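/- **Bernstein functions.** Let $\mathcal B$ be the set of functions $\phi\in C^\infty((0,\infty))$, $\phi\ge 0$, $\phi\not\equiv0$, whose derivative is completely monotone, i.e. $(-1)^n(\phi')^{(n)}\ge0$ on $(0,\infty)$ for all $n\ge0$. Every $\phi\in\mathcal B$ extends holomorphically to $\{\Re z>0\}$; the extension is again denoted by $\phi$. Put $$W_\phi(z)=\frac{e^{-\gamma_\phi z}}{\phi(z)}\prod_{k=1}^\infty\frac{\phi(k)}{\phi(k+z)}e^{\frac{\phi'(k)}{\phi(k)}z},\qquad \gamma_\phi=\lim_{n\to\infty}\Big(\sum_{k=1}^n\frac{\phi'(k)}{\phi(k)}-\ln\phi(n)\Big),$$ $$\Theta_\phi(a,|b|)=\int_{a/|b|}^\infty\ln\frac{|\phi(|b|y+i|b|)|}{\phi(|b|y)}\,dy\qquad(\Theta_\phi(a,0)=0).$$ **The class $\mathcal N$.** Let $\mathcal N$ be the set of functions $$\psi(z)=\sigma^2z^2+mz+\int_0^\infty(e^{-zy}-1+zy)\,\Pi(dy),\qquad \Re z\ge0,$$ with $\sigma,m\ge0$ and $\Pi$ a measure on $(0,\infty)$ with $\int_0^\infty(y^2\wedge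 y)\,\Pi(dy)<\infty$, where the linear functions $\psi(z)=mz$ ($\sigma=0$, $\Pi=0$) are excluded. Let $\overline\Pi(y)=\Pi([y,\infty))$, $\overline\Pi(0^+)=\Pi((0,\infty))$, and $$\phi(z)=m+\sigma^2z+\int_0^\infty(1-e^{-zy})\overline\Pi(y)\,dy,\qquad d_\phi=\sup\{u\le0:\ \phi(u)=-\infty\text{ or }\phi(u)=0\}.$$ Further: * $\psi\in\mathcal N_P$ if $\sigma>0$; $\psi\in\mathcal N_\infty$ if $\sigma>0$ or $\overline\Pi(0^+)=\infty$; $\psi\in\mathcal N_\alpha$ $(0<\alpha<1)$ if $\psi(u)\sim C u^{\alpha+1}$ as $u\to\infty$ for some $C>0$. * $\underline\Theta_\phi=\liminf_{|b|\to\infty}\Theta_\phi(0,|b|)$, and $\psi\in\mathcal N_{\underline\Theta}$ if $\underline\Theta_\phi>0$. * $\mathrm N_r=\infty$ if $\psi\in\mathcal N_\infty$, and $\mathrm N_r=\lceil\overline\Pi(0^+)/r\rceil-1$ with $r=\int_0^\infty\overline\Pi(y)\,dy+m$ otherwise. **Theorem.** 1. Let $\phi\in\mathcal B$. For $a>0$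 and $b\in\mathbb R$ the limit and the product defining $W_\phi(a+ib)$ converge, the integral $\Theta_\phi(a,|b|)$ is absolutely convergent, and $0\le\Theta_\phi(a,|b|)\le\frac\pi2$. For every $a_0>0$ there is a constant $c>0$, depending only on $a_0$, such that for all $\phi\in\mathcal B$, $a\ge a_0$ and $b\in\mathbb R$ $$c\,\frac{\sqrt{\phi(a)}\,W_\phi(a)}{\sqrt{|\phi(a+ib)|}}e^{-|b|\Theta_\phi(a,|b|)}\le|W_\phi(a+ib)|\le c^{-1}\frac{\sqrt{\phi(a)}\,W_\phi(a)}{\sqrt{|\phi(a+ib)|}}e^{-|b|\Theta_\phi(a,|b|)}.$$ 2. Let $\psi\in\mathcal N$. Then $\psi(z)=z\phi(z)$ for $\Re z\ge0$, $\phi\in\mathcal B$, and the limit and the product defining $W_\phi(z)$ converge for $\Re z>d_\phi$. (a) For every real $u\le\max(\mathrm N_r-1,0)$ and every $a>d_\phi$, $$\lim_{|b|\to\infty}|b|^u|W_\phi(a+ib)|=0.\qquad(*)$$ Moreover $\psi\in\mathcal N_\infty$ if and only if $(*)$ holds for all $u\ge0$ and all $a>d_\phi$. (b) The integrals $\Theta_\phi(0,|b|)$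 are absolutely convergent and $\underline\Theta_\phi\in[0,\frac\pi2]$. More specifically: * (i) if $\psi\in\mathcal N_P$, then $\underline\Theta_\phi=\frac\pi2$ and $\psi\in\mathcal N_{\underline\Theta}$; * (ii) if $\psi\in\mathcal N_\alpha$ with $\alpha\in(0,1)$, then $\underline\Theta_\phi=\frac\pi2\alpha$ and $\psi\in\mathcal N_{\underline\Theta}$; * (iii) if $\sigma=0$ and $\overline\Pi(y)=y^{-1}|\ln y|^2\,\mathbb I_{(0,1/2]}(y)$ for $y>0$ (such a $\psi$ exists for every $m\ge0$), then $\Theta_\phi(0,|b|)\sim\frac{3\pi}{2\ln|b|}$ as $|b|\to\infty$; for every $a>d_\phi$, $|W_\phi(a+ib)|=O\big(e^{-(\ln|b|)^3}\big)$ as $|b|\to\infty$; and $\psi\in\mathcal N_\infty\setminus\mathcal N_{\underline\Theta}$. -/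

import Mathlib

namespace BernsteinWeierstrass

open MeasureTheory Filter Topology Set

noncomputable section

/-- `g` is completely monotone on `(0, ∞)`: smooth there, with `(-1)ⁿ g⁽ⁿ⁾ ≥ 0` for all `n ≥ 0`. -/
structure IsCompletelyMonotone (g : ℝ → ℝ) : Prop where
  smooth : ContDiffOn ℝ (⊤ : ℕ∞) g (Ioi 0)
  alternating : ∀ n : ℕ, ∀ u : ℝ, 0 < u → 0 ≤ (-1 : ℝ) ^ n * iteratedDeriv n g u

/-- The class `ℬ` of Bernstein functions: smooth non-negative functions on `(0, ∞)`, not identically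
zero, with completely monotone derivative. Only the values on `(0, ∞)` matter. -/
structure IsBernstein (f : ℝ → ℝ) : Prop where
  smooth : ContDiffOn ℝ (⊤ : ℕ∞) f (Ioi 0)
  not_zero : ∃ u : ℝ, 0 < u ∧ f u ≠ 0
  nonneg : ∀ u : ℝ, 0 < u → 0 ≤ f u
  deriv_cm : IsCompletelyMonotone (deriv f)

/-- `F` is the holomorphic extension of `f : (0, ∞) → ℝ` to the open right half-plane
(there is at most one such function on that half-plane). -/
structure IsHolomorphicExtension (f : ℝ → ℝ) (F : ℂ → ℂ) : Prop where
  holomorphic : DifferentiableOn ℂ F {z : ℂ | 0 < z.re}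
  agrees : ∀ u : ℝ, 0 < u → F (u : ℂ) = (f u : ℂ)

/-! ### The generalized Weierstrass product -/

/-- The sequence `∑_{k=1}^n φ'(k)/φ(k) - ln φ(n)`. In all uses `φ` is positive on the positive
half-line, so that real parts and absolute values of `φ(k)`, `φ'(k)` are these numbers themselves. -/
def eulerSeq (φ : ℂ → ℂ) (n : ℕ) : ℝ :=
  (∑ k ∈ Finset.Icc 1 n, (deriv φ (k : ℂ) / φ (k : ℂ)).re) - Real.log ‖φ (n : ℂ)‖

/-- The generalized Euler constant `γ_φ`. -/
def eulerConst (φ : ℂ → ℂ) : ℝ := limUnder atTop (eulerSeq φ)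

/-- The factor of index `k` of the product: `φ(k)/φ(k+z) · exp (z φ'(k)/φ(k))`. -/
def weierstrassFactor (φ : ℂ → ℂ) (z : ℂ) (k : ℕ) : ℂ :=
  φ (k : ℂ) / φ ((k : ℂ) + z) * Complex.exp (deriv φ (k : ℂ) / φ (k : ℂ) * z)

/-- `W_φ(z) = e^{-γ_φ z} / φ(z) · ∏_{k ≥ 1} φ(k)/φ(k+z) e^{z φ'(k)/φ(k)}`. -/
def W (φ : ℂ → ℂ) (z : ℂ) : ℂ :=
  Complex.exp (-(eulerConst φ : ℂ) * z) / φ z * ∏' k : ℕ, weierstrassFactor φ z (k + 1)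

/-- The limit and the infinite product that define `W_φ(z)` converge. -/
def WConverges (φ : ℂ → ℂ) (z : ℂ) : Prop :=
  (∃ γ : ℝ, Tendsto (eulerSeq φ) atTop (𝓝 γ)) ∧
    Multipliable (fun k : ℕ => weierstrassFactor φ z (k + 1))

/-! ### The functions `Θ_φ` -/

/-- `y ↦ ln (|φ(by + ib)| / φ(by))`; in all uses `φ(by) > 0`, so that `φ(by) = |φ(by)|`. -/
def angleIntegrand (φ : ℂ → ℂ) (b y : ℝ) : ℝ :=
  Real.log (‖φ ((b * y : ℝ) + (b : ℂ) * Complex.I)‖ / ‖φ ((b * y : ℝ) : ℂ)‖)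

/-- `Θ_φ(a, b) = ∫_{a/b}^∞ ln (|φ(by + ib)| / φ(by)) dy`, for `a ≥ 0` and `b ≥ 0`
(for `b = 0` the integrand vanishes and the value is `0`). -/
def Theta (φ : ℂ → ℂ) (a b : ℝ) : ℝ :=
  ∫ y in Ioi (a / b), angleIntegrand φ b y

/-- `liminf_{|b| → ∞} ∫_0^∞ ln (|φ(|b|y + i|b|)| / φ(|b|y)) dy`. -/
def ThetaInf (φ : ℂ → ℂ) : ℝ :=
  liminf (fun b : ℝ => Theta φ 0 |b|) (cocompact ℝ)

/-! ### The class `𝒩` -/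

/-- Characteristic triplets `(σ, m, Π)` of the functions in `𝒩`: `σ, m ≥ 0` and `Π` is a measure
concentrated on `(0, ∞)` with `∫ (y² ∧ y) Π(dy) < ∞` (hence `σ`-finite). -/
structure Triplet where
  sigma : ℝ
  m : ℝ
  Pi : Measure ℝ
  sigma_nonneg : 0 ≤ sigma
  m_nonneg : 0 ≤ m
  concentrated : Pi (Iic 0) = 0
  integrability : ∫⁻ y, ENNReal.ofReal (min (y ^ 2) y) ∂Pi < ⊤

namespace Triplet

variable (T : Triplet)

/-- `ψ(z) = σ² z² + m z + ∫ (e^{-zy} - 1 + zy) Π(dy)`. -/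
def psi (z : ℂ) : ℂ :=
  (T.sigma : ℂ) ^ 2 * z ^ 2 + (T.m : ℂ) * z +
    ∫ y : ℝ, (Complex.exp (-z * (y : ℂ)) - 1 + z * (y : ℂ)) ∂T.Pi

/-- The tail `Π̄(y) = Π([y, ∞))`, for `y > 0`. -/
def tail (y : ℝ) : ℝ := (T.Pi (Ici y)).toReal

/-- `φ(z) = m + σ² z + ∫_0^∞ (1 - e^{-zy}) Π̄(y) dy`. -/
def phi (z : ℂ) : ℂ :=
  (T.m : ℂ) + (T.sigma : ℂ) ^ 2 * z +
    ∫ y in Ioi (0 : ℝ), (1 - Complex.exp (-z * (y : ℂ))) * (T.tail y : ℂ)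

/-- `d_φ = sup {u ≤ 0 : φ(u) = -∞ or φ(u) = 0}`. For `u ≤ 0` the integrand in `φ(u)` is
non-positive, so `φ(u) = -∞` means that it is not integrable. -/
def dphi : ℝ :=
  sSup {u : ℝ | u ≤ 0 ∧
    (¬ IntegrableOn (fun y : ℝ => (1 - Real.exp (-u * y)) * T.tail y) (Ioi 0) ∨
      T.phi (u : ℂ) = 0)}

/-- `Π̄(0+) = Π((0, ∞))`. -/
def tailZero : ENNReal := T.Pi (Ioi 0)

/-- The integrated tail at zero, `∫_0^∞ Π̄(y) dy`. -/
def intTailZero : ENNReal := ∫⁻ y in Ioi (0 : ℝ), T.Pi (Ici y)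

/-- `r = φ(∞)` in the case `σ = 0`, that is `∫_0^∞ Π̄(y) dy + m`. -/
def r : ENNReal := T.intTailZero + ENNReal.ofReal T.m

/-- `ψ ∈ 𝒩_P`. -/
def InNP : Prop := 0 < T.sigma

/-- `ψ ∈ 𝒩_∞`. -/
def InNInfty : Prop := 0 < T.sigma ∨ T.tailZero = ⊤

/-- `ψ ∈ 𝒩_α`: `ψ(u) ∼ C u^{α+1}` as `u → ∞` for some `C > 0`. -/
def InNAlpha (α : ℝ) : Prop :=
  ∃ C : ℝ, 0 < C ∧
    Tendsto (fun u : ℝ => (T.psi (u : ℂ)).re / (C * u ^ (α + 1))) atTop (𝓝 1)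

/-- `ψ ∈ 𝒩_Θ`. -/
def InNTheta : Prop := 0 < ThetaInf T.phi

open Classical in
/-- `N_r = ⌈Π̄(0+)/r⌉ - 1`, with value `∞` if `σ > 0` or `Π̄(0+) = ∞`. -/
def Nr : EReal :=
  if T.InNInfty then ⊤ else (((⌈(T.tailZero / T.r).toReal⌉ - 1 : ℤ) : ℝ) : EReal)

/-- `ψ` is not a linear function `u ↦ m u`, equivalently `φ` is not constant. -/
def Nondegenerate : Prop := 0 < T.sigma ∨ T.Pi ≠ 0

/-- `|b|^u |W_φ(a + ib)| → 0` as `|b| → ∞`. -/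
def DecaysOfOrder (a u : ℝ) : Prop :=
  Tendsto (fun b : ℝ => |b| ^ u * ‖W T.phi ((a : ℂ) + (b : ℂ) * Complex.I)‖)
    (cocompact ℝ) (𝓝 0)

/-- `σ = 0` and `Π̄(y) = y⁻¹ (ln y)²` for `0 < y ≤ 1/2`, `Π̄(y) = 0` for `y > 1/2`. -/
def IsLogExample : Prop :=
  T.sigma = 0 ∧ ∀ y : ℝ, 0 < y → T.tail y = if y ≤ 1 / 2 then y⁻¹ * Real.log y ^ 2 else 0

end Triplet

end

end BernsteinWeierstrass

namespace BernsteinWeierstrass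

open MeasureTheory Filter Topology Set

/-! ### Holomorphic extensions and their derivatives -/

/-! A discrete form of the Lévy–Khintchine formula carries the general theory. The Taylor
coefficients of a Bernstein function at `R` have fixed signs, so on the disc of radius `R` about `R`
it is a non-negative constant plus a non-negative combination of terms `1 - q ^ (k + 1)`. Putting `q
= exp (-z / n)` and `R = n → ∞` exhibits it as a pointwise limit of combinations of the functions `1
- exp (-z s)` (`IsBernstein.exists_approx`). Inequalities that hold for each such exponential
survive: `|F|` is controlled by `f` at the real part from both sides, and `|F'|`, `|F''|` by `f'`,
`-f''` there. Concavity then gives `|(log F)''| ≤ 5 / (Re z)²` for every Bernstein function, with no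
other constants.

This one bound makes the Weierstrass factors `1 + O(k⁻²)`. On the line `Re z = a` the product
becomes, in modulus, `|W(a)| exp (-∑ v(a + k))` with `v(x) = ln (|F(x + ib)| / F(x))`. The
trapezoidal rule compares the sum with `v(a)/2 + ∫ v`; the half term is the square root in the
estimate, the integral is `|b| Θ`, and the error is summable uniformly in `F`, `b` and `a ≥ a₀`
(`IsBernstein.W_bounds`). The bound `π/2` is the integral of `ln (|y + i| / y)`, which dominates
every integrand of `Θ`.

Limits of `Θ` come from dominated convergence. The limit of the rescaled function is known only on
the positive half-line, and a Vitali argument (`LocallyBoundedFamily.tendsto_zero`) carries it to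
complex arguments: `F(bz) / (C b^α) → z^α` under regular variation, and `(F(bz) - F(b)) / (ln b)² →
ln z` in the logarithmic example.

For decay, terms `v(a + k) ≥ 0` may be dropped from the sum, which needs only `|φ(a + ib)| ≥ φ(a) >
0` for `a > d_φ`. If `σ > 0` or `Π` is infinite, `v(x) ≥ ln (1 + x φ'(x)/φ(x)) - x²/(2b²)`
(`Triplet.Nondegenerate.vert_ge`), and `x² φ'(x)/φ(x) → ∞` makes every power available. If `Π` is
finite and `σ = 0`, `φ` tends to `r` with `x (r - φ(x)) → Π̄(0+)`, which gives every exponent below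
`Π̄(0+)/r`; conversely `v(x) ≤ C/x` then prevents decay faster than some power. In the logarithmic
example the same lower bound on about `√|b|` factors yields the decay rate. -/

theorem isOpen_rightHalfPlane : IsOpen {z : ℂ | 0 < z.re} :=
  isOpen_lt continuous_const Complex.continuous_re

theorem ball_subset_rightHalfPlane (R : ℝ) :
    Metric.ball (R : ℂ) R ⊆ {z : ℂ | 0 < z.re} := by
  intro z hz
  rw [Metric.mem_ball, dist_eq_norm] at hz
  have h := (abs_le.1 (Complex.abs_re_le_norm (z - R))).1
  simp only [Complex.sub_re, Complex.ofReal_re] at h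
  change 0 < z.re
  linarith

namespace IsHolomorphicExtension

variable {f : ℝ → ℝ} {F : ℂ → ℂ}

theorem differentiableAt (h : IsHolomorphicExtension f F) {z : ℂ} (hz : 0 < z.re) :
    DifferentiableAt ℂ F z :=
  (h.holomorphic z hz).differentiableAt (isOpen_rightHalfPlane.mem_nhds hz)

theorem continuousAt (h : IsHolomorphicExtension f F) {z : ℂ} (hz : 0 < z.re) :
    ContinuousAt F z :=
  (h.differentiableAt hz).continuousAt

theorem re_eq (h : IsHolomorphicExtension f F) {x : ℝ} (hx : 0 < x) : (F x).re = f x := by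
  rw [h.agrees x hx, Complex.ofReal_re]

theorem hasDerivAt_re (h : IsHolomorphicExtension f F) {x : ℝ} (hx : 0 < x) :
    HasDerivAt f (deriv F x).re x := by
  have h1 : HasDerivAt F (deriv F x) (x : ℂ) :=
    (h.differentiableAt (by simpa using hx)).hasDerivAt
  refine h1.real_of_complex.congr_of_eventuallyEq ?_
  filter_upwards [Ioi_mem_nhds hx] with u hu
  rw [h.re_eq hu]

theorem deriv_eq (h : IsHolomorphicExtension f F) {x : ℝ} (hx : 0 < x) :
    deriv F x = ((deriv f x : ℝ) : ℂ) := by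
  have h1 : HasDerivAt (fun u : ℝ => F u) (deriv F x) x :=
    (h.differentiableAt (by simpa using hx)).hasDerivAt.comp_ofReal
  have h2 : HasDerivAt (fun u : ℝ => (f u : ℂ)) ((deriv f x : ℝ) : ℂ) x :=
    (h.hasDerivAt_re hx).differentiableAt.hasDerivAt.ofReal_comp
  refine h1.unique (h2.congr_of_eventuallyEq ?_)
  filter_upwards [Ioi_mem_nhds hx] with u hu
  exact h.agrees u hu

protected theorem deriv (h : IsHolomorphicExtension f F) :
    IsHolomorphicExtension (deriv f) (deriv F) :=
  ⟨h.holomorphic.deriv isOpen_rightHalfPlane, fun _ hu => h.deriv_eq hu⟩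

theorem differentiableAt_real (h : IsHolomorphicExtension f F) {x : ℝ} (hx : 0 < x) :
    DifferentiableAt ℝ f x :=
  (h.hasDerivAt_re hx).differentiableAt

protected theorem iteratedDeriv (h : IsHolomorphicExtension f F) (n : ℕ) :
    IsHolomorphicExtension (iteratedDeriv n f) (iteratedDeriv n F) := by
  induction n with
  | zero => simpa using h
  | succ n ih =>
    rw [iteratedDeriv_succ, iteratedDeriv_succ]
    exact ih.deriv

/-- The Taylor expansion at `R` on the disc of radius `R`. -/
theorem hasSum_taylor (h : IsHolomorphicExtension f F) {R : ℝ} (hR : 0 < R) {q : ℂ}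
    (hq : ‖q‖ < 1) :
    HasSum (fun n : ℕ => (((-R) ^ n * iteratedDeriv n f R / n.factorial : ℝ) : ℂ) * q ^ n)
      (F (R * (1 - q))) := by
  have hz : (R : ℂ) * (1 - q) ∈ Metric.ball (R : ℂ) R := by
    rw [Metric.mem_ball, dist_eq_norm]
    have : (R : ℂ) * (1 - q) - R = -(R * q) := by ring
    rw [this, norm_neg, norm_mul, Complex.norm_real, Real.norm_of_nonneg hR.le]
    nlinarith
  have := Complex.hasSum_taylorSeries_on_ball
    (h.holomorphic.mono (ball_subset_rightHalfPlane R)) hz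
  convert! this using 1
  funext n
  have h2 := (h.iteratedDeriv n).agrees R hR
  rw [h2]
  have : (R : ℂ) * (1 - q) - R = -R * q := by ring
  rw [this, mul_pow]
  push_cast
  simp only [smul_eq_mul]
  ring

end IsHolomorphicExtension

namespace IsBernstein

variable {f : ℝ → ℝ} {F : ℂ → ℂ}

theorem alternating (hf : IsBernstein f) (n : ℕ) {u : ℝ} (hu : 0 < u) :
    0 ≤ (-1 : ℝ) ^ n * iteratedDeriv (n + 1) f u := by
  rw [iteratedDeriv_succ']
  exact hf.deriv_cm.alternating n u hu

/-- On the disc of radius `R` about `R`, a Bernstein function is a constant plus a sum of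
`d k * (1 - q ^ (k + 1))` with non-negative summable coefficients. -/
theorem exists_discrete (hf : IsBernstein f) (h : IsHolomorphicExtension f F) {R : ℝ}
    (hR : 0 < R) :
    ∃ A : ℝ, 0 ≤ A ∧ ∃ d : ℕ → ℝ, (∀ k, 0 ≤ d k) ∧
      ∀ q : ℂ, ‖q‖ < 1 →
        HasSum (fun k => (d k : ℂ) * (1 - q ^ (k + 1))) (F (R * (1 - q)) - A) := by
  -- The negatives of the Taylor coefficients of positive degree; the alternating signs of the
  -- derivatives make them non-negative.
  set d : ℕ → ℝ := fun k => -((-R) ^ (k + 1) * iteratedDeriv (k + 1) f R / (k + 1).factorial)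
    with hd
  have hd0 : ∀ k, 0 ≤ d k := by
    intro k
    have h1 := hf.alternating k hR
    have h2 : d k = R ^ (k + 1) * ((-1) ^ k * iteratedDeriv (k + 1) f R) /
        (k + 1).factorial := by
      simp only [hd]
      rw [neg_pow R, pow_succ (-1 : ℝ) k]
      ring
    rw [h2]
    positivity
  have hs : ∀ q : ℂ, ‖q‖ < 1 →
      HasSum (fun k => (d k : ℂ) * q ^ (k + 1)) ((f R : ℂ) - F (R * (1 - q))) := by
    intro q hq
    have h1 := ((hasSum_nat_add_iff' 1).2 (h.hasSum_taylor hR hq)).neg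
    convert! h1 using 1
    · funext k
      simp only [hd]
      push_cast
      ring
    · simp
  -- For real `q < 1` the full sum is `f R - f (R (1 - q)) ≤ f R`; letting `q` increase to `1` in a
  -- finite partial sum bounds the coefficients themselves.
  have hle : ∀ n, ∑ k ∈ Finset.range n, d k ≤ f R := by
    intro n
    have h1 : Tendsto (fun q : ℝ => ∑ k ∈ Finset.range n, d k * q ^ (k + 1)) (𝓝[<] 1)
        (𝓝 (∑ k ∈ Finset.range n, d k * (1 : ℝ) ^ (k + 1))) := by
      refine Tendsto.mono_left ?_ nhdsWithin_le_nhds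
      exact Continuous.tendsto (by fun_prop) 1
    simp only [one_pow, mul_one] at h1
    refine le_of_tendsto h1 ?_
    filter_upwards [Ioo_mem_nhdsLT (zero_lt_one' ℝ)] with q hq
    have hq1 : ‖(q : ℂ)‖ < 1 := by
      rw [Complex.norm_real, Real.norm_of_nonneg hq.1.le]
      exact hq.2
    have hpos : 0 < R * (1 - q) := mul_pos hR (by linarith [hq.2])
    have h2 : HasSum (fun k => d k * q ^ (k + 1)) (f R - f (R * (1 - q))) := by
      have h3 := hs q hq1
      have h4 : F (R * (1 - (q : ℂ))) = (f (R * (1 - q)) : ℂ) := by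
        rw [← h.agrees _ hpos]
        push_cast
        rfl
      rw [h4] at h3
      exact_mod_cast h3
    have h5 := h2.tsum_eq ▸ h2.summable.sum_le_tsum (Finset.range n)
      (fun k _ => mul_nonneg (hd0 k) (pow_nonneg hq.1.le _))
    linarith [hf.nonneg _ hpos]
  have hsum : Summable d := summable_of_sum_range_le hd0 hle
  -- The constant term is the limit of `f` at zero, written as what the summable coefficients leave
  -- of `f R`.
  refine ⟨f R - ∑' k, d k, sub_nonneg.2 (Real.tsum_le_of_sum_range_le hd0 hle), d, hd0, ?_⟩
  intro q hq
  have h1 : HasSum (fun k => (d k : ℂ)) ((∑' k, d k : ℝ) : ℂ) := by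
    exact_mod_cast hsum.hasSum
  convert! h1.sub (hs q hq) using 1
  · funext k
    ring
  · push_cast
    ring

theorem tendsto_mul_one_sub_exp (z : ℂ) :
    Tendsto (fun n : ℕ => ((n : ℝ) : ℂ) * (1 - Complex.exp (-z / n))) atTop (𝓝 z) := by
  have h1 : HasDerivAt (fun t : ℂ => Complex.exp (-z * t)) (-z) 0 := by
    have := ((hasDerivAt_id (0 : ℂ)).const_mul (-z)).cexp
    simpa using this
  have h2 := h1.tendsto_slope_zero
  have h3 : Tendsto (fun n : ℕ => ((n : ℂ))⁻¹) atTop (𝓝[≠] 0) := by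
    refine tendsto_nhdsWithin_iff.2 ⟨tendsto_inv_atTop_nhds_zero_nat, ?_⟩
    filter_upwards [eventually_gt_atTop 0] with n hn
    simpa using hn.ne'
  have h4 := (h2.comp h3).neg
  rw [neg_neg] at h4
  refine h4.congr fun n => ?_
  simp only [Function.comp_apply, zero_add, mul_zero, Complex.exp_zero, inv_inv, smul_eq_mul,
    Complex.ofReal_natCast, div_eq_mul_inv]
  ring

theorem norm_exp_neg_div_lt_one {z : ℂ} (hz : 0 < z.re) {n : ℕ} (hn : 0 < n) :
    ‖Complex.exp (-z / n)‖ < 1 := by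
  rw [Complex.norm_exp, Real.exp_lt_one_iff]
  have : (-z / (n : ℂ)).re = -z.re / n := by
    rw [Complex.div_natCast_re, Complex.neg_re]
  rw [this]
  have : (0 : ℝ) < n := by exact_mod_cast hn
  rw [neg_div]
  exact neg_neg_of_pos (by positivity)

/-- A closed property that holds for all functions `A + ∑ d k * (1 - exp (-z s_k))`
with `A, d k ≥ 0` and `s_k > 0` holds for all Bernstein functions. -/
theorem exists_approx (hf : IsBernstein f) (h : IsHolomorphicExtension f F) :
    ∃ G : ℕ → ℂ → ℂ, (∀ z : ℂ, 0 < z.re → Tendsto (fun n => G n z) atTop (𝓝 (F z))) ∧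
      ∀ n, 0 < n → ∃ A : ℝ, 0 ≤ A ∧ ∃ d s : ℕ → ℝ, (∀ k, 0 ≤ d k) ∧ (∀ k, 0 < s k) ∧
        ∀ z : ℂ, 0 < z.re →
          HasSum (fun k => (d k : ℂ) * (1 - Complex.exp (-z * s k))) (G n z - A) := by
  -- With `R = n` and `q = exp (-z / n)` the powers `q ^ (k + 1)` become exponentials with `s_k = (k
  -- + 1) / n`, while the argument `n (1 - q)` tends to `z`.
  refine ⟨fun n z => F (((n : ℝ) : ℂ) * (1 - Complex.exp (-z / n))), fun z hz => ?_, ?_⟩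
  · exact (h.continuousAt hz).tendsto.comp (tendsto_mul_one_sub_exp z)
  · intro n hn
    have hn' : (0 : ℝ) < n := by exact_mod_cast hn
    obtain ⟨A, hA, d, hd, hs⟩ := hf.exists_discrete h hn'
    refine ⟨A, hA, d, fun k => (k + 1) / n, hd, fun k => by positivity, fun z hz => ?_⟩
    convert! hs _ (norm_exp_neg_div_lt_one hz hn) using 4 with k
    rw [← Complex.exp_nat_mul]
    congr 1
    push_cast
    ring

end IsBernstein

/-! ### Inequalities for Bernstein functions on the right half-plane -/

/-- Along `t ↦ t z` the left side has derivative of modulus `‖z‖ exp (-t Re z)`, which is exactly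
the derivative of the right side. -/
theorem norm_one_sub_exp_neg_le {z : ℂ} (hz : 0 < z.re) :
    ‖1 - Complex.exp (-z)‖ ≤ ‖z‖ / z.re * (1 - Real.exp (-z.re)) := by
  have hf : ∀ t : ℝ, HasDerivAt (fun t : ℝ => 1 - Complex.exp (-z * t))
      (z * Complex.exp (-z * t)) t := by
    intro t
    have h1 : HasDerivAt (fun t : ℂ => 1 - Complex.exp (-z * t)) (z * Complex.exp (-z * t))
        (t : ℂ) := by
      have := (((hasDerivAt_id (t : ℂ)).const_mul (-z)).cexp).const_sub 1
      convert! this using 1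
      simp only [id, mul_one]
      ring
    exact h1.comp_ofReal
  have hB : ∀ t : ℝ, HasDerivAt (fun t : ℝ => ‖z‖ / z.re * (1 - Real.exp (-z.re * t)))
      (‖z‖ * Real.exp (-z.re * t)) t := by
    intro t
    have := ((((hasDerivAt_id t).const_mul (-z.re)).exp).const_sub 1).const_mul (‖z‖ / z.re)
    convert! this using 1
    simp only [id, mul_one]
    field_simp
  have h := image_norm_le_of_norm_deriv_right_le_deriv_boundary
    (f := fun t : ℝ => 1 - Complex.exp (-z * t)) (a := 0) (b := 1)
    (fun t _ => (hf t).continuousAt.continuousWithinAt) (fun t _ => (hf t).hasDerivWithinAt)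
    (B := fun t : ℝ => ‖z‖ / z.re * (1 - Real.exp (-z.re * t))) (by simp) hB
    (by
      intro t _
      rw [norm_mul, Complex.norm_exp]
      simp)
    (x := 1) (by simp)
  simpa using h

theorem hasSum_re_of_hasSum_ofReal {g : ℕ → ℝ} {w : ℂ} (h : HasSum (fun k => (g k : ℂ)) w) :
    HasSum g w.re := by
  simpa using Complex.hasSum_re h

namespace IsBernstein

variable {f : ℝ → ℝ} {F : ℂ → ℂ}

/-- The ratio `‖z‖ / z.re` is invariant under scaling by `s_k`, so the estimate for one exponential
applies to all terms with the same factor; the constant `A` is absorbed because the ratio is at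
least one. -/
theorem norm_le (hf : IsBernstein f) (h : IsHolomorphicExtension f F) {z : ℂ} (hz : 0 < z.re) :
    ‖F z‖ ≤ ‖z‖ / z.re * f z.re := by
  obtain ⟨G, hG, hd⟩ := hf.exists_approx h
  have hx : 0 < ((z.re : ℝ) : ℂ).re := by simpa using hz
  have h1 := (Complex.continuous_re.tendsto _).comp (hG z.re hx)
  rw [h.re_eq hz] at h1
  refine le_of_tendsto_of_tendsto (hG z hz).norm (h1.const_mul (‖z‖ / z.re)) ?_
  filter_upwards [eventually_gt_atTop 0] with n hn
  obtain ⟨A, hA, d, s, hd0, hs0, hsum⟩ := hd n hn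
  have h2 : HasSum (fun k => d k * (1 - Real.exp (-z.re * s k))) ((G n z.re).re - A) := by
    have h3 := hsum z.re hx
    have h4 := hasSum_re_of_hasSum_ofReal (g := fun k => d k * (1 - Real.exp (-z.re * s k)))
      (by convert! h3 using 2; push_cast; rfl)
    simpa using h4
  have h5 : ‖G n z - A‖ ≤ ‖z‖ / z.re * ((G n z.re).re - A) := by
    refine (hsum z hz).norm_le_of_bounded (h2.mul_left (‖z‖ / z.re)) fun k => ?_
    rw [norm_mul, Complex.norm_real, Real.norm_of_nonneg (hd0 k)]
    have h6 : 0 < (z * s k).re := by simpa using mul_pos hz (hs0 k)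
    have h7 := norm_one_sub_exp_neg_le h6
    have h8 : (z * (s k : ℂ)).re = z.re * s k := by simp
    rw [norm_mul, Complex.norm_real, Real.norm_of_nonneg (hs0 k).le, h8,
      mul_div_mul_right _ _ (hs0 k).ne', ← neg_mul, ← neg_mul] at h7
    calc d k * ‖1 - Complex.exp (-z * s k)‖
        ≤ d k * (‖z‖ / z.re * (1 - Real.exp (-z.re * s k))) :=
          mul_le_mul_of_nonneg_left h7 (hd0 k)
      _ = _ := by ring
  have h9 : 1 ≤ ‖z‖ / z.re := by
    rw [one_le_div hz]
    exact (le_abs_self _).trans (Complex.abs_re_le_norm z)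
  calc ‖G n z‖ = ‖(G n z - A) + A‖ := by rw [sub_add_cancel]
    _ ≤ ‖z‖ / z.re * ((G n z.re).re - A) + A := by
      refine (norm_add_le _ _).trans (add_le_add h5 ?_)
      rw [Complex.norm_real, Real.norm_of_nonneg hA]
    _ ≤ ‖z‖ / z.re * (G n z.re).re := by nlinarith

/-- Termwise this is `cos ≤ 1`. -/
theorem le_re (hf : IsBernstein f) (h : IsHolomorphicExtension f F) {z : ℂ} (hz : 0 < z.re) :
    f z.re ≤ (F z).re := by
  obtain ⟨G, hG, hd⟩ := hf.exists_approx h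
  have hx : 0 < ((z.re : ℝ) : ℂ).re := by simpa using hz
  have h1 := (Complex.continuous_re.tendsto _).comp (hG z.re hx)
  rw [h.re_eq hz] at h1
  refine le_of_tendsto_of_tendsto h1 ((Complex.continuous_re.tendsto _).comp (hG z hz)) ?_
  filter_upwards [eventually_gt_atTop 0] with n hn
  obtain ⟨A, hA, d, s, hd0, hs0, hsum⟩ := hd n hn
  have h2 := hasSum_le (fun k => ?_) (Complex.hasSum_re (hsum z.re hx))
    (Complex.hasSum_re (hsum z hz))
  · simpa using h2
  · rw [Complex.re_ofReal_mul, Complex.re_ofReal_mul]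
    refine mul_le_mul_of_nonneg_left ?_ (hd0 k)
    have h3 : Real.cos (z.im * s k) ≤ 1 := Real.cos_le_one _
    have h4 := Real.exp_pos (-(z.re * s k))
    simp only [Complex.sub_re, Complex.one_re, Complex.exp_re]
    simp
    nlinarith

theorem map_conj (hf : IsBernstein f) (h : IsHolomorphicExtension f F) {z : ℂ} (hz : 0 < z.re) :
    F (starRingEnd ℂ z) = starRingEnd ℂ (F z) := by
  obtain ⟨G, hG, hd⟩ := hf.exists_approx h
  refine tendsto_nhds_unique (hG _ (by simpa using hz))
    ((((Complex.continuous_conj.tendsto _).comp (hG z hz))).congr' ?_)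
  filter_upwards [eventually_gt_atTop 0] with n hn
  obtain ⟨A, hA, d, s, hd0, hs0, hsum⟩ := hd n hn
  have h1 := hsum _ (show 0 < (starRingEnd ℂ z).re by simpa using hz)
  have h2 := Complex.hasSum_conj'.2 (hsum z hz)
  have h3 : starRingEnd ℂ (G n z - A) = G n (starRingEnd ℂ z) - A := by
    refine h2.unique ?_
    convert! h1 using 2 with k
    simp [← Complex.exp_conj]
  rw [map_sub, Complex.conj_ofReal] at h3
  exact sub_left_injective h3

/-- The increment of one term is a non-negative number times `exp (-z s)`, whose modulus is its
value at `Re z`. Increments are used here, and second differences next, because pointwise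
convergence of the approximants passes them to the limit directly; derivatives are recovered
afterwards. -/
theorem norm_sub_le (hf : IsBernstein f) (h : IsHolomorphicExtension f F) {z : ℂ}
    (hz : 0 < z.re) {t : ℝ} (ht : 0 ≤ t) :
    ‖F (z + t) - F z‖ ≤ f (z.re + t) - f z.re := by
  obtain ⟨G, hG, hd⟩ := hf.exists_approx h
  have hx : 0 < ((z.re : ℝ) : ℂ).re := by simpa using hz
  have hx' : 0 < ((z.re + t : ℝ) : ℂ).re := by simpa using add_pos_of_pos_of_nonneg hz ht
  have hzt : 0 < (z + t).re := by simpa using add_pos_of_pos_of_nonneg hz ht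
  have h1 := (Complex.continuous_re.tendsto _).comp ((hG _ hx').sub (hG _ hx))
  rw [Complex.sub_re, h.re_eq hz, h.re_eq (by simpa using hx')] at h1
  refine le_of_tendsto_of_tendsto ((hG _ hzt).sub (hG _ hz)).norm h1 ?_
  filter_upwards [eventually_gt_atTop 0] with n hn
  obtain ⟨A, hA, d, s, hd0, hs0, hsum⟩ := hd n hn
  have h2 := (hsum _ hzt).sub (hsum _ hz)
  have h3 := Complex.hasSum_re ((hsum _ hx').sub (hsum _ hx))
  rw [sub_sub_sub_cancel_right] at h2 h3
  refine h2.norm_le_of_bounded h3 fun k => ?_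
  have e1 : ∀ w : ℂ, (d k : ℂ) * (1 - Complex.exp (-(w + t) * s k)) -
      d k * (1 - Complex.exp (-w * s k)) =
      ((d k * (1 - Real.exp (-t * s k)) : ℝ) : ℂ) * Complex.exp (-w * s k) := by
    intro w
    rw [show -(w + t) * (s k : ℂ) = -w * s k + -t * s k by ring, Complex.exp_add]
    push_cast
    ring
  have e2 : 0 ≤ d k * (1 - Real.exp (-t * s k)) :=
    mul_nonneg (hd0 k) (by
      rw [sub_nonneg, Real.exp_le_one_iff]
      nlinarith [hs0 k])
  rw [e1, show ((z.re + t : ℝ) : ℂ) = (z.re : ℂ) + t by push_cast; rfl, e1, norm_mul,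
    Complex.norm_real, Real.norm_of_nonneg e2, Complex.re_ofReal_mul, Complex.norm_exp]
  refine le_of_eq ?_
  rw [show -(z.re : ℂ) * (s k : ℂ) = ((-z.re * s k : ℝ) : ℂ) by push_cast; rfl,
    ← Complex.ofReal_exp, Complex.ofReal_re]
  simp

/-- The second difference of one term carries the factor `-(1 - exp (-t s)) (1 - exp (-u s))`, of
constant sign. This is the finite form of `|F''| ≤ -f''`. -/
theorem norm_mixed_difference_le (hf : IsBernstein f) (h : IsHolomorphicExtension f F) {z : ℂ}
    (hz : 0 < z.re) {t u : ℝ} (ht : 0 ≤ t) (hu : 0 ≤ u) :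
    ‖(F (z + u + t) - F (z + u)) - (F (z + t) - F z)‖ ≤
      -((f (z.re + u + t) - f (z.re + u)) - (f (z.re + t) - f z.re)) := by
  obtain ⟨G, hG, hd⟩ := hf.exists_approx h
  have hx1 : 0 < ((z.re : ℝ) : ℂ).re := by simpa using hz
  have hx2 : 0 < ((z.re + t : ℝ) : ℂ).re := by simpa using add_pos_of_pos_of_nonneg hz ht
  have hx3 : 0 < ((z.re + u : ℝ) : ℂ).re := by simpa using add_pos_of_pos_of_nonneg hz hu
  have hx4 : 0 < ((z.re + u + t : ℝ) : ℂ).re := by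
    simpa using add_pos_of_pos_of_nonneg (add_pos_of_pos_of_nonneg hz hu) ht
  have hz2 : 0 < (z + t).re := by simpa using hx2
  have hz3 : 0 < (z + u).re := by simpa using hx3
  have hz4 : 0 < (z + u + t).re := by simpa using hx4
  have h1 := (Complex.continuous_re.tendsto _).comp
    (((hG _ hx4).sub (hG _ hx3)).sub ((hG _ hx2).sub (hG _ hx1))).neg
  rw [Complex.neg_re, Complex.sub_re, Complex.sub_re, Complex.sub_re, h.re_eq hz,
    h.re_eq (by simpa using hx4), h.re_eq (by simpa using hx3), h.re_eq (by simpa using hx2)] at h1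
  refine le_of_tendsto_of_tendsto
    (((hG _ hz4).sub (hG _ hz3)).sub ((hG _ hz2).sub (hG _ hz))).norm h1 ?_
  filter_upwards [eventually_gt_atTop 0] with n hn
  obtain ⟨A, hA, d, s, hd0, hs0, hsum⟩ := hd n hn
  have h2 := ((hsum _ hz4).sub (hsum _ hz3)).sub ((hsum _ hz2).sub (hsum _ hz))
  have h3 := Complex.hasSum_re
    (((hsum _ hx4).sub (hsum _ hx3)).sub ((hsum _ hx2).sub (hsum _ hx1))).neg
  simp only [sub_sub_sub_cancel_right] at h2 h3
  refine h2.norm_le_of_bounded h3 fun k => ?_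
  have e1 : ∀ w : ℂ, (d k : ℂ) * (1 - Complex.exp (-(w + u + t) * s k)) -
      d k * (1 - Complex.exp (-(w + u) * s k)) - (d k * (1 - Complex.exp (-(w + t) * s k)) -
      d k * (1 - Complex.exp (-w * s k))) =
      -(((d k * (1 - Real.exp (-t * s k)) * (1 - Real.exp (-u * s k)) : ℝ) : ℂ) *
        Complex.exp (-w * s k)) := by
    intro w
    rw [show -(w + u + t) * (s k : ℂ) = -w * s k + -u * s k + -t * s k by ring,
      show -(w + u) * (s k : ℂ) = -w * s k + -u * s k by ring,
      show -(w + t) * (s k : ℂ) = -w * s k + -t * s k by ring, Complex.exp_add,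
      Complex.exp_add, Complex.exp_add]
    push_cast
    ring
  have e3 : ∀ v : ℝ, 0 ≤ v → 0 ≤ 1 - Real.exp (-v * s k) := by
    intro v hv
    rw [sub_nonneg, Real.exp_le_one_iff]
    nlinarith [hs0 k]
  have e2 : 0 ≤ d k * (1 - Real.exp (-t * s k)) * (1 - Real.exp (-u * s k)) :=
    mul_nonneg (mul_nonneg (hd0 k) (e3 t ht)) (e3 u hu)
  rw [e1, show ((z.re + t : ℝ) : ℂ) = (z.re : ℂ) + t by push_cast; rfl,
    show ((z.re + u : ℝ) : ℂ) = (z.re : ℂ) + u by push_cast; rfl,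
    show ((z.re + u + t : ℝ) : ℂ) = (z.re : ℂ) + u + t by push_cast; rfl, e1, norm_neg, norm_mul,
    neg_neg, Complex.norm_real, Real.norm_of_nonneg e2, Complex.re_ofReal_mul, Complex.norm_exp]
  refine le_of_eq ?_
  rw [show -(z.re : ℂ) * (s k : ℂ) = ((-z.re * s k : ℝ) : ℂ) by push_cast; rfl,
    ← Complex.ofReal_exp, Complex.ofReal_re]
  simp

end IsBernstein

/-- Divide the increments by `t` and let `t` decrease to zero. -/
theorem norm_hasDerivAt_le_of_increment_le {G : ℂ → ℂ} {g : ℝ → ℝ} {z G' : ℂ} {x g' : ℝ}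
    (hG : HasDerivAt G G' z) (hg : HasDerivAt g g' x)
    (h : ∀ t : ℝ, 0 < t → ‖G (z + t) - G z‖ ≤ g (x + t) - g x) : ‖G'‖ ≤ g' := by
  have h1 : HasDerivAt (fun t : ℝ => G (z + t)) G' 0 := by
    have h2 : HasDerivAt (fun w : ℂ => G (z + w)) G' ((0 : ℝ) : ℂ) := by
      apply HasDerivAt.comp_const_add
      simpa using hG
    exact h2.comp_ofReal
  refine le_of_tendsto_of_tendsto h1.tendsto_slope_zero_right.norm hg.tendsto_slope_zero_right ?_
  filter_upwards [self_mem_nhdsWithin] with t ht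
  have ht' : 0 < t := ht
  rw [norm_smul, norm_inv, Real.norm_of_nonneg ht'.le, smul_eq_mul]
  refine mul_le_mul_of_nonneg_left ?_ (inv_nonneg.2 ht'.le)
  simpa using h t ht'

/-! ### Derivatives of Bernstein functions and of their logarithms. -/

namespace IsBernstein

variable {f : ℝ → ℝ} {F : ℂ → ℂ}

theorem norm_deriv_le (hf : IsBernstein f) (h : IsHolomorphicExtension f F) {z : ℂ}
    (hz : 0 < z.re) : ‖deriv F z‖ ≤ deriv f z.re :=
  norm_hasDerivAt_le_of_increment_le (h.differentiableAt hz).hasDerivAt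
    (h.differentiableAt_real hz).hasDerivAt fun _ ht => hf.norm_sub_le h hz ht.le

theorem norm_deriv_sub_le (hf : IsBernstein f) (h : IsHolomorphicExtension f F) {z : ℂ}
    (hz : 0 < z.re) {t : ℝ} (ht : 0 ≤ t) :
    ‖deriv F (z + t) - deriv F z‖ ≤ -(deriv f (z.re + t) - deriv f z.re) := by
  have hzt : 0 < (z + t).re := by simpa using add_pos_of_pos_of_nonneg hz ht
  have hxt : 0 < z.re + t := add_pos_of_pos_of_nonneg hz ht
  have h1 : HasDerivAt (fun w => F (w + t) - F w) (deriv F (z + t) - deriv F z) z :=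
    ((h.differentiableAt hzt).hasDerivAt.comp_add_const z t).sub
      (h.differentiableAt hz).hasDerivAt
  have h2 : HasDerivAt (fun u => -(f (u + t) - f u)) (-(deriv f (z.re + t) - deriv f z.re)) z.re :=
    (((h.differentiableAt_real hxt).hasDerivAt.comp_add_const z.re t).sub
      (h.differentiableAt_real hz).hasDerivAt).neg
  refine norm_hasDerivAt_le_of_increment_le h1 h2 fun u hu => ?_
  have h3 := hf.norm_mixed_difference_le h hz ht hu.le
  refine h3.trans (le_of_eq ?_)
  ring

theorem norm_deriv_deriv_le (hf : IsBernstein f) (h : IsHolomorphicExtension f F) {z : ℂ}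
    (hz : 0 < z.re) : ‖deriv (deriv F) z‖ ≤ -deriv (deriv f) z.re := by
  refine norm_hasDerivAt_le_of_increment_le (h.deriv.differentiableAt hz).hasDerivAt
    (h.deriv.differentiableAt_real hz).hasDerivAt.neg fun t ht => ?_
  refine (hf.norm_deriv_sub_le h hz ht.le).trans (le_of_eq ?_)
  simp only [Pi.neg_apply]
  ring

theorem deriv_nonneg (hf : IsBernstein f) {x : ℝ} (hx : 0 < x) : 0 ≤ deriv f x := by
  simpa using hf.alternating 0 hx

theorem deriv_deriv_nonpos (hf : IsBernstein f) {x : ℝ} (hx : 0 < x) :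
    deriv (deriv f) x ≤ 0 := by
  simpa [iteratedDeriv_succ] using hf.alternating 1 hx

theorem monotoneOn (hf : IsBernstein f) (h : IsHolomorphicExtension f F) :
    MonotoneOn f (Ioi 0) := by
  refine monotoneOn_of_deriv_nonneg (convex_Ioi 0)
    (fun x hx => (h.differentiableAt_real hx).continuousAt.continuousWithinAt)
    (fun x hx => ?_) (fun x hx => ?_)
  · rw [interior_Ioi] at hx
    exact (h.differentiableAt_real hx).differentiableWithinAt
  · rw [interior_Ioi] at hx
    exact hf.deriv_nonneg hx

theorem antitoneOn_deriv (hf : IsBernstein f) (h : IsHolomorphicExtension f F) :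
    AntitoneOn (deriv f) (Ioi 0) := by
  refine antitoneOn_of_deriv_nonpos (convex_Ioi 0)
    (fun x hx => (h.deriv.differentiableAt_real hx).continuousAt.continuousWithinAt)
    (fun x hx => ?_) (fun x hx => ?_)
  · rw [interior_Ioi] at hx
    exact (h.deriv.differentiableAt_real hx).differentiableWithinAt
  · rw [interior_Ioi] at hx
    exact hf.deriv_deriv_nonpos hx

theorem monotoneOn_deriv_deriv (hf : IsBernstein f) (h : IsHolomorphicExtension f F) :
    MonotoneOn (deriv (deriv f)) (Ioi 0) := by
  refine monotoneOn_of_deriv_nonneg (convex_Ioi 0)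
    (fun x hx => (h.deriv.deriv.differentiableAt_real hx).continuousAt.continuousWithinAt)
    (fun x hx => ?_) (fun x hx => ?_)
  · rw [interior_Ioi] at hx
    exact (h.deriv.deriv.differentiableAt_real hx).differentiableWithinAt
  · rw [interior_Ioi] at hx
    simpa [iteratedDeriv_succ] using hf.alternating 2 hx

/-- A zero at `x` forces `f = 0` on `(0, x)` by monotonicity, hence `F = 0` on the strip `0 < Re z <
x` by `norm_le`, hence `F = 0` everywhere by the identity theorem. -/
theorem pos (hf : IsBernstein f) (h : IsHolomorphicExtension f F) {x : ℝ} (hx : 0 < x) :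
    0 < f x := by
  refine lt_of_le_of_ne (hf.nonneg x hx) fun h0 => ?_
  obtain ⟨u, hu, hu0⟩ := hf.not_zero
  have h1 : ∀ z : ℂ, 0 < z.re → z.re < x → F z = 0 := by
    intro z hz hzx
    have h2 : f z.re = 0 :=
      le_antisymm (h0 ▸ hf.monotoneOn h hz hx hzx.le) (hf.nonneg _ hz)
    have h3 := hf.norm_le h hz
    rw [h2, mul_zero] at h3
    exact norm_le_zero_iff.1 h3
  have hA : AnalyticOnNhd ℂ F {z : ℂ | 0 < z.re} :=
    h.holomorphic.analyticOnNhd isOpen_rightHalfPlane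
  have h4 := hA.eqOn_zero_of_preconnected_of_eventuallyEq_zero
    (convex_halfSpace_re_gt 0).isPreconnected (z₀ := ((x / 2 : ℝ) : ℂ))
    (by change 0 < ((x / 2 : ℝ) : ℂ).re; rw [Complex.ofReal_re]; linarith)
    (by
      have h5 : {z : ℂ | 0 < z.re ∧ z.re < x} ∈ 𝓝 ((x / 2 : ℝ) : ℂ) := by
        refine (isOpen_rightHalfPlane.inter
          (isOpen_lt Complex.continuous_re continuous_const)).mem_nhds ?_
        change 0 < ((x / 2 : ℝ) : ℂ).re ∧ ((x / 2 : ℝ) : ℂ).re < x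
        rw [Complex.ofReal_re]
        constructor <;> linarith
      filter_upwards [h5] with z hz
      exact h1 z hz.1 hz.2)
  have h6 := h4 (show (u : ℂ) ∈ {z : ℂ | 0 < z.re} by simpa using hu)
  rw [h.agrees u hu] at h6
  exact hu0 (by simpa using h6)

theorem re_pos (hf : IsBernstein f) (h : IsHolomorphicExtension f F) {z : ℂ} (hz : 0 < z.re) :
    0 < (F z).re :=
  (hf.pos h hz).trans_le (hf.le_re h hz)

theorem le_norm (hf : IsBernstein f) (h : IsHolomorphicExtension f F) {z : ℂ} (hz : 0 < z.re) :
    f z.re ≤ ‖F z‖ :=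
  (hf.le_re h hz).trans ((le_abs_self _).trans (Complex.abs_re_le_norm _))

theorem ne_zero (hf : IsBernstein f) (h : IsHolomorphicExtension f F) {z : ℂ} (hz : 0 < z.re) :
    F z ≠ 0 :=
  norm_pos_iff.1 ((hf.pos h hz).trans_le (hf.le_norm h hz))

theorem sub_mul_deriv_le (hf : IsBernstein f) (h : IsHolomorphicExtension f F) {y x : ℝ}
    (hy : 0 < y) (hyx : y < x) : (x - y) * deriv f x ≤ f x - f y := by
  obtain ⟨c, hc, hc'⟩ := exists_deriv_eq_slope f hyx
    (fun u hu => (h.differentiableAt_real (hy.trans_le hu.1)).continuousAt.continuousWithinAt)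
    (fun u hu => (h.differentiableAt_real (hy.trans hu.1)).differentiableWithinAt)
  have h1 := hf.antitoneOn_deriv h (hy.trans hc.1) (hy.trans hyx) hc.2.le
  rw [hc', le_div_iff₀ (sub_pos.2 hyx)] at h1
  linarith

/-- Concavity: compare the tangent slope at `x` with the chord from `y` to `x`, let `y → 0` and use
`f ≥ 0`. -/
theorem mul_deriv_le (hf : IsBernstein f) (h : IsHolomorphicExtension f F) {x : ℝ}
    (hx : 0 < x) : x * deriv f x ≤ f x := by
  have h1 : Tendsto (fun y : ℝ => (x - y) * deriv f x) (𝓝[>] 0) (𝓝 ((x - 0) * deriv f x)) :=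
    (Continuous.tendsto (by fun_prop) 0).mono_left nhdsWithin_le_nhds
  rw [sub_zero] at h1
  refine le_of_tendsto h1 ?_
  filter_upwards [Ioo_mem_nhdsGT hx] with y hy
  linarith [hf.sub_mul_deriv_le h hy.1 hy.2, hf.nonneg y hy.1]

/-- Since `-f''` is decreasing, its value at `x` is at most the mean slope of `-f'` over `[x/2, x]`.
-/
theorem neg_deriv_deriv_le (hf : IsBernstein f) (h : IsHolomorphicExtension f F) {x : ℝ}
    (hx : 0 < x) : x * -deriv (deriv f) x ≤ 2 * deriv f (x / 2) := by
  obtain ⟨c, hc, hc'⟩ := exists_deriv_eq_slope (deriv f) (half_lt_self hx)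
    (fun u hu => (h.deriv.differentiableAt_real
      ((half_pos hx).trans_le hu.1)).continuousAt.continuousWithinAt)
    (fun u hu => (h.deriv.differentiableAt_real
      ((half_pos hx).trans hu.1)).differentiableWithinAt)
  have h1 := hf.monotoneOn_deriv_deriv h ((half_pos hx).trans hc.1) hx hc.2.le
  rw [hc', div_le_iff₀ (by linarith)] at h1
  linarith [hf.deriv_nonneg hx]

theorem sq_mul_neg_deriv_deriv_le (hf : IsBernstein f) (h : IsHolomorphicExtension f F) {x : ℝ}
    (hx : 0 < x) : x ^ 2 * -deriv (deriv f) x ≤ 4 * f x := by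
  have h1 := hf.neg_deriv_deriv_le h hx
  have h2 := hf.mul_deriv_le h (half_pos hx)
  have h3 := hf.monotoneOn h (half_pos hx) hx (half_le_self hx.le)
  nlinarith

theorem log_hasDerivAt (hf : IsBernstein f) (h : IsHolomorphicExtension f F) {z : ℂ}
    (hz : 0 < z.re) : HasDerivAt (fun w => Complex.log (F w)) (deriv F z / F z) z :=
  (h.differentiableAt hz).hasDerivAt.clog (Or.inl (hf.re_pos h hz))

theorem logDeriv_hasDerivAt (hf : IsBernstein f) (h : IsHolomorphicExtension f F) {z : ℂ}
    (hz : 0 < z.re) : HasDerivAt (fun w => deriv F w / F w)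
      (deriv (deriv F) z / F z - (deriv F z / F z) ^ 2) z := by
  have h1 := (h.deriv.differentiableAt hz).hasDerivAt.div (h.differentiableAt hz).hasDerivAt
    (hf.ne_zero h hz)
  convert! h1 using 1
  have := hf.ne_zero h hz
  field_simp

theorem norm_logDeriv_le (hf : IsBernstein f) (h : IsHolomorphicExtension f F) {z : ℂ}
    (hz : 0 < z.re) : ‖deriv F z / F z‖ ≤ deriv f z.re / f z.re := by
  rw [norm_div]
  exact div_le_div₀ (hf.deriv_nonneg hz) (hf.norm_deriv_le h hz) (hf.pos h hz) (hf.le_norm h hz)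

theorem norm_deriv_logDeriv_le' (hf : IsBernstein f) (h : IsHolomorphicExtension f F) {z : ℂ}
    (hz : 0 < z.re) : ‖deriv (deriv F) z / F z - (deriv F z / F z) ^ 2‖ ≤
      -deriv (deriv f) z.re / f z.re + (deriv f z.re / f z.re) ^ 2 := by
  refine (_root_.norm_sub_le _ _).trans (add_le_add ?_ ?_)
  · rw [norm_div]
    exact div_le_div₀ (neg_nonneg.2 (hf.deriv_deriv_nonpos hz)) (hf.norm_deriv_deriv_le h hz)
      (hf.pos h hz) (hf.le_norm h hz)
  · rw [norm_pow]
    exact pow_le_pow_left₀ (norm_nonneg _) (hf.norm_logDeriv_le h hz) 2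

/-- The universal bound on `(log F)''`: `4` comes from `F''/F` and `1` from `(F'/F)²`. No constant
depends on the function, which makes the later estimates uniform over the whole class. -/
theorem norm_deriv_logDeriv_le (hf : IsBernstein f) (h : IsHolomorphicExtension f F) {z : ℂ}
    (hz : 0 < z.re) : ‖deriv (deriv F) z / F z - (deriv F z / F z) ^ 2‖ ≤ 5 / z.re ^ 2 := by
  refine (hf.norm_deriv_logDeriv_le' h hz).trans ?_
  have h0 := hf.pos h hz
  have h1 : -deriv (deriv f) z.re / f z.re ≤ 4 / z.re ^ 2 := by
    rw [div_le_div_iff₀ h0 (by positivity)]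
    linarith [hf.sq_mul_neg_deriv_deriv_le h hz]
  have h2 : deriv f z.re / f z.re ≤ 1 / z.re := by
    rw [div_le_div_iff₀ h0 hz]
    linarith [hf.mul_deriv_le h hz]
  have h3 := pow_le_pow_left₀ (div_nonneg (hf.deriv_nonneg hz) h0.le) h2 2
  calc _ ≤ 4 / z.re ^ 2 + (1 / z.re) ^ 2 := add_le_add h1 h3
    _ = 5 / z.re ^ 2 := by
      field_simp
      norm_num

/-- Second order Taylor estimate for `log F`. -/
theorem norm_log_sub_sub_le_of_bound (hf : IsBernstein f) (h : IsHolomorphicExtension f F)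
    {c K : ℝ} (hc : 0 < c)
    (hK : ∀ z : ℂ, c ≤ z.re → ‖deriv (deriv F) z / F z - (deriv F z / F z) ^ 2‖ ≤ K)
    {u v : ℂ} (hu : c ≤ u.re) (hv : c ≤ v.re) :
    ‖Complex.log (F v) - Complex.log (F u) - (v - u) * (deriv F u / F u)‖ ≤
      K * ‖v - u‖ ^ 2 := by
  have hconv : Convex ℝ {z : ℂ | c ≤ z.re} := convex_halfSpace_re_ge c
  have hK0 : 0 ≤ K := (norm_nonneg _).trans (hK u hu)
  have h1 : ∀ w ∈ {z : ℂ | c ≤ z.re}, ‖deriv F w / F w - deriv F u / F u‖ ≤ K * ‖w - u‖ := by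
    intro w hw
    exact hconv.norm_image_sub_le_of_norm_hasDerivWithin_le
      (fun z hz => (hf.logDeriv_hasDerivAt h (hc.trans_le hz)).hasDerivWithinAt)
      (fun z hz => hK z hz) hu hw
  -- Intersecting with the ball keeps `‖w - u‖ ≤ ‖v - u‖` along the segment, so the derivative of
  -- the remainder is bounded by `K ‖v - u‖`.
  have hconv2 : Convex ℝ ({z : ℂ | c ≤ z.re} ∩ Metric.closedBall u ‖v - u‖) :=
    hconv.inter (convex_closedBall _ _)
  have h2 := hconv2.norm_image_sub_le_of_norm_hasDerivWithin_le
    (f := fun w => Complex.log (F w) - w * (deriv F u / F u))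
    (f' := fun w => deriv F w / F w - deriv F u / F u) (C := K * ‖v - u‖)
    (fun z hz => ?_) (fun z hz => ?_) ⟨hu, by simp⟩ (show v ∈ _ from ⟨hv, by simp [dist_eq_norm]⟩)
  · rw [sq, ← mul_assoc]
    convert! h2 using 2
    ring
  · have h3 := (hf.log_hasDerivAt h (hc.trans_le hz.1)).sub
      ((hasDerivAt_id z).mul_const (deriv F u / F u))
    rw [one_mul] at h3
    exact h3.hasDerivWithinAt
  · refine (h1 z hz.1).trans (mul_le_mul_of_nonneg_left ?_ hK0)
    simpa [dist_eq_norm] using hz.2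

theorem norm_log_sub_sub_le (hf : IsBernstein f) (h : IsHolomorphicExtension f F)
    {c : ℝ} (hc : 0 < c) {u v : ℂ} (hu : c ≤ u.re) (hv : c ≤ v.re) :
    ‖Complex.log (F v) - Complex.log (F u) - (v - u) * (deriv F u / F u)‖ ≤
      5 / c ^ 2 * ‖v - u‖ ^ 2 := by
  refine hf.norm_log_sub_sub_le_of_bound h hc (fun z hz => ?_) hu hv
  have hz' := hc.trans_le hz
  refine (hf.norm_deriv_logDeriv_le h hz').trans ?_
  exact div_le_div_of_nonneg_left (by norm_num) (by positivity) (pow_le_pow_left₀ hc.le hz 2)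

end IsBernstein

/-! ### Convergence of the generalized Weierstrass product -/

theorem summable_const_div_nat_sq (C : ℝ) : Summable fun n : ℕ => C / (n : ℝ) ^ 2 := by
  simpa [div_eq_mul_inv] using (Real.summable_nat_pow_inv.2 one_lt_two).mul_left C

namespace IsBernstein

variable {f : ℝ → ℝ} {F : ℂ → ℂ}

/-- A difference of consecutive terms is, up to sign, the real part of the second order remainder of
`log F` over a step of length one, hence `O(n⁻²)`. -/
theorem exists_tendsto_eulerSeq (hf : IsBernstein f) (h : IsHolomorphicExtension f F) :
    ∃ γ : ℝ, Tendsto (eulerSeq F) atTop (𝓝 γ) := by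
  -- The term of index zero involves `F 0`, on the boundary of the half-plane, so the sequence is
  -- started at one.
  suffices hc : CauchySeq (fun n => eulerSeq F (n + 1)) by
    obtain ⟨γ, hγ⟩ := cauchySeq_tendsto_of_complete hc
    exact ⟨γ, (tendsto_add_atTop_iff_nat 1).1 hγ⟩
  refine cauchySeq_of_summable_dist ?_
  refine Summable.of_nonneg_of_le (fun _ => dist_nonneg) (fun n => ?_)
    ((summable_nat_add_iff 1).2 (summable_const_div_nat_sq 5))
  have hn : (0 : ℝ) < ((n + 1 : ℕ) : ℝ) := by positivity
  have h1 := hf.norm_log_sub_sub_le h hn (u := ((n + 1 + 1 : ℕ) : ℂ)) (v := ((n + 1 : ℕ) : ℂ))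
    (by rw [Complex.natCast_re]; push_cast; linarith) (by rw [Complex.natCast_re])
  have h2 := (Complex.abs_re_le_norm _).trans h1
  rw [dist_comm, Real.dist_eq]
  have h3 : ‖((n + 1 : ℕ) : ℂ) - ((n + 1 + 1 : ℕ) : ℂ)‖ = 1 := by
    have : ((n + 1 : ℕ) : ℂ) - ((n + 1 + 1 : ℕ) : ℂ) = -1 := by push_cast; ring
    rw [this, norm_neg, norm_one]
  have h4 : ((n + 1 : ℕ) : ℂ) - ((n + 1 + 1 : ℕ) : ℂ) = -1 := by push_cast; ring
  rw [h3, one_pow, mul_one, h4] at h2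
  refine le_trans (le_of_eq ?_) h2
  congr 1
  simp only [eulerSeq, Finset.sum_Icc_succ_top (Nat.le_add_left 1 (n + 1)), Complex.sub_re,
    Complex.log_re, neg_mul, one_mul, Complex.neg_re]
  ring

/-- The exponential correction in the product is chosen so that what remains is the second order
Taylor remainder of `log F` at `k`. -/
theorem weierstrassFactor_eq_exp (hf : IsBernstein f) (h : IsHolomorphicExtension f F) {z : ℂ}
    {k : ℕ} (hk : 0 < k) (hz : 0 < ((k : ℂ) + z).re) :
    weierstrassFactor F z k = Complex.exp (-(Complex.log (F (k + z)) - Complex.log (F k) -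
      (k + z - k) * (deriv F k / F k))) := by
  have hk' : 0 < (k : ℂ).re := by
    rw [Complex.natCast_re]
    exact_mod_cast hk
  rw [weierstrassFactor, add_sub_cancel_left, neg_sub, sub_sub_eq_add_sub, Complex.exp_sub,
    Complex.exp_add, Complex.exp_log (hf.ne_zero h hk'), Complex.exp_log (hf.ne_zero h hz),
    mul_comm z]
  ring

/-- Valid for every `z`: once `k > 10 ‖z‖ + 1` one has `Re (k + z) ≥ k / 2`, the remainder is at
most `20 ‖z‖² / k² ≤ 1`, and `|e^w - 1| ≤ 2 |w|` doubles the constant. The finitely many earlier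
factors do not matter. -/
theorem summable_norm_weierstrassFactor_sub_one (hf : IsBernstein f)
    (h : IsHolomorphicExtension f F) (z : ℂ) :
    Summable fun k : ℕ => ‖weierstrassFactor F z (k + 1) - 1‖ := by
  refine (summable_nat_add_iff (f := fun k : ℕ => ‖weierstrassFactor F z k - 1‖) 1).2 ?_
  refine Summable.of_norm_bounded_eventually_nat (summable_const_div_nat_sq (40 * ‖z‖ ^ 2)) ?_
  obtain ⟨K, hK⟩ := exists_nat_gt (10 * ‖z‖ + 1)
  filter_upwards [eventually_ge_atTop K] with k hk
  have hkz : 10 * ‖z‖ + 1 < k := hK.trans_le (by exact_mod_cast hk)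
  have hk0 : (0 : ℝ) < k := by linarith [norm_nonneg z]
  have hre : (k : ℝ) / 2 ≤ ((k : ℂ) + z).re := by
    have := (abs_le.1 (Complex.abs_re_le_norm z)).1
    simp only [Complex.add_re, Complex.natCast_re]
    linarith [norm_nonneg z]
  rw [norm_norm, hf.weierstrassFactor_eq_exp h (by exact_mod_cast hk0)
    ((half_pos hk0).trans_le hre)]
  have h1 := hf.norm_log_sub_sub_le h (half_pos hk0) (u := (k : ℂ)) (v := k + z)
    (by rw [Complex.natCast_re]; linarith) hre
  have h4 : 5 / ((k : ℝ) / 2) ^ 2 * ‖(k : ℂ) + z - k‖ ^ 2 = 20 * ‖z‖ ^ 2 / k ^ 2 := by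
    rw [add_sub_cancel_left]
    field_simp
    ring
  rw [h4] at h1
  have h5 : 20 * ‖z‖ ^ 2 / (k : ℝ) ^ 2 ≤ 1 := by
    rw [div_le_one (by positivity)]
    nlinarith [norm_nonneg z]
  have h6 := Complex.norm_exp_sub_one_le (by rw [norm_neg]; exact h1.trans h5)
  refine h6.trans ?_
  rw [norm_neg]
  calc _ ≤ 2 * (20 * ‖z‖ ^ 2 / (k : ℝ) ^ 2) := by gcongr
    _ = _ := by ring

theorem multipliable_weierstrassFactor (hf : IsBernstein f) (h : IsHolomorphicExtension f F)
    (z : ℂ) : Multipliable fun k : ℕ => weierstrassFactor F z (k + 1) := by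
  simpa using multipliable_one_add_of_summable (hf.summable_norm_weierstrassFactor_sub_one h z)

theorem wConverges (hf : IsBernstein f) (h : IsHolomorphicExtension f F) (z : ℂ) :
    WConverges F z :=
  ⟨hf.exists_tendsto_eulerSeq h, hf.multipliable_weierstrassFactor h z⟩

end IsBernstein

/-- The partial products of `W`. -/
noncomputable def partialW (F : ℂ → ℂ) (z : ℂ) (n : ℕ) : ℂ :=
  Complex.exp (-(eulerConst F : ℂ) * z) / F z *
    ∏ k ∈ Finset.range n, weierstrassFactor F z (k + 1)

/-- `ln (|F(x + ib)| / |F(x)|)`. -/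
noncomputable def vert (F : ℂ → ℂ) (b x : ℝ) : ℝ :=
  Real.log (‖F ((x : ℂ) + (b : ℂ) * Complex.I)‖ / ‖F (x : ℂ)‖)

/-! ### The modulus of the product on vertical lines. -/

namespace IsBernstein

variable {f : ℝ → ℝ} {F : ℂ → ℂ}

theorem tendsto_partialW (hf : IsBernstein f) (h : IsHolomorphicExtension f F) (z : ℂ) :
    Tendsto (partialW F z) atTop (𝓝 (W F z)) :=
  ((hf.multipliable_weierstrassFactor h z).hasProd.tendsto_prod_nat).const_mul _

/-- All exponents multiplying `z` are real, so the exponentials have the same modulus at `a + ib` as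
at `a` and only the values of `F` contribute. The prefactor `1 / F z` supplies the index `k = 0`,
whence `n + 1` terms. Only non-vanishing at the points `a + k` is assumed, so that `a ≤ 0` is
allowed. -/
theorem norm_partialW (h : IsHolomorphicExtension f F) {a b : ℝ}
    (ha : ∀ k : ℕ, F ((a + k : ℝ) : ℂ) ≠ 0) (n : ℕ) :
    ‖partialW F (a + b * Complex.I) n‖ = ‖partialW F a n‖ *
      ∏ k ∈ Finset.range (n + 1),
        (‖F ((a + k : ℝ) : ℂ)‖ / ‖F (((a + k : ℝ) : ℂ) + b * Complex.I)‖) := by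
  rw [Finset.prod_range_succ', partialW, partialW, norm_mul, norm_mul, norm_prod, norm_prod]
  have h1 : ∀ k : ℕ, ‖weierstrassFactor F (a + b * Complex.I) (k + 1)‖ =
      ‖weierstrassFactor F a (k + 1)‖ * (‖F ((a + (k + 1 : ℕ) : ℝ) : ℂ)‖ /
        ‖F (((a + (k + 1 : ℕ) : ℝ) : ℂ) + b * Complex.I)‖) := by
    intro k
    have hk : (0 : ℝ) < ((k + 1 : ℕ) : ℝ) := by positivity
    have e1 : deriv F ((k + 1 : ℕ) : ℂ) / F ((k + 1 : ℕ) : ℂ) =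
        ((deriv f ((k + 1 : ℕ) : ℝ) / f ((k + 1 : ℕ) : ℝ) : ℝ) : ℂ) := by
      have e2 := h.deriv_eq hk
      have e3 := h.agrees _ hk
      rw [Complex.ofReal_natCast] at e2 e3
      rw [e2, e3, Complex.ofReal_div]
    have e4 : ((k + 1 : ℕ) : ℂ) + (a + b * Complex.I) =
        ((a + (k + 1 : ℕ) : ℝ) : ℂ) + b * Complex.I := by
      push_cast
      ring
    have e5 : ((k + 1 : ℕ) : ℂ) + a = ((a + (k + 1 : ℕ) : ℝ) : ℂ) := by
      push_cast
      ring
    have e6 := norm_pos_iff.2 (ha (k + 1))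
    rw [weierstrassFactor, weierstrassFactor, norm_mul, norm_mul, norm_div, norm_div, e1,
      Complex.norm_exp, Complex.norm_exp, Complex.re_ofReal_mul, Complex.re_ofReal_mul, e4, e5]
    simp only [Complex.add_re, Complex.ofReal_re, Complex.mul_re, Complex.I_re, mul_zero,
      Complex.ofReal_im, Complex.I_im, mul_one, sub_self, add_zero]
    field_simp
  rw [Finset.prod_congr rfl fun k _ => h1 k, Finset.prod_mul_distrib]
  have e6 := norm_pos_iff.2 (ha 0)
  simp only [Nat.cast_zero, add_zero] at e6 ⊢
  rw [norm_div, norm_div, Complex.norm_exp, Complex.norm_exp, ← Complex.ofReal_neg,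
    Complex.re_ofReal_mul, Complex.re_ofReal_mul]
  simp only [Complex.add_re, Complex.ofReal_re, Complex.mul_re, Complex.I_re, mul_zero,
      Complex.ofReal_im, Complex.I_im, mul_one, sub_self, add_zero]
  field_simp

theorem norm_partialW_eq_exp (h : IsHolomorphicExtension f F) {a b : ℝ}
    (ha : ∀ k : ℕ, F ((a + k : ℝ) : ℂ) ≠ 0)
    (hab : ∀ k : ℕ, F (((a + k : ℝ) : ℂ) + b * Complex.I) ≠ 0) (n : ℕ) :
    ‖partialW F (a + b * Complex.I) n‖ = ‖partialW F a n‖ *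
      Real.exp (-∑ k ∈ Finset.range (n + 1), vert F b (a + k)) := by
  rw [norm_partialW h ha, ← Finset.sum_neg_distrib, Real.exp_sum]
  congr 1
  refine Finset.prod_congr rfl fun k _ => ?_
  have h1 := norm_pos_iff.2 (ha k)
  have h2 := norm_pos_iff.2 (hab k)
  rw [vert, Real.exp_neg, Real.exp_log (div_pos h2 h1), inv_div]

/-- All terms `vert F b (a + k)` are non-negative, so any finite block of them bounds the whole sum
from below. -/
theorem norm_W_le (hf : IsBernstein f) (h : IsHolomorphicExtension f F) {a b : ℝ}
    (ha : ∀ k : ℕ, F ((a + k : ℝ) : ℂ) ≠ 0)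
    (hab : ∀ k : ℕ, ‖F ((a + k : ℝ) : ℂ)‖ ≤ ‖F (((a + k : ℝ) : ℂ) + b * Complex.I)‖)
    (k₀ N : ℕ) :
    ‖W F (a + b * Complex.I)‖ ≤
      ‖W F a‖ * Real.exp (-∑ k ∈ Finset.Ico k₀ N, vert F b (a + k)) := by
  have hab' : ∀ k : ℕ, F (((a + k : ℝ) : ℂ) + b * Complex.I) ≠ 0 := fun k =>
    norm_pos_iff.1 ((norm_pos_iff.2 (ha k)).trans_le (hab k))
  refine le_of_tendsto_of_tendsto (hf.tendsto_partialW h _).norm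
    ((hf.tendsto_partialW h a).norm.mul_const _) ?_
  filter_upwards [eventually_ge_atTop N] with n hn
  rw [norm_partialW_eq_exp h ha hab']
  refine mul_le_mul_of_nonneg_left ?_ (norm_nonneg _)
  rw [Real.exp_le_exp, neg_le_neg_iff]
  refine Finset.sum_le_sum_of_subset_of_nonneg (fun k hk => ?_) fun k _ _ => ?_
  · rw [Finset.mem_Ico] at hk
    rw [Finset.mem_range]
    omega
  · exact Real.log_nonneg ((one_le_div (norm_pos_iff.2 (ha k))).2 (hab k))

theorem le_norm_W (hf : IsBernstein f) (h : IsHolomorphicExtension f F) {a b B : ℝ}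
    (ha : ∀ k : ℕ, F ((a + k : ℝ) : ℂ) ≠ 0)
    (hab : ∀ k : ℕ, F (((a + k : ℝ) : ℂ) + b * Complex.I) ≠ 0)
    (hB : ∀ n : ℕ, ∑ k ∈ Finset.range n, vert F b (a + k) ≤ B) :
    ‖W F a‖ * Real.exp (-B) ≤ ‖W F (a + b * Complex.I)‖ := by
  refine le_of_tendsto_of_tendsto' ((hf.tendsto_partialW h a).norm.mul_const _)
    (hf.tendsto_partialW h _).norm fun n => ?_
  rw [norm_partialW_eq_exp h ha hab]
  refine mul_le_mul_of_nonneg_left ?_ (norm_nonneg _)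
  rw [Real.exp_le_exp, neg_le_neg_iff]
  exact hB _

theorem W_ne_zero (hf : IsBernstein f) (h : IsHolomorphicExtension f F) {z : ℂ}
    (hz : 0 < z.re) : W F z ≠ 0 := by
  refine mul_ne_zero (div_ne_zero (Complex.exp_ne_zero _) (hf.ne_zero h hz)) ?_
  have h1 := tprod_one_add_ne_zero_of_summable (f := fun k => weierstrassFactor F z (k + 1) - 1)
    (fun k => ?_) (hf.summable_norm_weierstrassFactor_sub_one h z)
  · simpa using h1
  · rw [add_sub_cancel, hf.weierstrassFactor_eq_exp h k.succ_pos]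
    · exact Complex.exp_ne_zero _
    · rw [Complex.add_re, Complex.natCast_re]
      positivity

/-- On the positive half-line the partial products are non-negative reals, and so is their limit. -/
theorem re_W_ofReal (hf : IsBernstein f) (h : IsHolomorphicExtension f F) {a : ℝ} (ha : 0 < a) :
    (W F a).re = ‖W F a‖ := by
  have h1 : ∀ n, partialW F a n = (‖partialW F a n‖ : ℂ) := by
    intro n
    have e0 : ∃ r : ℝ, 0 ≤ r ∧ partialW F a n = r := by
      have e1 : ∀ k : ℕ, ∃ r : ℝ, 0 ≤ r ∧ weierstrassFactor F a (k + 1) = r := by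
        intro k
        have hk : (0 : ℝ) < ((k + 1 : ℕ) : ℝ) := by positivity
        have e2 := h.deriv_eq hk
        have e3 := h.agrees _ hk
        have e4 := h.agrees (((k + 1 : ℕ) : ℝ) + a) (by positivity)
        have e5 := hf.nonneg _ hk
        have e6 := hf.nonneg (((k + 1 : ℕ) : ℝ) + a) (by positivity)
        refine ⟨f ((k + 1 : ℕ) : ℝ) / f (((k + 1 : ℕ) : ℝ) + a) *
          Real.exp (deriv f ((k + 1 : ℕ) : ℝ) / f ((k + 1 : ℕ) : ℝ) * a), by positivity, ?_⟩
        rw [Complex.ofReal_natCast] at e2 e3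
        rw [Complex.ofReal_add, Complex.ofReal_natCast] at e4
        rw [weierstrassFactor, e2, e3, e4]
        push_cast
        rfl
      choose r hr0 hr using e1
      have e7 := hf.nonneg a ha
      refine ⟨Real.exp (-eulerConst F * a) / f a * ∏ k ∈ Finset.range n, r k,
        mul_nonneg (by positivity) (Finset.prod_nonneg fun k _ => hr0 k), ?_⟩
      rw [partialW, Finset.prod_congr rfl fun k _ => hr k, h.agrees a ha]
      push_cast
      rfl
    obtain ⟨r, hr, hr'⟩ := e0
    rw [hr', Complex.norm_real, Real.norm_of_nonneg hr]
  have h2 := hf.tendsto_partialW h a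
  have h3 : Tendsto (partialW F a) atTop (𝓝 (‖W F a‖ : ℂ)) := by
    refine ((Complex.continuous_ofReal.tendsto _).comp h2.norm).congr fun n => ?_
    exact (h1 n).symm
  rw [tendsto_nhds_unique h2 h3, Complex.ofReal_re, Complex.norm_real, norm_norm]

/-! ### Estimates along vertical lines -/

theorem norm_ofReal (hf : IsBernstein f) (h : IsHolomorphicExtension f F) {x : ℝ} (hx : 0 < x) :
    ‖F x‖ = f x := by
  rw [h.agrees x hx, Complex.norm_real, Real.norm_of_nonneg (hf.nonneg x hx)]

theorem re_add_mul_I (x b : ℝ) : ((x : ℂ) + b * Complex.I).re = x := by simp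

theorem vert_nonneg (hf : IsBernstein f) (h : IsHolomorphicExtension f F) {x : ℝ} (hx : 0 < x)
    (b : ℝ) : 0 ≤ vert F b x := by
  refine Real.log_nonneg ?_
  rw [hf.norm_ofReal h hx, one_le_div (hf.pos h hx)]
  simpa using hf.le_norm h (z := x + b * Complex.I) (by simpa using hx)

theorem vert_neg (hf : IsBernstein f) (h : IsHolomorphicExtension f F) {x : ℝ} (hx : 0 < x)
    (b : ℝ) : vert F (-b) x = vert F b x := by
  have h1 := hf.map_conj h (z := x + b * Complex.I) (by simpa using hx)
  have h2 : starRingEnd ℂ ((x : ℂ) + b * Complex.I) = x + (-b : ℝ) * Complex.I := by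
    simp
  rw [h2] at h1
  rw [vert, vert, h1, Complex.norm_conj]

theorem vert_abs (hf : IsBernstein f) (h : IsHolomorphicExtension f F) {x : ℝ} (hx : 0 < x)
    (b : ℝ) : vert F |b| x = vert F b x := by
  rcases abs_choice b with hb | hb
  · rw [hb]
  · rw [hb, hf.vert_neg h hx]

theorem vert_eq (hf : IsBernstein f) (h : IsHolomorphicExtension f F) {x : ℝ} (hx : 0 < x)
    (b : ℝ) :
    vert F b x = (Complex.log (F (x + b * Complex.I)) - Complex.log (F x)).re := by
  rw [Complex.sub_re, Complex.log_re, Complex.log_re, vert, Real.log_div]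
  · exact norm_ne_zero_iff.2 (hf.ne_zero h (by simpa using hx))
  · exact norm_ne_zero_iff.2 (hf.ne_zero h (by simpa using hx))

/-- The first order term of `log F(x + ib)` is `ib F'(x)/F(x)`, purely imaginary, so it drops out of
the log-modulus and only the quadratic remainder is left. -/
theorem vert_le_of_bound (hf : IsBernstein f) (h : IsHolomorphicExtension f F) {x K : ℝ}
    (hx : 0 < x)
    (hK : ∀ z : ℂ, x ≤ z.re → ‖deriv (deriv F) z / F z - (deriv F z / F z) ^ 2‖ ≤ K) (b : ℝ) :
    vert F b x ≤ K * b ^ 2 := by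
  have h1 := hf.norm_log_sub_sub_le_of_bound h hx hK (u := x) (v := x + b * Complex.I)
    (by simp) (by simp)
  have h2 := (Complex.re_le_norm _).trans h1
  rw [Complex.sub_re, ← hf.vert_eq h hx, add_sub_cancel_left, h.deriv_eq hx, h.agrees x hx,
    ← Complex.ofReal_div, norm_mul, Complex.norm_I, Complex.norm_real, mul_one,
    Real.norm_eq_abs, sq_abs] at h2
  simpa using h2

theorem vert_le (hf : IsBernstein f) (h : IsHolomorphicExtension f F) {x : ℝ} (hx : 0 < x)
    (b : ℝ) : vert F b x ≤ 5 / x ^ 2 * b ^ 2 := by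
  refine hf.vert_le_of_bound h hx (fun z hz => ?_) b
  refine (hf.norm_deriv_logDeriv_le h (hx.trans_le hz)).trans ?_
  exact div_le_div_of_nonneg_left (by norm_num) (by positivity) (pow_le_pow_left₀ hx.le hz 2)

theorem vert_hasDerivAt (hf : IsBernstein f) (h : IsHolomorphicExtension f F) {x : ℝ}
    (hx : 0 < x) (b : ℝ) :
    HasDerivAt (vert F b) (deriv F (x + b * Complex.I) / F (x + b * Complex.I) -
      deriv F x / F x).re x := by
  have h1 := (hf.log_hasDerivAt h (z := x + b * Complex.I) (by simpa using hx)).comp_add_const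
    (x : ℂ) (b * Complex.I)
  have h2 := (h1.sub (hf.log_hasDerivAt h (z := x) (by simpa using hx))).real_of_complex
  refine h2.congr_of_eventuallyEq ?_
  filter_upwards [Ioi_mem_nhds hx] with u hu
  exact hf.vert_eq h hu b

theorem vert_continuousOn (hf : IsBernstein f) (h : IsHolomorphicExtension f F) (b : ℝ) :
    ContinuousOn (vert F b) (Ioi 0) := fun _ hx =>
  (hf.vert_hasDerivAt h hx b).continuousAt.continuousWithinAt

theorem abs_deriv_vert_sub_le (hf : IsBernstein f) (h : IsHolomorphicExtension f F)
    {c x y : ℝ} (hc : 0 < c) (hx : c ≤ x) (hy : c ≤ y) (b : ℝ) :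
    |(deriv F (y + b * Complex.I) / F (y + b * Complex.I) - deriv F y / F y).re -
      (deriv F (x + b * Complex.I) / F (x + b * Complex.I) - deriv F x / F x).re| ≤
      10 / c ^ 2 * |y - x| := by
  have h1 : ∀ u v : ℂ, c ≤ u.re → c ≤ v.re →
      ‖deriv F v / F v - deriv F u / F u‖ ≤ 5 / c ^ 2 * ‖v - u‖ := by
    intro u v hu hv
    refine (convex_halfSpace_re_ge c).norm_image_sub_le_of_norm_hasDerivWithin_le
      (fun z hz => (hf.logDeriv_hasDerivAt h (hc.trans_le hz)).hasDerivWithinAt)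
      (fun z hz => ?_) hu hv
    refine (hf.norm_deriv_logDeriv_le h (hc.trans_le hz)).trans ?_
    exact div_le_div_of_nonneg_left (by norm_num) (by positivity) (pow_le_pow_left₀ hc.le hz 2)
  have h2 := h1 (x + b * Complex.I) (y + b * Complex.I) (by simpa using hx) (by simpa using hy)
  have h3 := h1 x y (by simpa using hx) (by simpa using hy)
  rw [add_sub_add_right_eq_sub] at h2
  rw [← Complex.ofReal_sub, Complex.norm_real, Real.norm_eq_abs] at h2 h3
  rw [← Complex.sub_re, sub_sub_sub_comm]
  refine (Complex.abs_re_le_norm _).trans ((_root_.norm_sub_le _ _).trans ?_)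
  calc _ ≤ 5 / c ^ 2 * |y - x| + 5 / c ^ 2 * |y - x| := add_le_add h2 h3
    _ = _ := by ring

end IsBernstein

/-! ### The integrals `Θ_φ(a, b)` -/

/-- `ln (|y + i| / y)`, for `y > 0`. -/
noncomputable def logSlope (y : ℝ) : ℝ := Real.log (y ^ 2 + 1) / 2 - Real.log y

theorem logSlope_nonneg {y : ℝ} (hy : 0 < y) : 0 ≤ logSlope y := by
  have h1 : Real.log (y ^ 2) ≤ Real.log (y ^ 2 + 1) :=
    Real.log_le_log (by positivity) (by linarith)
  rw [Real.log_pow] at h1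
  push_cast at h1
  rw [logSlope]
  linarith

theorem logSlope_le {y : ℝ} (hy : 0 < y) : logSlope y ≤ 1 / (2 * y ^ 2) := by
  have h1 : Real.log (y ^ 2 + 1) = Real.log (y ^ 2) + Real.log (1 + 1 / y ^ 2) := by
    rw [← Real.log_mul (by positivity) (by positivity)]
    congr 1
    field_simp
  have h2 : Real.log (1 + 1 / y ^ 2) ≤ 1 / y ^ 2 := by
    have := Real.log_le_sub_one_of_pos (show 0 < 1 + 1 / y ^ 2 by positivity)
    linarith
  rw [Real.log_pow] at h1
  push_cast at h1
  have h3 : 1 / (2 * y ^ 2) = 1 / y ^ 2 / 2 := by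
    field_simp
  rw [logSlope, h3]
  linarith

theorem logSlope_eq {y : ℝ} (hy : 0 < y) : logSlope y = Real.log (‖(y : ℂ) + Complex.I‖ / y) := by
  have h1 : ‖(y : ℂ) + Complex.I‖ = √(y ^ 2 + 1) := by
    have := Complex.norm_add_mul_I y 1
    simpa using this
  rw [h1, Real.log_div (by positivity) hy.ne', Real.log_sqrt (by positivity), logSlope]

/-- The explicit primitive `g` is continuous up to `0` with `g 0 = 0`; at infinity it equals `y *
logSlope y + arctan y`, whose first summand vanishes. -/
theorem integrableOn_logSlope_and_integral :
    IntegrableOn logSlope (Ioi 0) ∧ ∫ y in Ioi (0 : ℝ), logSlope y = Real.pi / 2 := by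
  set g : ℝ → ℝ := fun y => y * Real.log (y ^ 2 + 1) / 2 - y * Real.log y + Real.arctan y with hg
  have hc : Continuous g := by
    refine ((Continuous.div_const (continuous_id.mul (Continuous.log (by fun_prop)
      fun y => by positivity)) 2).sub Real.continuous_mul_log).add Real.continuous_arctan
  have hd : ∀ y ∈ Ioi (0 : ℝ), HasDerivAt g (logSlope y) y := by
    intro y hy
    have hy0 : y ≠ 0 := (mem_Ioi.1 hy).ne'
    have h1 : HasDerivAt (fun y : ℝ => y ^ 2 + 1) (2 * y) y := by
      simpa using (hasDerivAt_pow 2 y).add_const 1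
    have h2 := ((hasDerivAt_id y).mul (h1.log (by positivity))).div_const 2
    have h3 := (h2.sub (Real.hasDerivAt_mul_log hy0)).add (Real.hasDerivAt_arctan y)
    convert! h3 using 1
    simp only [logSlope, id]
    have : y ^ 2 + 1 ≠ 0 := by positivity
    have : 1 + y ^ 2 ≠ 0 := by positivity
    field_simp
    ring
  have hl : Tendsto g atTop (𝓝 (Real.pi / 2)) := by
    have h1 : Tendsto (fun y : ℝ => y * logSlope y) atTop (𝓝 0) := by
      refine squeeze_zero' ?_ ?_ tendsto_inv_atTop_zero
      · filter_upwards [eventually_gt_atTop 0] with y hy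
        exact mul_nonneg hy.le (logSlope_nonneg hy)
      · filter_upwards [eventually_gt_atTop 0] with y hy
        calc y * logSlope y ≤ y * (1 / (2 * y ^ 2)) :=
              mul_le_mul_of_nonneg_left (logSlope_le hy) hy.le
          _ = y⁻¹ / 2 := by field_simp
          _ ≤ y⁻¹ := half_le_self (by positivity)
    have h2 := h1.add (Real.tendsto_arctan_atTop.mono_right nhdsWithin_le_nhds)
    rw [zero_add] at h2
    refine h2.congr fun y => ?_
    simp only [hg, logSlope]
    ring
  have hpos : ∀ y ∈ Ioi (0 : ℝ), 0 ≤ logSlope y := fun y hy => logSlope_nonneg hy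
  refine ⟨integrableOn_Ioi_deriv_of_nonneg hc.continuousWithinAt hd hpos hl, ?_⟩
  rw [integral_Ioi_of_hasDerivAt_of_nonneg hc.continuousWithinAt hd hpos hl]
  simp [hg]

theorem angleIntegrand_eq_vert (F : ℂ → ℂ) (b y : ℝ) :
    angleIntegrand F b y = vert F b (b * y) := rfl

theorem angleIntegrand_zero (F : ℂ → ℂ) (y : ℝ) : angleIntegrand F 0 y = 0 := by
  rw [angleIntegrand]
  simp only [zero_mul, Complex.ofReal_zero, add_zero]
  by_cases h : ‖F 0‖ = 0
  · rw [h]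
    simp
  · rw [div_self h, Real.log_one]

/-- The trapezoidal rule on an interval of length one. -/
theorem abs_trapezoid_sub_integral_le {g g' : ℝ → ℝ} {a ζ : ℝ}
    (hg : ∀ x ∈ Icc a (a + 1), HasDerivAt g (g' x) x)
    (hζ : ∀ x ∈ Icc a (a + 1), ∀ y ∈ Icc a (a + 1), |g' y - g' x| ≤ ζ) :
    |(g a + g (a + 1)) / 2 - ∫ x in a..a + 1, g x| ≤ ζ := by
  have ha1 : a ≤ a + 1 := by linarith
  have hgc : ContinuousOn g (Icc a (a + 1)) := fun x hx =>
    (hg x hx).continuousAt.continuousWithinAt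
  -- The trapezoid is the integral of the chord, whose slope is `g' η`; so the error is controlled
  -- by the oscillation of `g'` alone and no second derivative is needed.
  obtain ⟨η, hη, hη'⟩ := exists_hasDerivAt_eq_slope g g' (by linarith : a < a + 1) hgc
    (fun x hx => hg x (Ioo_subset_Icc_self hx))
  rw [add_sub_cancel_left, div_one] at hη'
  have hζ0 : 0 ≤ ζ := (abs_nonneg _).trans (hζ a ⟨le_rfl, ha1⟩ a ⟨le_rfl, ha1⟩)
  have h1 : ∀ x ∈ Icc a (a + 1), |g a + (x - a) * g' η - g x| ≤ ζ := by
    intro x hx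
    rcases eq_or_lt_of_le hx.1 with hax | hax
    · rw [← hax]
      simpa using hζ0
    · obtain ⟨ξ, hξ, hξ'⟩ := exists_hasDerivAt_eq_slope g g' hax
        (hgc.mono (Icc_subset_Icc_right hx.2))
        (fun y hy => hg y ⟨hy.1.le, hy.2.le.trans hx.2⟩)
      have h2 : g a + (x - a) * g' η - g x = (x - a) * (g' η - g' ξ) := by
        rw [hξ']
        have : x - a ≠ 0 := (sub_pos.2 hax).ne'
        field_simp
        ring
      rw [h2, abs_mul, abs_of_pos (sub_pos.2 hax)]
      have h3 := hζ ξ ⟨hξ.1.le, hξ.2.le.trans hx.2⟩ η (Ioo_subset_Icc_self hη)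
      have h4 := abs_nonneg (g' η - g' ξ)
      nlinarith [hx.2]
  have hint : IntervalIntegrable g volume a (a + 1) :=
    ContinuousOn.intervalIntegrable (by rwa [uIcc_of_le ha1])
  have h5 : ∫ x in a..a + 1, (g a + (x - a) * g' η) = (g a + g (a + 1)) / 2 := by
    rw [intervalIntegral.integral_add (by simp) (Continuous.intervalIntegrable (by fun_prop) _ _),
      intervalIntegral.integral_mul_const, intervalIntegral.integral_sub (by simp) (by simp),
      integral_id]
    simp only [intervalIntegral.integral_const, smul_eq_mul]
    rw [hη']
    ring
  rw [← h5, ← intervalIntegral.integral_sub (Continuous.intervalIntegrable (by fun_prop) _ _) hint]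
  have h6 := intervalIntegral.norm_integral_le_of_norm_le_const (a := a) (b := a + 1) (C := ζ)
    (f := fun x => g a + (x - a) * g' η - g x) (fun x hx => by
      rw [uIoc_of_le ha1] at hx
      exact h1 x (Ioc_subset_Icc_self hx))
  simpa using h6

namespace IsBernstein

variable {f : ℝ → ℝ} {F : ℂ → ℂ}

theorem angleIntegrand_nonneg (hf : IsBernstein f) (h : IsHolomorphicExtension f F) {b y : ℝ}
    (hb : 0 < b) (hy : 0 < y) : 0 ≤ angleIntegrand F b y :=
  hf.vert_nonneg h (mul_pos hb hy) b

/-- The bound `‖z‖ / z.re` of `norm_le` at `z = b (y + i)` no longer depends on `b`. It serves both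
for `Θ ≤ π/2` and as a dominating function. -/
theorem angleIntegrand_le (hf : IsBernstein f) (h : IsHolomorphicExtension f F) {b y : ℝ}
    (hb : 0 < b) (hy : 0 < y) : angleIntegrand F b y ≤ logSlope y := by
  have hby := mul_pos hb hy
  have h1 := hf.norm_le h (z := (b * y : ℝ) + b * Complex.I) (by simpa using hby)
  rw [re_add_mul_I] at h1
  have h2 : ((b * y : ℝ) : ℂ) + b * Complex.I = b * (y + Complex.I) := by
    push_cast
    ring
  have h3 : ‖((b * y : ℝ) : ℂ) + b * Complex.I‖ / (b * y) = ‖(y : ℂ) + Complex.I‖ / y := by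
    rw [h2, norm_mul, Complex.norm_real, Real.norm_of_nonneg hb.le, mul_div_mul_left _ _ hb.ne']
  rw [h3] at h1
  have h4 := hf.pos h hby
  rw [logSlope_eq hy, angleIntegrand, hf.norm_ofReal h hby]
  refine Real.log_le_log (div_pos ?_ h4) ((div_le_iff₀ h4).2 h1)
  exact norm_pos_iff.2 (hf.ne_zero h (by simpa using hby))

theorem angleIntegrand_continuousOn (hf : IsBernstein f) (h : IsHolomorphicExtension f F) {b : ℝ}
    (hb : 0 < b) : ContinuousOn (angleIntegrand F b) (Ioi 0) :=
  (hf.vert_continuousOn h b).comp (continuous_const.mul continuous_id).continuousOn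
    fun _ hy => mul_pos hb hy

theorem integrableOn_angleIntegrand (hf : IsBernstein f) (h : IsHolomorphicExtension f F) {b : ℝ}
    (hb : 0 ≤ b) : IntegrableOn (angleIntegrand F b) (Ioi 0) := by
  rcases hb.eq_or_lt with rfl | hb
  · have : angleIntegrand F 0 = fun _ => 0 := funext (angleIntegrand_zero F)
    rw [this]
    exact integrableOn_zero
  · refine Integrable.mono' integrableOn_logSlope_and_integral.1
      ((hf.angleIntegrand_continuousOn h hb).aestronglyMeasurable measurableSet_Ioi) ?_
    filter_upwards [ae_restrict_mem measurableSet_Ioi] with y hy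
    rw [Real.norm_of_nonneg (hf.angleIntegrand_nonneg h hb hy)]
    exact hf.angleIntegrand_le h hb hy

theorem Theta_nonneg (hf : IsBernstein f) (h : IsHolomorphicExtension f F) {a b : ℝ}
    (ha : 0 ≤ a) (hb : 0 ≤ b) : 0 ≤ Theta F a b := by
  rcases hb.eq_or_lt with rfl | hb
  · simp [Theta, angleIntegrand_zero]
  · refine setIntegral_nonneg measurableSet_Ioi fun y hy => hf.angleIntegrand_nonneg h hb ?_
    exact (div_nonneg ha hb.le).trans_lt hy

theorem Theta_le (hf : IsBernstein f) (h : IsHolomorphicExtension f F) {a b : ℝ}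
    (ha : 0 ≤ a) (hb : 0 ≤ b) : Theta F a b ≤ Real.pi / 2 := by
  rcases hb.eq_or_lt with rfl | hb
  · simp only [Theta, angleIntegrand_zero, integral_zero]
    positivity
  · rw [← integrableOn_logSlope_and_integral.2, Theta]
    have hsub : Ioi (a / b) ⊆ Ioi 0 := Ioi_subset_Ioi (div_nonneg ha hb.le)
    refine (setIntegral_mono_on ((hf.integrableOn_angleIntegrand h hb.le).mono_set hsub)
      (integrableOn_logSlope_and_integral.1.mono_set hsub) measurableSet_Ioi
      fun y hy => hf.angleIntegrand_le h hb (hsub hy)).trans ?_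
    refine setIntegral_mono_set integrableOn_logSlope_and_integral.1 ?_ hsub.eventuallyLE
    filter_upwards [ae_restrict_mem measurableSet_Ioi] with y hy
    exact logSlope_nonneg hy

theorem integrableOn_vert (hf : IsBernstein f) (h : IsHolomorphicExtension f F) {a : ℝ}
    (ha : 0 < a) (b : ℝ) : IntegrableOn (vert F b) (Ioi a) := by
  refine Integrable.mono' ((integrableOn_Ioi_rpow_of_lt (show (-2 : ℝ) < -1 by norm_num) ha).const_mul
    (5 * b ^ 2)) (((hf.vert_continuousOn h b).mono
      (Ioi_subset_Ioi ha.le)).aestronglyMeasurable measurableSet_Ioi) ?_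
  filter_upwards [ae_restrict_mem measurableSet_Ioi] with x hx
  have hx0 : 0 < x := ha.trans hx
  rw [Real.norm_of_nonneg (hf.vert_nonneg h hx0 b)]
  refine (hf.vert_le h hx0 b).trans (le_of_eq ?_)
  rw [Real.rpow_neg hx0.le, Real.rpow_two]
  ring

theorem integral_vert (hf : IsBernstein f) (h : IsHolomorphicExtension f F) {a : ℝ}
    (ha : 0 < a) (b : ℝ) : ∫ x in Ioi a, vert F b x = |b| * Theta F a |b| := by
  have h0 : ∫ x in Ioi a, vert F b x = ∫ x in Ioi a, vert F |b| x :=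
    setIntegral_congr_fun measurableSet_Ioi fun x hx => (hf.vert_abs h (ha.trans hx) b).symm
  rw [h0]
  rcases (abs_nonneg b).eq_or_lt with hb | hb
  · rw [← hb, zero_mul]
    have : ∀ x, vert F 0 x = 0 := by
      intro x
      rw [vert]
      simp only [Complex.ofReal_zero, zero_mul, add_zero]
      by_cases h : ‖F x‖ = 0
      · rw [h]
        simp
      · rw [div_self h, Real.log_one]
    simp [this]
  · rw [Theta]
    simp only [angleIntegrand_eq_vert]
    rw [integral_comp_mul_left_Ioi (vert F |b|) _ hb, smul_eq_mul, mul_inv_cancel_left₀ hb.ne',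
      mul_div_cancel₀ _ hb.ne']

/-- The trapezoidal rule on each unit interval, with the Lipschitz bound `10 / (a + k)²` for the
derivative. Replacing `a` by `a₀` makes the error independent of `a`, `b` and the function. -/
theorem abs_sum_vert_sub_le (hf : IsBernstein f) (h : IsHolomorphicExtension f F) {a₀ a : ℝ}
    (ha₀ : 0 < a₀) (ha : a₀ ≤ a) (b : ℝ) (n : ℕ) :
    |∑ k ∈ Finset.range (n + 1), vert F b (a + k) - (vert F b a + vert F b (a + n)) / 2 -
      ∫ x in a..a + n, vert F b x| ≤ ∑ k ∈ Finset.range n, 10 / (a₀ + k) ^ 2 := by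
  induction n with
  | zero => simp
  | succ n ih =>
    have ha' : 0 < a := ha₀.trans_le ha
    have hk : 0 < a + n := by positivity
    have hk' : a₀ + n ≤ a + n := by linarith
    have h1 := abs_trapezoid_sub_integral_le (a := a + n) (ζ := 10 / (a₀ + n) ^ 2)
      (fun x hx => hf.vert_hasDerivAt h (hk.trans_le hx.1) b) (fun x hx y hy => by
        refine (hf.abs_deriv_vert_sub_le h hk hx.1 hy.1 b).trans ?_
        have h2 : |y - x| ≤ 1 := abs_le.2 ⟨by linarith [hx.2, hy.1], by linarith [hx.1, hy.2]⟩
        calc 10 / (a + n) ^ 2 * |y - x| ≤ 10 / (a + n) ^ 2 * 1 :=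
              mul_le_mul_of_nonneg_left h2 (by positivity)
          _ ≤ _ := by
            rw [mul_one]
            exact div_le_div_of_nonneg_left (by norm_num) (by positivity)
              (pow_le_pow_left₀ (by positivity) hk' 2))
    have hi : ∀ c d : ℝ, 0 < c → 0 < d → IntervalIntegrable (vert F b) volume c d := by
      intro c d hc hd
      refine ContinuousOn.intervalIntegrable ((hf.vert_continuousOn h b).mono fun x hx => ?_)
      exact (lt_min hc hd).trans_le hx.1
    rw [Finset.sum_range_succ, Finset.sum_range_succ (fun k : ℕ => 10 / (a₀ + (k : ℝ)) ^ 2) n]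
    have e1 : a + (n + 1 : ℕ) = a + n + 1 := by
      push_cast
      ring
    rw [e1, ← intervalIntegral.integral_add_adjacent_intervals (hi a (a + n) (by linarith) hk)
      (hi (a + n) (a + n + 1) hk (by linarith))]
    refine le_trans (le_of_eq ?_) ((abs_add_le _ _).trans (add_le_add ih h1))
    congr 1
    ring

/-- The two-sided estimate of `|W(a + ib)|`. -/
theorem W_bounds (hf : IsBernstein f) (h : IsHolomorphicExtension f F) {a₀ a : ℝ}
    (ha₀ : 0 < a₀) (ha : a₀ ≤ a) (b : ℝ) :
    Real.exp (-∑' k : ℕ, 10 / (a₀ + k) ^ 2) *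
      (√(f a) * (W F a).re / √‖F (a + b * Complex.I)‖ * Real.exp (-|b| * Theta F a |b|)) ≤
        ‖W F (a + b * Complex.I)‖ ∧
    ‖W F (a + b * Complex.I)‖ ≤ (Real.exp (-∑' k : ℕ, 10 / (a₀ + k) ^ 2))⁻¹ *
      (√(f a) * (W F a).re / √‖F (a + b * Complex.I)‖ * Real.exp (-|b| * Theta F a |b|)) := by
  have ha' : 0 < a := ha₀.trans_le ha
  set C := ∑' k : ℕ, 10 / (a₀ + k) ^ 2 with hC
  have hsum : Summable fun k : ℕ => 10 / (a₀ + k) ^ 2 := by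
    have h1 : Summable fun k : ℕ => 10 / (a₀ + (k + 1 : ℕ)) ^ 2 := by
      refine Summable.of_nonneg_of_le (fun k => by positivity) (fun k => ?_)
        ((summable_nat_add_iff 1).2 (summable_const_div_nat_sq 10))
      exact div_le_div_of_nonneg_left (by norm_num) (by positivity)
        (pow_le_pow_left₀ (by positivity) (by linarith) 2)
    exact (summable_nat_add_iff (f := fun k : ℕ => 10 / (a₀ + k) ^ 2) 1).1 h1
  have hle : ∀ n, ∑ k ∈ Finset.range n, 10 / (a₀ + k) ^ 2 ≤ C := fun n =>
    hsum.sum_le_tsum _ fun k _ => by positivity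
  set I := |b| * Theta F a |b| with hI
  have hna : ∀ k : ℕ, F ((a + k : ℝ) : ℂ) ≠ 0 := fun k =>
    hf.ne_zero h (by rw [Complex.ofReal_re]; positivity)
  have hnab : ∀ k : ℕ, F (((a + k : ℝ) : ℂ) + b * Complex.I) ≠ 0 := fun k =>
    hf.ne_zero h (by rw [re_add_mul_I]; positivity)
  have htop : Tendsto (fun n : ℕ => a + (n : ℝ)) atTop atTop :=
    tendsto_atTop_add_const_left _ _ tendsto_natCast_atTop_atTop
  have hlim : Tendsto (fun n : ℕ => (vert F b a + vert F b (a + n)) / 2 +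
      ∫ x in a..a + n, vert F b x) atTop (𝓝 ((vert F b a + 0) / 2 + I)) := by
    have h1 := intervalIntegral_tendsto_integral_Ioi a (hf.integrableOn_vert h ha' b) htop
    rw [hf.integral_vert h ha' b] at h1
    have h2 : Tendsto (fun n : ℕ => vert F b (a + n)) atTop (𝓝 0) := by
      have h3 : Tendsto (fun x : ℝ => 5 / x ^ 2 * b ^ 2) atTop (𝓝 (0 * b ^ 2)) := by
        refine Tendsto.mul_const _ ?_
        exact Tendsto.const_div_atTop (tendsto_pow_atTop (by norm_num)) 5
      rw [zero_mul] at h3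
      refine squeeze_zero (fun n => hf.vert_nonneg h (by positivity) b)
        (fun n => hf.vert_le h (by positivity) b) (h3.comp htop)
    exact ((h2.const_add _).div_const 2).add h1
  rw [add_zero] at hlim
  have hexp := ((Real.continuous_exp.tendsto _).comp hlim.neg)
  have key : √(f a) * (W F a).re / √‖F (a + b * Complex.I)‖ * Real.exp (-|b| * Theta F a |b|) =
      ‖W F a‖ * Real.exp (-(vert F b a / 2 + I)) := by
    -- The half weight of the trapezoidal rule at the left endpoint is the source of both square
    -- roots.
    have h1 : Real.exp (-(vert F b a / 2)) = √(f a) / √‖F (a + b * Complex.I)‖ := by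
      have h2 : 0 < ‖F (a + b * Complex.I)‖ := by simpa using norm_pos_iff.2 (hnab 0)
      rw [vert, hf.norm_ofReal h ha', ← Real.log_sqrt (by positivity [hf.pos h ha']), Real.exp_neg,
        Real.exp_log (Real.sqrt_pos.2 (div_pos h2 (hf.pos h ha'))), Real.sqrt_div h2.le, inv_div]
    rw [hf.re_W_ofReal h ha', neg_add, Real.exp_add, h1, hI, neg_mul]
    ring
  rw [key]
  have hW := (hf.tendsto_partialW h (a + b * Complex.I)).norm
  have hWa := (hf.tendsto_partialW h a).norm
  constructor
  · have h1 := (hWa.mul hexp).const_mul (Real.exp (-C))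
    refine le_of_tendsto_of_tendsto' h1 hW fun n => ?_
    rw [norm_partialW_eq_exp h hna hnab, mul_left_comm]
    refine mul_le_mul_of_nonneg_left ?_ (norm_nonneg _)
    simp only [Function.comp_apply]
    rw [← Real.exp_add, Real.exp_le_exp]
    have := (abs_le.1 ((hf.abs_sum_vert_sub_le h ha₀ ha b n).trans (hle n))).2
    linarith
  · have h1 := (hWa.mul hexp).const_mul (Real.exp (-C))⁻¹
    refine le_of_tendsto_of_tendsto' hW h1 fun n => ?_
    rw [norm_partialW_eq_exp h hna hnab, mul_left_comm]
    refine mul_le_mul_of_nonneg_left ?_ (norm_nonneg _)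
    simp only [Function.comp_apply]
    rw [← Real.exp_neg, neg_neg, ← Real.exp_add, Real.exp_le_exp]
    have := (abs_le.1 ((hf.abs_sum_vert_sub_le h ha₀ ha b n).trans (hle n))).1
    linarith

end IsBernstein

/-! ### Existence of the holomorphic extension -/

namespace IsBernstein

variable {f : ℝ → ℝ}

/-- The Cauchy form is essential: its factor `(x - ξ) ^ n` combines with the coefficient bound `f ξ
/ ξ ^ (n + 1)` into a power of `(ξ - x) / ξ`. -/
theorem exists_taylor_remainder (hf : IsBernstein f) {x R : ℝ} (hx : 0 < x) (hxR : x < R) (n : ℕ) :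
    ∃ ξ ∈ Ioo x R, f x = ∑ k ∈ Finset.range (n + 1),
      iteratedDeriv k f R / k.factorial * (x - R) ^ k +
        iteratedDeriv (n + 1) f ξ * (x - ξ) ^ n / n.factorial * (x - R) := by
  have huIcc : uIcc R x = Icc x R := uIcc_of_ge hxR.le
  have huIoo : uIoo R x = Ioo x R := by
    rw [uIoo, min_eq_right hxR.le, max_eq_left hxR.le]
  have hsub : uIcc R x ⊆ Ioi 0 := by
    rw [huIcc]
    exact fun u hu => hx.trans_le hu.1
  have hu : UniqueDiffOn ℝ (uIcc R x) := uniqueDiffOn_uIcc hxR.ne'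
  have hcd : ∀ m : ℕ, ContDiffOn ℝ m f (uIcc R x) := fun m =>
    (hf.smooth.mono hsub).of_le (by exact_mod_cast le_top)
  have hat : ∀ (m : ℕ) (u : ℝ), u ∈ uIcc R x →
      iteratedDerivWithin m f (uIcc R x) u = iteratedDeriv m f u := by
    intro m u hu'
    refine iteratedDerivWithin_eq_iteratedDeriv hu ?_ hu'
    exact (hf.smooth.contDiffAt (Ioi_mem_nhds (hsub hu'))).of_le (by exact_mod_cast le_top)
  have hd : DifferentiableOn ℝ (iteratedDerivWithin n f (uIcc R x)) (uIcc R x) := by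
    refine (hcd (n + 1)).differentiableOn_iteratedDerivWithin ?_ hu
    exact_mod_cast n.lt_succ_self
  obtain ⟨ξ, hξ, hξ'⟩ := taylor_mean_remainder_cauchy hxR.ne' (hcd n)
    (hd.mono (by rw [huIcc, huIoo]; exact Ioo_subset_Icc_self))
  rw [huIoo] at hξ
  refine ⟨ξ, hξ, ?_⟩
  rw [hat _ ξ (by rw [huIcc]; exact Ioo_subset_Icc_self hξ), taylor_within_apply] at hξ'
  have hsum : ∑ k ∈ Finset.range (n + 1), ((k.factorial : ℝ)⁻¹ * (x - R) ^ k) •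
      iteratedDerivWithin k f (uIcc R x) R =
      ∑ k ∈ Finset.range (n + 1), iteratedDeriv k f R / k.factorial * (x - R) ^ k := by
    refine Finset.sum_congr rfl fun k _ => ?_
    rw [hat k R left_mem_uIcc, smul_eq_mul]
    ring
  rw [← hξ', hsum]
  ring

theorem le_of_lt (hf : IsBernstein f) {x R : ℝ} (hx : 0 < x) (hxR : x < R) : f x ≤ f R := by
  obtain ⟨ξ, hξ, h⟩ := hf.exists_taylor_remainder hx hxR 0
  have h1 := hf.alternating 0 (hx.trans hξ.1)
  simp only [pow_zero, one_mul] at h1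
  simp only [zero_add, Finset.sum_range_one, iteratedDeriv_zero, Nat.factorial_zero, Nat.cast_one,
    div_one, pow_zero, mul_one] at h
  rw [zero_add] at h1
  nlinarith

theorem neg_one_pow_mul_sub_pow (a b : ℝ) (k : ℕ) : (a - b) ^ k = (-1) ^ k * (b - a) ^ k := by
  rw [← mul_pow]
  congr 1
  ring

/-- For `x < R` every Taylor term of positive degree, and the remainder, is non-positive. As `f x ≥
0`, each of them is at most `f R` in absolute value; then `x → 0`. -/
theorem taylorCoeff_le (hf : IsBernstein f) {R : ℝ} (hR : 0 < R) (n : ℕ) :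
    (-1) ^ n * iteratedDeriv (n + 1) f R * R ^ (n + 1) ≤ (n + 1).factorial * f R := by
  have key : ∀ x ∈ Ioo 0 R,
      (-1) ^ n * iteratedDeriv (n + 1) f R * (R - x) ^ (n + 1) ≤ (n + 1).factorial * f R := by
    intro x hx
    obtain ⟨ξ, hξ, h⟩ := hf.exists_taylor_remainder hx.1 hx.2 (n + 1)
    have hξ0 : 0 < ξ := hx.1.trans hξ.1
    have hrem : iteratedDeriv (n + 1 + 1) f ξ * (x - ξ) ^ (n + 1) / (n + 1).factorial * (x - R) ≤
        0 := by
      have h1 := hf.alternating (n + 1) hξ0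
      rw [neg_one_pow_mul_sub_pow]
      have h2 : 0 ≤ ((-1) ^ (n + 1) * iteratedDeriv (n + 1 + 1) f ξ) * (ξ - x) ^ (n + 1) /
          (n + 1).factorial :=
        div_nonneg (mul_nonneg h1 (pow_nonneg (by linarith [hξ.1]) _)) (by positivity)
      have h3 : x - R ≤ 0 := by linarith [hx.2]
      refine le_trans (le_of_eq ?_) (mul_nonpos_of_nonneg_of_nonpos h2 h3)
      ring
    have hterm : ∀ k : ℕ, iteratedDeriv (k + 1) f R / (k + 1).factorial * (x - R) ^ (k + 1) =
        -((-1) ^ k * iteratedDeriv (k + 1) f R * (R - x) ^ (k + 1) / (k + 1).factorial) := by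
      intro k
      rw [neg_one_pow_mul_sub_pow, pow_succ (-1 : ℝ) k]
      ring
    rw [Finset.sum_range_succ'] at h
    simp only [hterm, Finset.sum_neg_distrib] at h
    have h4 := Finset.single_le_sum (f := fun k : ℕ => (-1) ^ k * iteratedDeriv (k + 1) f R *
      (R - x) ^ (k + 1) / ((k + 1).factorial : ℝ)) (s := Finset.range (n + 1)) (fun k _ =>
        div_nonneg (mul_nonneg (hf.alternating k hR) (pow_nonneg (by linarith [hx.2]) _))
          (by positivity)) (Finset.mem_range.2 n.lt_succ_self)
    simp only [iteratedDeriv_zero, Nat.factorial_zero, Nat.cast_one, div_one, pow_zero,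
      mul_one] at h h4
    have h5 := hf.nonneg x hx.1
    have h6 : (-1) ^ n * iteratedDeriv (n + 1) f R * (R - x) ^ (n + 1) / ((n + 1).factorial : ℝ) ≤
      f R := by linarith
    rwa [div_le_iff₀ (by positivity), mul_comm (f R)] at h6
  have h1 : Tendsto (fun x : ℝ => (-1) ^ n * iteratedDeriv (n + 1) f R * (R - x) ^ (n + 1))
      (𝓝[>] 0) (𝓝 ((-1) ^ n * iteratedDeriv (n + 1) f R * (R - 0) ^ (n + 1))) :=
    (Continuous.tendsto (by fun_prop) 0).mono_left nhdsWithin_le_nhds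
  rw [sub_zero] at h1
  refine le_of_tendsto h1 ?_
  filter_upwards [Ioo_mem_nhdsGT hR] with x hx
  exact key x hx

theorem abs_taylorCoeff_le (hf : IsBernstein f) {R : ℝ} (hR : 0 < R) (n : ℕ) :
    |iteratedDeriv n f R / n.factorial| ≤ f R / R ^ n := by
  rcases n with _ | n
  · simp [abs_of_nonneg (hf.nonneg R hR)]
  · have h1 := hf.taylorCoeff_le hR n
    have h2 : |iteratedDeriv (n + 1) f R| = (-1) ^ n * iteratedDeriv (n + 1) f R := by
      rw [← abs_of_nonneg (hf.alternating n hR), abs_mul]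
      simp
    rw [abs_div, h2, Nat.abs_cast, div_le_div_iff₀ (by positivity) (by positivity)]
    linarith

/-- For every `ξ` in `(x, R)` the ratio `(ξ - x) / ξ` is at most `q = (R - x) / R < 1`, so the
remainder is `O((n + 1) q ^ n)` wherever the intermediate point lies. -/
theorem hasSum_taylor_real (hf : IsBernstein f) {x R : ℝ} (hx : 0 < x) (hxR : x < R) :
    HasSum (fun k : ℕ => iteratedDeriv k f R / k.factorial * (x - R) ^ k) (f x) := by
  have hR : 0 < R := hx.trans hxR
  have hfR := hf.nonneg R hR
  set q := (R - x) / R with hq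
  have hq0 : 0 ≤ q := div_nonneg (by linarith) hR.le
  have hq1 : q < 1 := (div_lt_one hR).2 (by linarith)
  have hsum : Summable fun k : ℕ => iteratedDeriv k f R / k.factorial * (x - R) ^ k := by
    refine Summable.of_norm_bounded
      ((summable_geometric_of_lt_one hq0 hq1).mul_left (f R)) fun k => ?_
    rw [norm_mul, Real.norm_eq_abs, norm_pow, Real.norm_eq_abs, abs_sub_comm x R,
      abs_of_pos (by linarith : 0 < R - x), hq, div_pow]
    refine (mul_le_mul_of_nonneg_right (hf.abs_taylorCoeff_le hR k)
      (pow_nonneg (by linarith) _)).trans (le_of_eq ?_)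
    ring
  have hlim : Tendsto (fun n : ℕ => ∑ k ∈ Finset.range (n + 1),
      iteratedDeriv k f R / k.factorial * (x - R) ^ k) atTop (𝓝 (f x)) := by
    rw [tendsto_iff_norm_sub_tendsto_zero]
    have h0 : Tendsto (fun n : ℕ => ((n : ℝ) * q ^ n + q ^ n) * (f R * (R - x) / x)) atTop
        (𝓝 ((0 + 0) * (f R * (R - x) / x))) :=
      ((tendsto_self_mul_const_pow_of_lt_one hq0 hq1).add
        (tendsto_pow_atTop_nhds_zero_of_lt_one hq0 hq1)).mul_const _
    rw [add_zero, zero_mul] at h0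
    refine squeeze_zero (fun _ => norm_nonneg _) (fun n => ?_) h0
    obtain ⟨ξ, hξ, h⟩ := hf.exists_taylor_remainder hx hxR n
    have hξ0 : 0 < ξ := hx.trans hξ.1
    have h1 : ∑ k ∈ Finset.range (n + 1), iteratedDeriv k f R / k.factorial * (x - R) ^ k - f x =
        -(iteratedDeriv (n + 1) f ξ * (x - ξ) ^ n / n.factorial * (x - R)) := by
      linarith
    have h2 := hf.abs_taylorCoeff_le hξ0 (n + 1)
    have h3 := hf.le_of_lt hξ0 hξ.2
    have h4 : |iteratedDeriv (n + 1) f ξ| ≤ (n + 1) * n.factorial * (f R / ξ ^ (n + 1)) := by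
      rw [abs_div, Nat.abs_cast, div_le_iff₀ (by positivity), Nat.factorial_succ] at h2
      push_cast at h2
      refine h2.trans ?_
      rw [mul_comm]
      gcongr
    have h5 : (ξ - x) / ξ ≤ q := by
      rw [hq, div_le_div_iff₀ hξ0 hR]
      nlinarith [hξ.2]
    have h6 : 0 ≤ (ξ - x) / ξ := div_nonneg (by linarith [hξ.1]) hξ0.le
    rw [h1, norm_neg, Real.norm_eq_abs, abs_mul, abs_div, abs_mul, abs_pow, abs_sub_comm x R,
      abs_sub_comm x ξ, Nat.abs_cast, abs_of_pos (by linarith : 0 < R - x),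
      abs_of_pos (by linarith [hξ.1] : 0 < ξ - x)]
    have h7 : 0 < ξ - x := by linarith [hξ.1]
    have h8 : 0 < R - x := by linarith
    calc |iteratedDeriv (n + 1) f ξ| * (ξ - x) ^ n / n.factorial * (R - x)
        ≤ (n + 1) * n.factorial * (f R / ξ ^ (n + 1)) * (ξ - x) ^ n / n.factorial * (R - x) := by
          gcongr
      _ = (n + 1) * ((ξ - x) / ξ) ^ n * (f R * (R - x) / ξ) := by
          rw [div_pow, pow_succ]
          field_simp
      _ ≤ (n + 1) * q ^ n * (f R * (R - x) / x) := by
          gcongr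
          exact hξ.1.le
      _ = _ := by ring
  exact hsum.hasSum_iff.2 (tendsto_nhds_unique
    ((tendsto_add_atTop_iff_nat 1).2 hsum.hasSum.tendsto_sum_nat) hlim)

/-- The sum of the Taylor series at `R`. -/
noncomputable def taylorSum (f : ℝ → ℝ) (R : ℝ) (z : ℂ) : ℂ :=
  ∑' k : ℕ, ((iteratedDeriv k f R / k.factorial : ℝ) : ℂ) * (z - R) ^ k

theorem differentiableOn_taylorSum (hf : IsBernstein f) {R : ℝ} (hR : 0 < R) :
    DifferentiableOn ℂ (taylorSum f R) (Metric.ball (R : ℂ) R) := by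
  intro z hz
  have hz' : ‖z - R‖ < R := by simpa [dist_eq_norm] using hz
  obtain ⟨ρ, hρ1, hρ2⟩ := exists_between hz'
  have hρ0 : 0 ≤ ρ := (norm_nonneg _).trans hρ1.le
  have hfR := hf.nonneg R hR
  have h1 : DifferentiableOn ℂ (taylorSum f R) (Metric.ball (R : ℂ) ρ) := by
    refine Complex.differentiableOn_tsum_of_summable_norm (u := fun k => f R * (ρ / R) ^ k)
      ((summable_geometric_of_lt_one (by positivity) ((div_lt_one hR).2 hρ2)).mul_left _)
      (fun k => by fun_prop) Metric.isOpen_ball fun k w hw => ?_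
    have hw' : ‖w - R‖ < ρ := by simpa [dist_eq_norm] using hw
    rw [norm_mul, norm_pow, Complex.norm_real, Real.norm_eq_abs]
    calc _ ≤ f R / R ^ k * ρ ^ k := by
          gcongr
          exact hf.abs_taylorCoeff_le hR k
      _ = _ := by
          rw [div_pow]
          ring
  exact (h1.differentiableAt (Metric.isOpen_ball.mem_nhds
    (by simpa [dist_eq_norm] using hρ1))).differentiableWithinAt

theorem taylorSum_ofReal (hf : IsBernstein f) {x R : ℝ} (hx : 0 < x) (hxR : x < R) :
    taylorSum f R x = f x := by
  rw [taylorSum]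
  refine HasSum.tsum_eq ?_
  have := hf.hasSum_taylor_real hx hxR
  exact_mod_cast Complex.hasSum_ofReal.2 this

theorem taylorSum_eq (hf : IsBernstein f) {R S : ℝ} (hR : 0 < R) (hRS : R ≤ S) {z : ℂ}
    (hz : z ∈ Metric.ball (R : ℂ) R) : taylorSum f R z = taylorSum f S z := by
  have hsub : Metric.ball (R : ℂ) R ⊆ Metric.ball (S : ℂ) S := by
    refine Metric.ball_subset_ball' ?_
    rw [dist_eq_norm, ← Complex.ofReal_sub, Complex.norm_real, Real.norm_eq_abs,
      abs_of_nonpos (by linarith)]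
    linarith
  have hmem : ((R / 2 : ℝ) : ℂ) ∈ Metric.ball (R : ℂ) R := by
    rw [Metric.mem_ball, dist_eq_norm, ← Complex.ofReal_sub, Complex.norm_real, Real.norm_eq_abs,
      abs_of_nonpos (by linarith)]
    linarith
  refine AnalyticOnNhd.eqOn_of_preconnected_of_frequently_eq
    ((hf.differentiableOn_taylorSum hR).analyticOnNhd Metric.isOpen_ball)
    (((hf.differentiableOn_taylorSum (hR.trans_le hRS)).mono hsub).analyticOnNhd
      Metric.isOpen_ball) (convex_ball _ _).isPreconnected hmem ?_ hz
  have h1 : Tendsto (fun u : ℝ => (u : ℂ)) (𝓝[≠] (R / 2)) (𝓝[≠] ((R / 2 : ℝ) : ℂ)) := by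
    refine tendsto_nhdsWithin_iff.2
      ⟨(Complex.continuous_ofReal.tendsto _).mono_left nhdsWithin_le_nhds, ?_⟩
    filter_upwards [self_mem_nhdsWithin] with u hu
    exact fun h => hu (Complex.ofReal_injective h)
  refine h1.frequently (Eventually.frequently ?_)
  filter_upwards [mem_nhdsWithin_of_mem_nhds
    (Ioo_mem_nhds (half_pos hR) (half_lt_self hR))] with u hu
  rw [hf.taylorSum_ofReal hu.1 hu.2, hf.taylorSum_ofReal hu.1 (hu.2.trans_le hRS)]

/-- The disc condition reads `‖z‖² < 2 R z.re`, so the discs about `R` exhaust the half-plane as `R`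
grows. -/
theorem mem_ball_of_lt {z : ℂ} (hz : 0 < z.re) {R : ℝ} (hR : ‖z‖ ^ 2 / z.re < R) :
    z ∈ Metric.ball (R : ℂ) R := by
  have hR0 : 0 < R := lt_of_le_of_lt (by positivity) hR
  rw [div_lt_iff₀ hz] at hR
  rw [Metric.mem_ball, dist_eq_norm]
  refine lt_of_pow_lt_pow_left₀ 2 hR0.le ?_
  rw [← Complex.normSq_eq_norm_sq, Complex.normSq_apply] at hR ⊢
  simp only [Complex.sub_re, Complex.ofReal_re, Complex.sub_im, Complex.ofReal_im]
  nlinarith [mul_pos hR0 hz]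

/-- Bernstein functions extend holomorphically to the right half-plane. -/
theorem exists_extension (hf : IsBernstein f) : ∃ F : ℂ → ℂ, IsHolomorphicExtension f F := by
  refine ⟨fun z => taylorSum f (‖z‖ ^ 2 / z.re + 1) z, fun z hz => ?_, fun u hu => ?_⟩
  · have hz' : 0 < z.re := hz
    -- The centre used at `w` moves with `w`. For `w` near `z` it stays below this fixed `S`, and
    -- the expansions agree there by `taylorSum_eq`.
    set S := ‖z‖ ^ 2 / z.re + 2 with hS
    have hS0 : 0 < S := by positivity
    have hcont : ContinuousAt (fun w : ℂ => ‖w‖ ^ 2 / w.re) z :=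
      ContinuousAt.div (by fun_prop) (by fun_prop) hz'.ne'
    have hev : ∀ᶠ w in 𝓝 z, ‖w‖ ^ 2 / w.re < ‖z‖ ^ 2 / z.re + 1 :=
      hcont.eventually_lt_const (by linarith)
    have h1 : DifferentiableAt ℂ (taylorSum f S) z :=
      (hf.differentiableOn_taylorSum hS0).differentiableAt
        (Metric.isOpen_ball.mem_nhds (mem_ball_of_lt hz' (by linarith)))
    refine (h1.congr_of_eventuallyEq ?_).differentiableWithinAt
    filter_upwards [hev, isOpen_rightHalfPlane.mem_nhds hz] with w hw hw0
    have hw0' : 0 < w.re := hw0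
    exact hf.taylorSum_eq (by positivity) (by linarith) (mem_ball_of_lt hw0' (by linarith))
  · refine hf.taylorSum_ofReal hu ?_
    rw [Complex.norm_real, Real.norm_of_nonneg hu.le, Complex.ofReal_re, sq,
      mul_div_cancel_right₀ _ hu.ne']
    linarith

end IsBernstein

/-! ### A Vitali convergence theorem on the right half-plane -/

/-- A family of functions, eventually holomorphic on the right half-plane and bounded on discs
about the positive half-line. -/
structure LocallyBoundedFamily {ι : Type*} (l : Filter ι) (E : ι → ℂ → ℂ) : Prop where
  holomorphic : ∀ᶠ b in l, DifferentiableOn ℂ (E b) {z : ℂ | 0 < z.re}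
  bounded : ∀ R ρ : ℝ, 0 < ρ → ρ < R →
    ∃ M : ℝ, ∀ᶠ b in l, ∀ z ∈ Metric.closedBall (R : ℂ) ρ, ‖E b z‖ ≤ M

namespace LocallyBoundedFamily

variable {ι : Type*} {l : Filter ι} {E : ι → ℂ → ℂ}

theorem closedBall_subset {R ρ : ℝ} (h : ρ < R) :
    Metric.closedBall (R : ℂ) ρ ⊆ {z : ℂ | 0 < z.re} :=
  (Metric.closedBall_subset_ball h).trans (ball_subset_rightHalfPlane R)

protected theorem deriv (h : LocallyBoundedFamily l E) :
    LocallyBoundedFamily l (fun b => deriv (E b)) where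
  holomorphic := h.holomorphic.mono fun _ hb => hb.deriv isOpen_rightHalfPlane
  bounded := by
    intro R ρ hρ hρR
    obtain ⟨M, hM⟩ := h.bounded R ((ρ + R) / 2) (by linarith) (by linarith)
    refine ⟨M / ((R - ρ) / 2), ?_⟩
    filter_upwards [hM, h.holomorphic] with b hb hd z hz
    have hsub : Metric.closedBall z ((R - ρ) / 2) ⊆ Metric.closedBall (R : ℂ) ((ρ + R) / 2) := by
      refine Metric.closedBall_subset_closedBall' ?_
      have := Metric.mem_closedBall.1 hz
      linarith
    refine Complex.norm_deriv_le_of_forall_mem_sphere_norm_le (by linarith) ?_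
      fun w hw => hb w (hsub (Metric.sphere_subset_closedBall hw))
    refine (hd.mono ((Metric.closure_ball_subset_closedBall.trans hsub).trans
      (closedBall_subset (by linarith)))).diffContOnCl

/-- The derivative is compared with a difference quotient of step `t`. Local boundedness of second
derivatives makes the error at most `K' t`, at most `ε / 4`; with `t` fixed, both values in the
quotient tend to zero. -/
theorem tendsto_deriv_ofReal (h : LocallyBoundedFamily l E)
    (h0 : ∀ x : ℝ, 0 < x → Tendsto (fun b => E b x) l (𝓝 0)) {x : ℝ} (hx : 0 < x) :
    Tendsto (fun b => deriv (E b) x) l (𝓝 0) := by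
  obtain ⟨K, hK⟩ := h.deriv.deriv.bounded x (x / 2) (by linarith) (by linarith)
  set K' := |K| + 1 with hK'
  have hK'0 : 0 < K' := by positivity
  rw [Metric.tendsto_nhds]
  intro ε hε
  set t := min (x / 2) (ε / (4 * K')) with ht
  have ht0 : 0 < t := lt_min (by linarith) (by positivity)
  have ht1 : t ≤ x / 2 := min_le_left _ _
  have ht2 : K' * t ≤ ε / 4 := by
    calc K' * t ≤ K' * (ε / (4 * K')) := mul_le_mul_of_nonneg_left (min_le_right _ _) hK'0.le
      _ = ε / 4 := by field_simp
  have e1 := Metric.tendsto_nhds.1 (h0 x hx) (ε * t / 4) (by positivity)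
  have e2 := Metric.tendsto_nhds.1 (h0 (x + t) (by linarith)) (ε * t / 4) (by positivity)
  filter_upwards [hK, h.holomorphic, e1, e2] with b hb hd h1 h2
  rw [dist_zero_right] at h1 h2 ⊢
  set B := Metric.closedBall (x : ℂ) (x / 2) with hB
  have hBs : B ⊆ {z : ℂ | 0 < z.re} := closedBall_subset (by linarith)
  have hBt : Metric.closedBall (x : ℂ) t ⊆ B := Metric.closedBall_subset_closedBall ht1
  have hda : ∀ w ∈ B, DifferentiableAt ℂ (E b) w := fun w hw =>
    hd.differentiableAt (isOpen_rightHalfPlane.mem_nhds (hBs hw))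
  have hda' : ∀ w ∈ B, DifferentiableAt ℂ (deriv (E b)) w := fun w hw =>
    (hd.deriv isOpen_rightHalfPlane).differentiableAt (isOpen_rightHalfPlane.mem_nhds (hBs hw))
  have hxB : (x : ℂ) ∈ B := Metric.mem_closedBall_self (by linarith)
  have h3 : ∀ w ∈ Metric.closedBall (x : ℂ) t, ‖deriv (E b) w - deriv (E b) x‖ ≤ K' * t := by
    intro w hw
    have h4 := (convex_closedBall (x : ℂ) (x / 2)).norm_image_sub_le_of_norm_hasDerivWithin_le
      (fun z hz => (hda' z hz).hasDerivAt.hasDerivWithinAt) (C := K')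
      (fun z hz => (hb z hz).trans ((le_abs_self K).trans (by rw [hK']; linarith))) hxB (hBt hw)
    exact h4.trans (mul_le_mul_of_nonneg_left (by simpa [dist_eq_norm] using hw) hK'0.le)
  have h5 := (convex_closedBall (x : ℂ) t).norm_image_sub_le_of_norm_hasDerivWithin_le
    (f := fun w => E b w - w * deriv (E b) x) (f' := fun w => deriv (E b) w - deriv (E b) x)
    (C := K' * t) (x := (x : ℂ)) (y := ((x + t : ℝ) : ℂ))
    (fun z hz => by
      have := ((hda z (hBt hz)).hasDerivAt.sub ((hasDerivAt_id z).mul_const (deriv (E b) x)))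
      rw [one_mul] at this
      exact this.hasDerivWithinAt) h3 (Metric.mem_closedBall_self ht0.le)
    (by simp [dist_eq_norm, abs_of_pos ht0])
  have h6 : ‖((x + t : ℝ) : ℂ) - x‖ = t := by
    rw [← Complex.ofReal_sub, add_sub_cancel_left, Complex.norm_real, Real.norm_of_nonneg ht0.le]
  rw [h6] at h5
  have h7 : (t : ℂ) * deriv (E b) x = E b ((x + t : ℝ) : ℂ) - E b x -
      ((E b ((x + t : ℝ) : ℂ) - ((x + t : ℝ) : ℂ) * deriv (E b) x) -
        (E b x - x * deriv (E b) x)) := by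
    push_cast
    ring
  have h8 : t * ‖deriv (E b) x‖ ≤ ‖E b ((x + t : ℝ) : ℂ)‖ + ‖E b x‖ + K' * t * t := by
    have : t * ‖deriv (E b) x‖ = ‖(t : ℂ) * deriv (E b) x‖ := by
      rw [norm_mul, Complex.norm_real, Real.norm_of_nonneg ht0.le]
    rw [this, h7]
    exact (norm_sub_le _ _).trans (add_le_add (norm_sub_le _ _) h5)
  have h9 : t * ‖deriv (E b) x‖ < t * ε := by nlinarith
  exact lt_of_mul_lt_mul_left h9 ht0.le

theorem iteratedDeriv (h : LocallyBoundedFamily l E)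
    (h0 : ∀ x : ℝ, 0 < x → Tendsto (fun b => E b x) l (𝓝 0)) (n : ℕ) :
    LocallyBoundedFamily l (fun b => iteratedDeriv n (E b)) ∧
      ∀ x : ℝ, 0 < x → Tendsto (fun b => _root_.iteratedDeriv n (E b) x) l (𝓝 0) := by
  induction n with
  | zero => simpa using ⟨h, h0⟩
  | succ n ih =>
    simp only [iteratedDeriv_succ]
    exact ⟨ih.1.deriv, fun x hx => ih.1.tendsto_deriv_ofReal ih.2 hx⟩

/-- A locally bounded family of holomorphic functions on the right half-plane that tends to zero
on the positive half-line tends to zero everywhere. -/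
theorem tendsto_zero (h : LocallyBoundedFamily l E)
    (h0 : ∀ x : ℝ, 0 < x → Tendsto (fun b => E b x) l (𝓝 0)) {z : ℂ} (hz : 0 < z.re) :
    Tendsto (fun b => E b z) l (𝓝 0) := by
  set R := ‖z‖ ^ 2 / z.re + 1 with hR
  have hR0 : 0 < R := by positivity
  have hzR : ‖z - R‖ < R := by
    simpa [dist_eq_norm] using IsBernstein.mem_ball_of_lt hz (R := R) (by linarith)
  obtain ⟨ρ, hρ1, hρ2⟩ := exists_between hzR
  have hρ0 : 0 < ρ := (norm_nonneg _).trans_lt hρ1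
  obtain ⟨M, hM⟩ := h.bounded R ρ hρ0 hρ2
  have hsum : Summable fun n : ℕ => M * (‖z - R‖ / ρ) ^ n :=
    (summable_geometric_of_lt_one (by positivity) ((div_lt_one hρ0).2 hρ1)).mul_left _
  -- Each Taylor coefficient at the real point `R` tends to zero, and Cauchy's estimates on radius
  -- `ρ` give a geometric majorant.
  have h1 := tendsto_tsum_of_dominated_convergence (𝓕 := l)
    (f := fun b (n : ℕ) => ((n.factorial : ℂ))⁻¹ • (z - R) ^ n • _root_.iteratedDeriv n (E b) R)
    (g := fun _ => (0 : ℂ)) hsum (fun n => ?_) ?_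
  · rw [tsum_zero] at h1
    refine h1.congr' ?_
    filter_upwards [h.holomorphic] with b hb
    exact Complex.taylorSeries_eq_on_ball (hb.mono (ball_subset_rightHalfPlane R))
      (by simpa [dist_eq_norm] using hzR)
  · have := (((h.iteratedDeriv h0 n).2 R hR0).const_smul ((z - R) ^ n)).const_smul
      ((n.factorial : ℂ))⁻¹
    simpa using this
  · filter_upwards [h.holomorphic, hM] with b hb hb' n
    have h2 := Complex.norm_iteratedDeriv_le_of_forall_mem_sphere_norm_le n hρ0
      (hb.mono ((Metric.closure_ball_subset_closedBall).trans
        (closedBall_subset hρ2))).diffContOnCl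
      (fun w hw => hb' w (Metric.sphere_subset_closedBall hw))
    rw [norm_smul, norm_smul, norm_inv, norm_pow, Complex.norm_natCast]
    calc _ ≤ (n.factorial : ℝ)⁻¹ * (‖z - R‖ ^ n * (n.factorial * M / ρ ^ n)) := by gcongr
      _ = _ := by
        rw [div_pow]
        field_simp

end LocallyBoundedFamily

/-! ### Regularly varying Bernstein functions -/

namespace IsBernstein

variable {f : ℝ → ℝ} {F : ℂ → ℂ}

theorem mem_closedBall_bounds {R ρ : ℝ} (hρ : 0 < ρ) (hρR : ρ < R) {z : ℂ}
    (hz : z ∈ Metric.closedBall (R : ℂ) ρ) :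
    R - ρ ≤ z.re ∧ z.re ≤ 2 * R ∧ ‖z‖ ≤ 2 * R := by
  rw [Metric.mem_closedBall, dist_eq_norm] at hz
  have h1 := abs_le.1 ((Complex.abs_re_le_norm (z - R)).trans hz)
  simp only [Complex.sub_re, Complex.ofReal_re] at h1
  have h2 : ‖z‖ ≤ ‖z - R‖ + ‖(R : ℂ)‖ := by
    simpa using norm_add_le (z - R) (R : ℂ)
  rw [Complex.norm_real, Real.norm_of_nonneg (by linarith)] at h2
  exact ⟨by linarith [h1.1], by linarith [h1.2], by linarith⟩

/-- The continuity theorem for regularly varying Bernstein functions. -/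
theorem tendsto_of_regularlyVarying (hf : IsBernstein f) (h : IsHolomorphicExtension f F)
    {C α : ℝ} (hC : 0 < C) (hreg : Tendsto (fun u : ℝ => f u / (C * u ^ α)) atTop (𝓝 1))
    {z : ℂ} (hz : 0 < z.re) :
    Tendsto (fun b : ℝ => F (b * z) / (C * b ^ α : ℝ)) atTop (𝓝 (z ^ (α : ℂ))) := by
  have hreal : ∀ x : ℝ, 0 < x →
      Tendsto (fun b : ℝ => f (b * x) / (C * b ^ α)) atTop (𝓝 (x ^ α)) := by
    intro x hx
    have h1 := (hreg.comp (tendsto_id.atTop_mul_const hx)).mul_const (x ^ α)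
    rw [one_mul] at h1
    refine h1.congr' ?_
    filter_upwards [eventually_gt_atTop 0] with b hb
    simp only [Function.comp_apply, id]
    rw [Real.mul_rpow hb.le hx.le]
    have : 0 < x ^ α := Real.rpow_pos_of_pos hx _
    have : 0 < b ^ α := Real.rpow_pos_of_pos hb _
    field_simp
  have hcpow : DifferentiableOn ℂ (fun z : ℂ => z ^ (α : ℂ)) {z : ℂ | 0 < z.re} := fun w hw =>
    ((hasDerivAt_id w).cpow_const (Or.inl hw)).differentiableAt.differentiableWithinAt
  have hfam : LocallyBoundedFamily atTop
      (fun (b : ℝ) (z : ℂ) => F (b * z) / (C * b ^ α : ℝ) - z ^ (α : ℂ)) := by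
    refine ⟨?_, ?_⟩
    · filter_upwards [eventually_gt_atTop 0] with b hb
      refine DifferentiableOn.sub (DifferentiableOn.div_const ?_ _) hcpow
      refine h.holomorphic.comp (by fun_prop) fun w hw => ?_
      have hw' : 0 < w.re := hw
      change 0 < ((b : ℂ) * w).re
      rw [Complex.re_ofReal_mul]
      positivity
    · intro R ρ hρ hρR
      obtain ⟨M₁, hM₁⟩ := (isCompact_closedBall (R : ℂ) ρ).exists_bound_of_continuousOn
        (hcpow.continuousOn.mono (LocallyBoundedFamily.closedBall_subset hρR))
      have hR0 : 0 < 2 * R := by linarith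
      -- On the disc `‖z‖ / z.re ≤ 2R / (R - ρ)`, so `norm_le` and monotonicity reduce the bound to
      -- the convergent real quotient at `2R`.
      refine ⟨2 * R / (R - ρ) * ((2 * R) ^ α + 1) + M₁, ?_⟩
      filter_upwards [eventually_gt_atTop 0,
        (hreal (2 * R) hR0).eventually_le_const (lt_add_one _)] with b hb hb1 z hz
      obtain ⟨hz1, hz2, hz3⟩ := mem_closedBall_bounds hρ hρR hz
      have hz0 : 0 < z.re := by linarith
      have hbz : 0 < ((b : ℂ) * z).re := by
        rw [Complex.re_ofReal_mul]
        positivity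
      have hD : 0 < C * b ^ α := mul_pos hC (Real.rpow_pos_of_pos hb _)
      refine (_root_.norm_sub_le _ _).trans (add_le_add ?_ (hM₁ z hz))
      rw [norm_div, Complex.norm_real, Real.norm_of_nonneg hD.le]
      have h2 := hf.norm_le h hbz
      rw [Complex.re_ofReal_mul, norm_mul, Complex.norm_real, Real.norm_of_nonneg hb.le,
        mul_div_mul_left _ _ hb.ne'] at h2
      have h3 : f (b * z.re) ≤ f (b * (2 * R)) :=
        hf.monotoneOn h (mul_pos hb hz0) (mul_pos hb hR0) (by gcongr)
      have h4 := hf.nonneg _ (mul_pos hb hR0)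
      have h5 := hf.nonneg _ (mul_pos hb hz0)
      have h6 : 0 < R - ρ := by linarith
      calc ‖F (b * z)‖ / (C * b ^ α) ≤ ‖z‖ / z.re * f (b * z.re) / (C * b ^ α) := by gcongr
        _ ≤ 2 * R / (R - ρ) * f (b * (2 * R)) / (C * b ^ α) := by
          gcongr
        _ = 2 * R / (R - ρ) * (f (b * (2 * R)) / (C * b ^ α)) := by ring
        _ ≤ _ := by gcongr
  have h5 := hfam.tendsto_zero (fun x hx => ?_) hz
  · simpa using h5.add_const (z ^ (α : ℂ))
  · have h6 := (Complex.continuous_ofReal.tendsto _).comp (hreal x hx)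
    rw [tendsto_iff_norm_sub_tendsto_zero] at h6
    rw [tendsto_zero_iff_norm_tendsto_zero]
    refine h6.congr' ?_
    filter_upwards [eventually_gt_atTop 0] with b hb
    rw [Function.comp_apply, Complex.ofReal_cpow hx.le]
    have := h.agrees (b * x) (mul_pos hb hx)
    rw [Complex.ofReal_mul] at this
    rw [this]
    push_cast
    rfl

theorem tendsto_angleIntegrand_of_regularlyVarying (hf : IsBernstein f)
    (h : IsHolomorphicExtension f F) {C α : ℝ} (hC : 0 < C)
    (hreg : Tendsto (fun u : ℝ => f u / (C * u ^ α)) atTop (𝓝 1)) {y : ℝ} (hy : 0 < y) :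
    Tendsto (fun b : ℝ => angleIntegrand F b y) atTop (𝓝 (α * logSlope y)) := by
  have hyI : 0 < ((y : ℂ) + Complex.I).re := by simpa using hy
  have hy' : 0 < (y : ℂ).re := by simpa using hy
  have h1 := (hf.tendsto_of_regularlyVarying h hC hreg hyI).norm
  have h2 := (hf.tendsto_of_regularlyVarying h hC hreg hy').norm
  have hpos : 0 < ‖(y : ℂ) + Complex.I‖ := norm_pos_iff.2 fun h0 => by simp [h0] at hyI
  have e1 : ‖((y : ℂ) + Complex.I) ^ (α : ℂ)‖ = ‖(y : ℂ) + Complex.I‖ ^ α :=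
    Complex.norm_cpow_real _ _
  have e2 : ‖(y : ℂ) ^ (α : ℂ)‖ = y ^ α := by
    rw [Complex.norm_cpow_real, Complex.norm_real, Real.norm_of_nonneg hy.le]
  rw [e1] at h1
  rw [e2] at h2
  have hyα := Real.rpow_pos_of_pos hy α
  have h3 := ((h1.div h2 hyα.ne').log (by positivity))
  rw [← Real.div_rpow hpos.le hy.le, Real.log_rpow (by positivity), ← logSlope_eq hy] at h3
  refine h3.congr' ?_
  filter_upwards [eventually_gt_atTop 0] with b hb
  have hD : 0 < C * b ^ α := mul_pos hC (Real.rpow_pos_of_pos hb _)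
  simp only [Pi.div_apply]
  rw [norm_div, norm_div, div_div_div_cancel_right₀ (by simpa using hD.ne'), angleIntegrand]
  congr 3
  · congr 1
    push_cast
    ring
  · push_cast
    rfl

theorem tendsto_Theta_of_regularlyVarying (hf : IsBernstein f)
    (h : IsHolomorphicExtension f F) {C α : ℝ} (hC : 0 < C)
    (hreg : Tendsto (fun u : ℝ => f u / (C * u ^ α)) atTop (𝓝 1)) :
    Tendsto (fun b : ℝ => Theta F 0 b) atTop (𝓝 (Real.pi / 2 * α)) := by
  have h1 := tendsto_integral_filter_of_dominated_convergence (l := atTop)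
    (μ := volume.restrict (Ioi (0 : ℝ))) (F := fun b : ℝ => angleIntegrand F b)
    (f := fun y => α * logSlope y) logSlope ?_ ?_ integrableOn_logSlope_and_integral.1 ?_
  · rw [integral_const_mul, integrableOn_logSlope_and_integral.2, mul_comm] at h1
    simpa [Theta] using h1
  · filter_upwards [eventually_gt_atTop 0] with b hb
    exact (hf.angleIntegrand_continuousOn h hb).aestronglyMeasurable measurableSet_Ioi
  · filter_upwards [eventually_gt_atTop 0] with b hb
    filter_upwards [ae_restrict_mem measurableSet_Ioi] with y hy
    rw [Real.norm_of_nonneg (hf.angleIntegrand_nonneg h hb hy)]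
    exact hf.angleIntegrand_le h hb hy
  · filter_upwards [ae_restrict_mem measurableSet_Ioi] with y hy
    exact hf.tendsto_angleIntegrand_of_regularlyVarying h hC hreg hy

end IsBernstein

/-- `ThetaInf` from a limit along `b → ∞`. -/
theorem ThetaInf_eq_of_tendsto {F : ℂ → ℂ} {L : ℝ}
    (h : Tendsto (fun b : ℝ => Theta F 0 b) atTop (𝓝 L)) : ThetaInf F = L :=
  (h.comp (tendsto_norm_cocompact_atTop (E := ℝ))).liminf_eq

theorem ThetaInf_mem_Icc {f : ℝ → ℝ} {F : ℂ → ℂ} (hf : IsBernstein f)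
    (h : IsHolomorphicExtension f F) : 0 ≤ ThetaInf F ∧ ThetaInf F ≤ Real.pi / 2 := by
  have h0 : ∀ b : ℝ, 0 ≤ Theta F 0 |b| := fun b => hf.Theta_nonneg h le_rfl (abs_nonneg b)
  have h1 : ∀ b : ℝ, Theta F 0 |b| ≤ Real.pi / 2 := fun b =>
    hf.Theta_le h le_rfl (abs_nonneg b)
  constructor
  · exact le_liminf_of_le (isBoundedUnder_of ⟨_, h1⟩).isCoboundedUnder_ge (Eventually.of_forall h0)
  · exact liminf_le_of_frequently_le (Frequently.of_forall h1) (isBoundedUnder_of ⟨_, h0⟩)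

/-! ### Elementary kernel estimates -/

theorem norm_one_sub_exp_neg_le_two {z : ℂ} (hz : 0 ≤ z.re) : ‖1 - Complex.exp (-z)‖ ≤ 2 := by
  have h1 : ‖Complex.exp (-z)‖ ≤ 1 := by
    rw [Complex.norm_exp, Real.exp_le_one_iff]
    simpa using hz
  calc _ ≤ ‖(1 : ℂ)‖ + ‖Complex.exp (-z)‖ := norm_sub_le _ _
    _ ≤ 1 + 1 := by
      rw [norm_one]
      linarith
    _ = 2 := by norm_num

theorem norm_one_sub_exp_neg_le_norm {z : ℂ} (hz : 0 ≤ z.re) : ‖1 - Complex.exp (-z)‖ ≤ ‖z‖ := by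
  have h1 := (convex_halfSpace_re_ge 0).norm_image_sub_le_of_norm_hasDerivWithin_le
    (f := fun w : ℂ => Complex.exp (-w)) (f' := fun w => -Complex.exp (-w)) (C := 1)
    (x := (0 : ℂ)) (y := z)
    (fun w _ => by
      have := ((hasDerivAt_id w).neg).cexp
      simpa using this.hasDerivWithinAt)
    (fun w hw => by
      have hw' : 0 ≤ w.re := hw
      rw [norm_neg, Complex.norm_exp, Real.exp_le_one_iff]
      simpa using hw') (by simp) hz
  rw [norm_sub_rev]
  simpa using h1

theorem norm_one_sub_exp_le_min {z : ℂ} (hz : 0 ≤ z.re) {t : ℝ} (ht : 0 < t) :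
    ‖1 - Complex.exp (-z * t)‖ ≤ max 2 ‖z‖ * min 1 t := by
  have h0 : 0 ≤ (z * t).re := by
    rw [Complex.re_mul_ofReal]
    positivity
  have h1 := norm_one_sub_exp_neg_le_two h0
  have h2 := norm_one_sub_exp_neg_le_norm h0
  rw [norm_mul, Complex.norm_real, Real.norm_of_nonneg ht.le] at h2
  rw [neg_mul]
  rcases min_choice 1 t with h | h
  · rw [h, mul_one]
    exact h1.trans (le_max_left _ _)
  · rw [h]
    exact h2.trans (mul_le_mul_of_nonneg_right (le_max_right _ _) ht.le)

/-- `min 1 t` is the weight against which the tail is integrable, so these are the majorants for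
differentiating `φ` under the integral. -/
theorem exists_pow_mul_exp_le (n : ℕ) {c : ℝ} (hc : 0 < c) :
    ∃ C : ℝ, 0 ≤ C ∧ ∀ t : ℝ, 0 < t → t ^ (n + 1) * Real.exp (-c * t) ≤ C * min 1 t := by
  have key : ∀ m : ℕ, ∀ t : ℝ, 0 < t → t ^ m * Real.exp (-c * t) ≤ m.factorial / c ^ m := by
    intro m t ht
    have h1 := Real.pow_div_factorial_le_exp (c * t) (by positivity) m
    rw [div_le_iff₀ (by positivity), mul_pow] at h1
    rw [neg_mul, Real.exp_neg, ← div_eq_mul_inv, div_le_div_iff₀ (Real.exp_pos _) (by positivity)]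
    linarith
  refine ⟨max ((n + 1).factorial / c ^ (n + 1)) (n.factorial / c ^ n), by positivity,
    fun t ht => ?_⟩
  rcases min_choice 1 t with h | h
  · rw [h, mul_one]
    exact (key (n + 1) t ht).trans (le_max_left _ _)
  · rw [h]
    calc t ^ (n + 1) * Real.exp (-c * t) = t ^ n * Real.exp (-c * t) * t := by ring
      _ ≤ _ := mul_le_mul_of_nonneg_right ((key n t ht).trans (le_max_right _ _)) ht.le

namespace Triplet

variable (T : Triplet)

/-! ### The Lévy measure and its tail -/

theorem ae_pos : ∀ᵐ y ∂T.Pi, 0 < y := by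
  rw [ae_iff]
  convert! T.concentrated using 2
  ext y
  simp

theorem integrable_min : Integrable (fun y : ℝ => min (y ^ 2) y) T.Pi := by
  refine ⟨by fun_prop, ?_⟩
  rw [hasFiniteIntegral_iff_ofReal]
  · exact T.integrability
  · filter_upwards [T.ae_pos] with y hy
    exact le_min (by positivity) hy.le

theorem integrable_of_norm_le {E : Type*} [NormedAddCommGroup E] {g : ℝ → E} {C : ℝ}
    (hg : AEStronglyMeasurable g T.Pi)
    (hC : ∀ y : ℝ, 0 < y → ‖g y‖ ≤ C * min (y ^ 2) y) : Integrable g T.Pi := by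
  refine Integrable.mono' (T.integrable_min.const_mul C) hg ?_
  filter_upwards [T.ae_pos] with y hy
  exact hC y hy

theorem Pi_Ici_lt_top {y : ℝ} (hy : 0 < y) : T.Pi (Ici y) < ⊤ := by
  have hm : 0 < min (y ^ 2) y := lt_min (by positivity) hy
  have h1 := mul_meas_ge_le_lintegral₀ (μ := T.Pi)
    (f := fun y : ℝ => ENNReal.ofReal (min (y ^ 2) y)) (by fun_prop)
    (ENNReal.ofReal (min (y ^ 2) y))
  have h2 : Ici y ⊆ {x : ℝ | ENNReal.ofReal (min (y ^ 2) y) ≤ ENNReal.ofReal (min (x ^ 2) x)} := by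
    intro x hx
    have hx' : y ≤ x := hx
    exact ENNReal.ofReal_le_ofReal (min_le_min (pow_le_pow_left₀ hy.le hx' 2) hx')
  have h3 := (mul_le_mul_right (measure_mono h2) _).trans h1
  have h4 := h3.trans_lt T.integrability
  by_contra h5
  rw [not_lt, top_le_iff] at h5
  rw [h5, ENNReal.mul_top (ENNReal.ofReal_pos.2 hm).ne'] at h4
  exact lt_irrefl _ h4

theorem iUnion_Ici_inv : Iic (0 : ℝ) ∪ ⋃ n : ℕ, Ici (1 / ((n : ℝ) + 1)) = univ := by
  ext y
  simp only [mem_union, mem_Iic, mem_iUnion, mem_Ici, mem_univ, iff_true]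
  rcases le_or_gt y 0 with hy | hy
  · exact Or.inl hy
  · obtain ⟨n, hn⟩ := exists_nat_one_div_lt hy
    exact Or.inr ⟨n, hn.le⟩

instance sigmaFinite_Pi : SigmaFinite T.Pi := by
  refine ⟨⟨⟨fun n : ℕ => Iic (0 : ℝ) ∪ Ici (1 / ((n : ℝ) + 1)), fun _ => trivial, fun n => ?_, ?_⟩⟩⟩
  · refine (measure_union_le _ _).trans_lt ?_
    rw [T.concentrated, zero_add]
    exact T.Pi_Ici_lt_top (by positivity)
  · rw [← union_iUnion, iUnion_Ici_inv]

theorem measurable_Pi_Ici : Measurable fun y : ℝ => T.Pi (Ici y) :=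
  Antitone.measurable fun _ _ h => measure_mono (Ici_subset_Ici.2 h)

theorem measurable_tail : Measurable T.tail := T.measurable_Pi_Ici.ennreal_toReal

theorem tail_nonneg (y : ℝ) : 0 ≤ T.tail y := ENNReal.toReal_nonneg

theorem ofReal_tail {y : ℝ} (hy : 0 < y) : ENNReal.ofReal (T.tail y) = T.Pi (Ici y) :=
  ENNReal.ofReal_toReal (T.Pi_Ici_lt_top hy).ne

/-- By the layer-cake formula the integral equals that of `∫_0^y min 1 t dt ≤ min (y ^ 2) y` against
`Π`. -/
theorem integrableOn_min_mul_tail :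
    IntegrableOn (fun t => min 1 t * T.tail t) (Ioi 0) := by
  refine ⟨((by fun_prop : Measurable fun t : ℝ => min 1 t).mul
    T.measurable_tail).aestronglyMeasurable, ?_⟩
  rw [hasFiniteIntegral_iff_ofReal]
  · have hi : ∀ t > (0 : ℝ), IntervalIntegrable (fun t : ℝ => min 1 t) volume 0 t := fun t _ =>
      Continuous.intervalIntegrable (by fun_prop) _ _
    have h1 := lintegral_comp_eq_lintegral_meas_le_mul T.Pi (f := id)
      (g := fun t : ℝ => min 1 t) (T.ae_pos.mono fun y hy => hy.le) aemeasurable_id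
      hi (by
        filter_upwards [ae_restrict_mem measurableSet_Ioi] with t ht
        exact le_min zero_le_one (mem_Ioi.1 ht).le)
    have h2 : ∫⁻ t in Ioi (0 : ℝ), ENNReal.ofReal (min 1 t * T.tail t) =
        ∫⁻ t in Ioi (0 : ℝ), T.Pi {a : ℝ | t ≤ id a} * ENNReal.ofReal (min 1 t) := by
      refine setLIntegral_congr_fun measurableSet_Ioi fun t ht => ?_
      have ht' : 0 < t := ht
      rw [ENNReal.ofReal_mul (le_min zero_le_one ht'.le), T.ofReal_tail ht', mul_comm]
      rfl
    rw [h2, ← h1]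
    refine lt_of_le_of_lt (lintegral_mono_ae ?_) T.integrability
    filter_upwards [T.ae_pos] with y hy
    refine ENNReal.ofReal_le_ofReal (le_min ?_ ?_)
    · calc ∫ t in (0 : ℝ)..y, min 1 t ≤ ∫ t in (0 : ℝ)..y, t :=
            intervalIntegral.integral_mono_on hy.le (hi y hy) (by simp) fun t _ => min_le_right _ _
        _ ≤ y ^ 2 := by
            rw [integral_id]
            nlinarith [sq_nonneg y]
    · calc ∫ t in (0 : ℝ)..y, min 1 t ≤ ∫ t in (0 : ℝ)..y, (1 : ℝ) :=
            intervalIntegral.integral_mono_on hy.le (hi y hy) (by simp) fun t _ => min_le_left _ _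
        _ = y := by simp
  · filter_upwards [ae_restrict_mem measurableSet_Ioi] with t ht
    exact mul_nonneg (le_min zero_le_one (mem_Ioi.1 ht).le) (T.tail_nonneg t)

theorem integrableOn_mul_tail {g : ℝ → ℂ} {C : ℝ} (hg : Measurable g)
    (hC : ∀ t : ℝ, 0 < t → ‖g t‖ ≤ C * min 1 t) :
    IntegrableOn (fun t => g t * T.tail t) (Ioi 0) := by
  refine Integrable.mono' (T.integrableOn_min_mul_tail.const_mul C)
    (hg.mul (Complex.measurable_ofReal.comp T.measurable_tail)).aestronglyMeasurable ?_
  filter_upwards [ae_restrict_mem measurableSet_Ioi] with t ht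
  rw [norm_mul, Complex.norm_real, Real.norm_of_nonneg (T.tail_nonneg t), ← mul_assoc]
  exact mul_le_mul_of_nonneg_right (hC t ht) (T.tail_nonneg t)

/-- Fubini for the tail. -/
theorem integral_mul_tail {g : ℝ → ℂ} {C : ℝ} (hg : Measurable g)
    (hC : ∀ t : ℝ, 0 < t → ‖g t‖ ≤ C * min 1 t) :
    ∫ t in Ioi (0 : ℝ), g t * T.tail t = ∫ y, (∫ t in (0 : ℝ)..y, g t) ∂T.Pi := by
  set G : ℝ → ℝ → ℂ := fun y t => (Iic y).indicator g t with hG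
  have hGm : Measurable (Function.uncurry G) := by
    have : Function.uncurry G = {p : ℝ × ℝ | p.2 ≤ p.1}.indicator fun p => g p.2 := by
      ext p
      rfl
    rw [this]
    exact (hg.comp measurable_snd).indicator (measurableSet_le measurable_snd measurable_fst)
  have hGt : ∀ t : ℝ, (fun y => G y t) = (Ici t).indicator fun _ => g t := by
    intro t
    ext y
    simp only [hG, indicator, mem_Iic, mem_Ici]
  have hGi : ∀ t : ℝ, 0 < t → ∫ y, G y t ∂T.Pi = g t * T.tail t := by
    intro t _
    rw [hGt, integral_indicator measurableSet_Ici, setIntegral_const, tail, Measure.real,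
      Complex.real_smul, mul_comm]
  have hint : Integrable (Function.uncurry G) (T.Pi.prod (volume.restrict (Ioi 0))) := by
    rw [integrable_prod_iff' hGm.aestronglyMeasurable]
    constructor
    · filter_upwards [ae_restrict_mem measurableSet_Ioi] with t ht
      change Integrable (fun y => G y t) T.Pi
      rw [hGt, integrable_indicator_iff measurableSet_Ici]
      exact integrableOn_const (T.Pi_Ici_lt_top ht).ne
    · refine (T.integrableOn_mul_tail hg hC).norm.congr ?_
      filter_upwards [ae_restrict_mem measurableSet_Ioi] with t ht
      change _ = ∫ y, ‖G y t‖ ∂T.Pi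
      have : (fun y => ‖G y t‖) = (Ici t).indicator fun _ => ‖g t‖ := by
        ext y
        rw [← norm_indicator_eq_indicator_norm, ← congrFun (hGt t) y]
      rw [this, integral_indicator measurableSet_Ici, setIntegral_const, norm_mul,
        Complex.norm_real, Real.norm_of_nonneg (T.tail_nonneg t), tail, Measure.real,
        smul_eq_mul, mul_comm]
  have h1 := integral_integral_swap hint
  rw [setIntegral_congr_fun measurableSet_Ioi fun t ht => (hGi t ht).symm, ← h1]
  refine integral_congr_ae ?_
  filter_upwards [T.ae_pos] with y hy
  rw [intervalIntegral.integral_of_le hy.le, hG]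
  simp only
  rw [integral_indicator measurableSet_Iic, Measure.restrict_restrict measurableSet_Iic,
    inter_comm, Ioi_inter_Iic]

theorem intervalIntegral_one_sub_exp {z : ℂ} (hz : z ≠ 0) (y : ℝ) :
    ∫ t in (0 : ℝ)..y, (1 - Complex.exp (-z * t)) = y - (1 - Complex.exp (-z * y)) / z := by
  rw [intervalIntegral.integral_sub (by simp) (Continuous.intervalIntegrable (by fun_prop) _ _),
    integral_exp_mul_complex (neg_ne_zero.2 hz)]
  simp only [intervalIntegral.integral_const, Complex.real_smul, Complex.ofReal_zero, mul_zero,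
    Complex.exp_zero]
  field_simp
  simp
  ring

/-- `ψ(z) = z φ(z)`. -/
theorem psi_eq {z : ℂ} (hz : 0 ≤ z.re) : T.psi z = z * T.phi z := by
  rcases eq_or_ne z 0 with rfl | hz0
  · simp [psi]
  · rw [psi, phi, T.integral_mul_tail (C := max 2 ‖z‖) (by fun_prop)
      fun t ht => norm_one_sub_exp_le_min hz ht]
    simp only [intervalIntegral_one_sub_exp hz0]
    rw [mul_add, mul_add, ← integral_const_mul]
    have : ∀ y : ℝ, z * (y - (1 - Complex.exp (-z * y)) / z) =
        Complex.exp (-z * y) - 1 + z * y := by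
      intro y
      field_simp
      ring
    simp only [this]
    ring

end Triplet

theorem IsHolomorphicExtension.contDiffOn {f : ℝ → ℝ} {F : ℂ → ℂ}
    (h : IsHolomorphicExtension f F) : ContDiffOn ℝ (⊤ : ℕ∞) f (Ioi 0) := by
  have h1 : ContDiffOn ℝ (⊤ : ℕ∞) F {z : ℂ | 0 < z.re} :=
    (h.holomorphic.contDiffOn isOpen_rightHalfPlane).restrict_scalars ℝ
  have h2 : ContDiffOn ℝ (⊤ : ℕ∞) (fun u : ℝ => F u) (Ioi 0) :=
    h1.comp Complex.ofRealCLM.contDiff.contDiffOn fun u hu => by simpa using hu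
  refine (Complex.reCLM.contDiff.comp_contDiffOn h2).congr fun u hu => ?_
  exact (h.re_eq hu).symm

namespace Triplet

variable (T : Triplet)

/-! ### `φ` is a Bernstein function -/

/-- `∫ tⁿ e^{-zt} Π̄(t) dt`. -/
noncomputable def tailMoment (n : ℕ) (z : ℂ) : ℂ :=
  ∫ t in Ioi (0 : ℝ), ((t : ℂ) ^ n * Complex.exp (-z * t)) * T.tail t

theorem norm_pow_mul_exp_le {n : ℕ} {c : ℝ} {z : ℂ} (hz : c ≤ z.re) {t : ℝ} (ht : 0 < t) :
    ‖(t : ℂ) ^ n * Complex.exp (-z * t)‖ ≤ t ^ n * Real.exp (-c * t) := by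
  rw [norm_mul, norm_pow, Complex.norm_real, Real.norm_of_nonneg ht.le, Complex.norm_exp,
    Complex.re_mul_ofReal, Complex.neg_re]
  gcongr

/-- Shared by `φ` and all tail moments. Only the modulus of `G'` is prescribed, so one statement
covers both signs; the majorant is uniform on `Re w > z.re / 2`. -/
theorem hasDerivAt_integral_mul_tail {G G' : ℂ → ℝ → ℂ} {z : ℂ} {n : ℕ} {C : ℝ} (hz : 0 < z.re)
    (hG : ∀ w, Measurable (G w)) (hG' : Measurable (G' z))
    (hC : ∀ t : ℝ, 0 < t → ‖G z t‖ ≤ C * min 1 t)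
    (hb : ∀ w : ℂ, ∀ t : ℝ, 0 < t → ‖G' w t‖ = ‖(t : ℂ) ^ (n + 1) * Complex.exp (-w * t)‖)
    (hd : ∀ t : ℝ, 0 < t → ∀ w, HasDerivAt (G · t) (G' w t) w) :
    HasDerivAt (fun w => ∫ t in Ioi (0 : ℝ), G w t * T.tail t)
      (∫ t in Ioi (0 : ℝ), G' z t * T.tail t) z := by
  obtain ⟨K, _, hK⟩ := exists_pow_mul_exp_le n (half_pos hz)
  have hs : {w : ℂ | z.re / 2 < w.re} ∈ 𝓝 z :=
    (isOpen_lt continuous_const Complex.continuous_re).mem_nhds (half_lt_self hz)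
  have hm : Measurable fun t => (T.tail t : ℂ) := Complex.measurable_ofReal.comp T.measurable_tail
  refine (hasDerivAt_integral_of_dominated_loc_of_deriv_le (μ := volume.restrict (Ioi (0 : ℝ)))
    (F := fun w t => G w t * T.tail t) (F' := fun w t => G' w t * T.tail t)
    (bound := fun t => K * (min 1 t * T.tail t)) hs
    (Eventually.of_forall fun w => ((hG w).mul hm).aestronglyMeasurable)
    (T.integrableOn_mul_tail (hG z) hC) (hG'.mul hm).aestronglyMeasurable ?_
    (T.integrableOn_min_mul_tail.const_mul K) ?_).2
  · filter_upwards [ae_restrict_mem measurableSet_Ioi] with t ht w hw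
    have hw' : z.re / 2 < w.re := hw
    rw [norm_mul, Complex.norm_real, Real.norm_of_nonneg (T.tail_nonneg t), ← mul_assoc, hb w t ht]
    exact mul_le_mul_of_nonneg_right ((norm_pow_mul_exp_le hw'.le ht).trans (hK t ht))
      (T.tail_nonneg t)
  · filter_upwards [ae_restrict_mem measurableSet_Ioi] with t ht w _
    exact (hd t ht w).mul_const _

theorem hasDerivAt_exp_neg_mul (t : ℝ) (w : ℂ) :
    HasDerivAt (fun w : ℂ => Complex.exp (-w * t)) (-(t * Complex.exp (-w * t))) w := by
  have := (((hasDerivAt_id w).neg).mul_const (t : ℂ)).cexp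
  convert! this using 1
  simp only [Pi.neg_apply, id]
  ring

theorem hasDerivAt_phi {z : ℂ} (hz : 0 < z.re) :
    HasDerivAt T.phi ((T.sigma : ℂ) ^ 2 + T.tailMoment 1 z) z := by
  have h1 := T.hasDerivAt_integral_mul_tail (n := 0) (C := max 2 ‖z‖) hz
    (G := fun w t => 1 - Complex.exp (-w * t))
    (G' := fun w t => (t : ℂ) ^ 1 * Complex.exp (-w * t)) (fun w => by fun_prop) (by fun_prop)
    (fun t ht => norm_one_sub_exp_le_min hz.le ht) (fun w t _ => rfl) (fun t _ w => by
      have := (hasDerivAt_exp_neg_mul t w).const_sub 1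
      rw [neg_neg] at this
      rwa [pow_one])
  have h2 := (((hasDerivAt_id z).const_mul ((T.sigma : ℂ) ^ 2)).const_add (T.m : ℂ)).add h1
  rw [mul_one] at h2
  exact h2

theorem hasDerivAt_tailMoment (n : ℕ) {z : ℂ} (hz : 0 < z.re) :
    HasDerivAt (T.tailMoment (n + 1)) (-T.tailMoment (n + 2) z) z := by
  obtain ⟨K, _, hK⟩ := exists_pow_mul_exp_le n hz
  have h1 := T.hasDerivAt_integral_mul_tail (n := n + 1) (C := K) hz
    (G := fun w t => (t : ℂ) ^ (n + 1) * Complex.exp (-w * t))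
    (G' := fun w t => -((t : ℂ) ^ (n + 2) * Complex.exp (-w * t))) (fun w => by fun_prop)
    (by fun_prop) (fun t ht => (norm_pow_mul_exp_le le_rfl ht).trans (hK t ht))
    (fun w t _ => norm_neg _) (fun t _ w => by
      have := (hasDerivAt_exp_neg_mul t w).const_mul ((t : ℂ) ^ (n + 1))
      convert! this using 1
      ring)
  simp only [neg_mul _ (T.tail _ : ℂ), integral_neg] at h1
  exact h1

theorem iteratedDeriv_succ_phi (n : ℕ) {z : ℂ} (hz : 0 < z.re) :
    iteratedDeriv (n + 1) T.phi z =
      (if n = 0 then (T.sigma : ℂ) ^ 2 else 0) + (-1) ^ n * T.tailMoment (n + 1) z := by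
  induction n generalizing z with
  | zero =>
    rw [iteratedDeriv_one, (T.hasDerivAt_phi hz).deriv]
    simp
  | succ n ih =>
    rw [iteratedDeriv_succ]
    have h1 : iteratedDeriv (n + 1) T.phi =ᶠ[𝓝 z] fun w =>
        (if n = 0 then (T.sigma : ℂ) ^ 2 else 0) + (-1) ^ n * T.tailMoment (n + 1) w := by
      filter_upwards [isOpen_rightHalfPlane.mem_nhds hz] with w hw
      exact ih hw
    rw [h1.deriv_eq, (((T.hasDerivAt_tailMoment n hz).const_mul ((-1) ^ n)).const_add _).deriv]
    rw [if_neg n.succ_ne_zero, pow_succ]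
    ring

theorem phi_ofReal (x : ℝ) : T.phi x = ((T.m + T.sigma ^ 2 * x +
    ∫ t in Ioi (0 : ℝ), (1 - Real.exp (-x * t)) * T.tail t : ℝ) : ℂ) := by
  rw [phi]
  push_cast
  congr 1
  rw [← integral_complex_ofReal]
  push_cast
  rfl

theorem re_phi_ofReal (x : ℝ) : (T.phi x).re = T.m + T.sigma ^ 2 * x +
    ∫ t in Ioi (0 : ℝ), (1 - Real.exp (-x * t)) * T.tail t := by
  rw [phi_ofReal, Complex.ofReal_re]

theorem phi_eq_re (x : ℝ) : T.phi x = ((T.phi x).re : ℂ) := by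
  rw [re_phi_ofReal, phi_ofReal]

theorem phi_isHolomorphicExtension :
    IsHolomorphicExtension (fun u : ℝ => (T.phi u).re) T.phi :=
  ⟨fun _ hz => (T.hasDerivAt_phi hz).differentiableAt.differentiableWithinAt,
    fun u _ => T.phi_eq_re u⟩

theorem tailMoment_ofReal_re_nonneg (n : ℕ) (u : ℝ) : 0 ≤ (T.tailMoment n u).re := by
  have h1 : T.tailMoment n u =
      ((∫ t in Ioi (0 : ℝ), (t ^ n * Real.exp (-u * t)) * T.tail t : ℝ) : ℂ) := by
    rw [tailMoment, ← integral_complex_ofReal]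
    push_cast
    rfl
  rw [h1, Complex.ofReal_re]
  refine setIntegral_nonneg measurableSet_Ioi fun t ht => ?_
  have ht' : 0 < t := ht
  have := T.tail_nonneg t
  positivity

theorem kernel_nonneg (v : ℝ) : 0 ≤ Real.exp (-v) - 1 + v := by
  have := Real.add_one_le_exp (-v)
  linarith

theorem norm_kernel_le {z : ℂ} (hz : 0 ≤ z.re) {y : ℝ} (hy : 0 < y) :
    ‖Complex.exp (-z * y) - 1 + z * y‖ ≤ (‖z‖ * max 2 ‖z‖) * min (y ^ 2) y := by
  rcases eq_or_ne z 0 with rfl | hz0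
  · simp
  have h1 : Complex.exp (-z * y) - 1 + z * y = z * ∫ t in (0 : ℝ)..y, (1 - Complex.exp (-z * t)) := by
    rw [intervalIntegral_one_sub_exp hz0]
    field_simp
    ring
  have h2 : ∀ t ∈ uIoc 0 y, ‖1 - Complex.exp (-z * t)‖ ≤ max 2 ‖z‖ * min 1 y := by
    intro t ht
    rw [uIoc_of_le hy.le] at ht
    refine (norm_one_sub_exp_le_min hz ht.1).trans ?_
    gcongr
    exact ht.2
  have h3 := intervalIntegral.norm_integral_le_of_norm_le_const h2
  rw [sub_zero, abs_of_pos hy] at h3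
  have h4 : min 1 y * y = min (y ^ 2) y := by
    rw [min_mul_of_nonneg _ _ hy.le, one_mul, min_comm, sq]
  rw [h1, norm_mul, mul_assoc, ← h4, ← mul_assoc]
  rw [mul_assoc]
  exact mul_le_mul_of_nonneg_left (by rw [← mul_assoc]; exact h3) (norm_nonneg _)

theorem integrable_kernel {z : ℂ} (hz : 0 ≤ z.re) :
    Integrable (fun y : ℝ => Complex.exp (-z * y) - 1 + z * y) T.Pi :=
  T.integrable_of_norm_le (by fun_prop) fun _ hy => norm_kernel_le hz hy

theorem psi_ofReal (x : ℝ) : T.psi x = ((T.sigma ^ 2 * x ^ 2 + T.m * x +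
    ∫ y, (Real.exp (-(x * y)) - 1 + x * y) ∂T.Pi : ℝ) : ℂ) := by
  rw [psi]
  push_cast
  congr 1
  rw [← integral_complex_ofReal]
  push_cast
  simp only [neg_mul]

theorem integrable_kernel_real {x : ℝ} (hx : 0 ≤ x) :
    Integrable (fun y : ℝ => Real.exp (-(x * y)) - 1 + x * y) T.Pi := by
  refine T.integrable_of_norm_le (C := ‖(x : ℂ)‖ * max 2 ‖(x : ℂ)‖) (by fun_prop) fun y hy => ?_
  have h1 := norm_kernel_le (z := x) (by simpa using hx) hy
  have h2 : Complex.exp (-(x : ℂ) * y) - 1 + x * y =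
      ((Real.exp (-(x * y)) - 1 + x * y : ℝ) : ℂ) := by
    push_cast
    rw [neg_mul]
  rwa [h2, Complex.norm_real] at h1

variable {T}

/-- `φ(1) = ψ(1)`, and the kernel of `ψ` is strictly positive on `(0, ∞)`, where `Π` has all its
mass. -/
theorem Nondegenerate.re_phi_pos (hT : T.Nondegenerate) : 0 < (T.phi (1 : ℝ)).re := by
  have h1 := T.psi_eq (z := ((1 : ℝ) : ℂ)) (by simp)
  rw [Complex.ofReal_one, one_mul, ← Complex.ofReal_one, psi_ofReal] at h1
  rw [← h1, Complex.ofReal_re]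
  have h2 := T.integrable_kernel_real zero_le_one
  have h0 : 0 ≤ T.m := T.m_nonneg
  have h3 : 0 ≤ ∫ y, (Real.exp (-(1 * y)) - 1 + 1 * y) ∂T.Pi :=
    integral_nonneg fun y => kernel_nonneg _
  rcases hT with h | h
  · have : 0 < T.sigma ^ 2 := by positivity
    linarith
  · have h4 : 0 < ∫ y, (Real.exp (-(1 * y)) - 1 + 1 * y) ∂T.Pi := by
      rw [integral_pos_iff_support_of_nonneg (fun y => kernel_nonneg _) h2]
      have h5 : Ioi (0 : ℝ) ⊆ Function.support fun y : ℝ => Real.exp (-(1 * y)) - 1 + 1 * y := by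
        intro y hy
        have hy' : 0 < y := hy
        have := Real.add_one_lt_exp (x := -(1 * y)) (by simpa using hy'.ne')
        exact (by linarith : 0 < Real.exp (-(1 * y)) - 1 + 1 * y).ne'
      refine lt_of_lt_of_le ?_ (measure_mono h5)
      rw [pos_iff_ne_zero]
      intro h6
      apply h
      rw [← Measure.measure_univ_eq_zero, ← Iic_union_Ioi (a := (0 : ℝ))]
      exact measure_union_null T.concentrated h6
    have : 0 ≤ T.sigma ^ 2 := sq_nonneg _
    linarith

theorem Nondegenerate.isBernstein (hT : T.Nondegenerate) :
    IsBernstein (fun u : ℝ => (T.phi u).re) := by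
  have h := T.phi_isHolomorphicExtension
  refine ⟨h.contDiffOn, ⟨1, one_pos, hT.re_phi_pos.ne'⟩, fun u hu => ?_, ⟨h.deriv.contDiffOn, ?_⟩⟩
  · rw [re_phi_ofReal]
    have h1 : 0 ≤ ∫ t in Ioi (0 : ℝ), (1 - Real.exp (-u * t)) * T.tail t := by
      refine setIntegral_nonneg measurableSet_Ioi fun t ht => mul_nonneg ?_ (T.tail_nonneg t)
      have ht' : 0 < t := ht
      rw [sub_nonneg, Real.exp_le_one_iff, neg_mul]
      exact neg_nonpos.2 (by positivity)
    have := T.m_nonneg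
    positivity
  · intro n u hu
    have h1 := (h.iteratedDeriv (n + 1)).re_eq hu
    rw [← iteratedDeriv_succ', ← h1, T.iteratedDeriv_succ_phi n (by simpa using hu)]
    have h2 := T.tailMoment_ofReal_re_nonneg (n + 1) u
    have h3 : ((-1 : ℂ) ^ n * T.tailMoment (n + 1) u).re =
        (-1) ^ n * (T.tailMoment (n + 1) u).re := by
      rw [show (-1 : ℂ) ^ n = (((-1) ^ n : ℝ) : ℂ) by push_cast; rfl, Complex.re_ofReal_mul]
    rw [Complex.add_re, h3, mul_add, ← mul_assoc, ← mul_pow]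
    simp only [mul_neg, mul_one, neg_neg, one_pow, one_mul]
    refine add_nonneg ?_ h2
    split_ifs with h4
    · rw [h4, ← Complex.ofReal_pow, Complex.ofReal_re]
      positivity
    · simp

/-! ### The half-plane `Re z > d_φ` -/

/-- The set defining `dphi` is bounded above by `0`, so no point beyond its supremum belongs to it.
If the set is empty, `sSup` takes the value `0` and the two hypotheses on `a` exclude each other. -/
theorem integrableOn_of_dphi_lt {a : ℝ} (ha : T.dphi < a) (ha0 : a ≤ 0) :
    IntegrableOn (fun y : ℝ => (1 - Real.exp (-a * y)) * T.tail y) (Ioi 0) ∧ T.phi a ≠ 0 := by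
  have hbdd : BddAbove {u : ℝ | u ≤ 0 ∧
    (¬ IntegrableOn (fun y : ℝ => (1 - Real.exp (-u * y)) * T.tail y) (Ioi 0) ∨
      T.phi (u : ℂ) = 0)} := ⟨0, fun u hu => hu.1⟩
  constructor
  · by_contra h
    exact absurd (le_csSup hbdd ⟨ha0, Or.inl h⟩) (not_le.2 ha)
  · intro h
    exact absurd (le_csSup hbdd ⟨ha0, Or.inr h⟩) (not_le.2 ha)

theorem abs_one_sub_exp_le {a x t : ℝ} (hax : a ≤ x) (hx : x ≤ 0) (ht : 0 < t) :
    |1 - Real.exp (-x * t)| ≤ -(1 - Real.exp (-a * t)) := by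
  have h1 : 1 ≤ Real.exp (-x * t) := by
    rw [← Real.exp_zero, Real.exp_le_exp]
    nlinarith
  have h2 : Real.exp (-x * t) ≤ Real.exp (-a * t) := by
    rw [Real.exp_le_exp]
    nlinarith
  rw [abs_of_nonpos (by linarith)]
  linarith

/-- `φ` is continuous on `[a, 0]`, is `m ≥ 0` at the right end and has no zero on this interval, so
the intermediate value theorem excludes `φ(a) ≤ 0`. -/
theorem re_phi_pos_of_nonpos {a : ℝ} (ha : T.dphi < a) (ha0 : a ≤ 0) : 0 < (T.phi a).re := by
  by_contra hneg
  rw [not_lt] at hneg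
  have hcont : ContinuousOn (fun x : ℝ => (T.phi x).re) (Icc a 0) := by
    simp only [re_phi_ofReal]
    refine ContinuousOn.add (by fun_prop) ?_
    refine continuousOn_of_dominated
      (bound := fun t => -((1 - Real.exp (-a * t)) * T.tail t))
      (fun x _ => ((by fun_prop : Measurable fun t : ℝ => 1 - Real.exp (-x * t)).mul
        T.measurable_tail).aestronglyMeasurable) (fun x hx => ?_)
      (integrableOn_of_dphi_lt ha ha0).1.neg ?_
    · filter_upwards [ae_restrict_mem measurableSet_Ioi] with t ht
      rw [norm_mul, Real.norm_eq_abs, Real.norm_of_nonneg (T.tail_nonneg t), ← neg_mul]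
      exact mul_le_mul_of_nonneg_right (abs_one_sub_exp_le hx.1 hx.2 ht) (T.tail_nonneg t)
    · exact Eventually.of_forall fun t => by fun_prop
  have h0 : 0 ≤ (T.phi (0 : ℝ)).re := by
    rw [re_phi_ofReal]
    simpa using T.m_nonneg
  obtain ⟨x, hx, hx'⟩ := intermediate_value_Icc ha0 hcont ⟨hneg, h0⟩
  refine (integrableOn_of_dphi_lt (ha.trans_le hx.1) hx.2).2 ?_
  rw [phi_eq_re]
  simpa using hx'

/-- The inequality `cos ≤ 1` again, now under the integral. Integrability at `a + ib` follows by
splitting the kernel into its value at `ib` and a unimodular multiple of its value at `a`. -/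
theorem re_phi_le_of_nonpos {a : ℝ} (ha : T.dphi < a) (ha0 : a ≤ 0) (b : ℝ) :
    (T.phi a).re ≤ (T.phi (a + b * Complex.I)).re := by
  have hm : Measurable fun t => (T.tail t : ℂ) := Complex.measurable_ofReal.comp T.measurable_tail
  have hi := (integrableOn_of_dphi_lt ha ha0).1
  have hint : IntegrableOn
      (fun t : ℝ => (1 - Complex.exp (-((a : ℂ) + b * Complex.I) * t)) * (T.tail t : ℂ))
      (Ioi 0) := by
    refine Integrable.mono' ((T.integrableOn_min_mul_tail.const_mul (max 2 ‖b * Complex.I‖)).add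
      hi.neg) ((by fun_prop : Measurable fun t : ℝ =>
        1 - Complex.exp (-((a : ℂ) + b * Complex.I) * t)).mul hm).aestronglyMeasurable ?_
    filter_upwards [ae_restrict_mem measurableSet_Ioi] with t ht
    have ht' : 0 < t := ht
    have e1 : 1 - Complex.exp (-((a : ℂ) + b * Complex.I) * t) =
        (1 - Complex.exp (-(b * Complex.I) * t)) +
          Complex.exp (-(b * Complex.I) * t) * ((1 - Real.exp (-a * t) : ℝ) : ℂ) := by
      push_cast
      rw [show -((a : ℂ) + b * Complex.I) * t = -(b * Complex.I) * t + -a * t by ring,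
        Complex.exp_add]
      ring
    have e2 : ‖Complex.exp (-(b * Complex.I) * t)‖ = 1 := by
      rw [show -(b * Complex.I) * t = ((-b * t : ℝ) : ℂ) * Complex.I by push_cast; ring]
      exact Complex.norm_exp_ofReal_mul_I _
    have e3 : ‖1 - Complex.exp (-((a : ℂ) + b * Complex.I) * t)‖ ≤
        max 2 ‖b * Complex.I‖ * min 1 t + -(1 - Real.exp (-a * t)) := by
      rw [e1]
      refine (norm_add_le _ _).trans (add_le_add ?_ ?_)
      · exact norm_one_sub_exp_le_min (by simp) ht'
      · rw [norm_mul, e2, one_mul, Complex.norm_real]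
        exact abs_one_sub_exp_le le_rfl ha0 ht'
    rw [norm_mul, Complex.norm_real, Real.norm_of_nonneg (T.tail_nonneg t)]
    refine (mul_le_mul_of_nonneg_right e3 (T.tail_nonneg t)).trans (le_of_eq ?_)
    simp only [Pi.add_apply, Pi.neg_apply]
    ring
  rw [re_phi_ofReal, phi]
  simp only [Complex.add_re, Complex.ofReal_re]
  refine add_le_add ?_ ?_
  · rw [← Complex.ofReal_pow, Complex.re_ofReal_mul, IsBernstein.re_add_mul_I]
  · have h1 := integral_re hint
    simp only [RCLike.re_eq_complex_re] at h1
    rw [← h1]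
    refine setIntegral_mono_on hi hint.re measurableSet_Ioi fun t ht => ?_
    rw [Complex.re_mul_ofReal]
    refine mul_le_mul_of_nonneg_right ?_ (T.tail_nonneg t)
    rw [Complex.sub_re, Complex.one_re, Complex.exp_re, Complex.re_mul_ofReal, Complex.neg_re,
      IsBernstein.re_add_mul_I]
    have := Real.cos_le_one (-((a : ℂ) + b * Complex.I) * t).im
    have := Real.exp_pos (-a * t)
    nlinarith

theorem Nondegenerate.re_phi_pos_of_dphi_lt (hT : T.Nondegenerate) {a : ℝ} (ha : T.dphi < a) :
    0 < (T.phi a).re := by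
  rcases le_or_gt a 0 with ha0 | ha0
  · exact re_phi_pos_of_nonpos ha ha0
  · exact hT.isBernstein.pos T.phi_isHolomorphicExtension ha0

theorem norm_phi_ofReal {a : ℝ} (ha : 0 ≤ (T.phi a).re) : ‖T.phi a‖ = (T.phi a).re := by
  rw [phi_eq_re, Complex.norm_real, Complex.ofReal_re, Real.norm_of_nonneg ha]

theorem Nondegenerate.norm_phi_le (hT : T.Nondegenerate) {a : ℝ} (ha : T.dphi < a) (b : ℝ) :
    ‖T.phi a‖ ≤ ‖T.phi (a + b * Complex.I)‖ := by
  rw [norm_phi_ofReal (hT.re_phi_pos_of_dphi_lt ha).le]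
  rcases le_or_gt a 0 with ha0 | ha0
  · exact (re_phi_le_of_nonpos ha ha0 b).trans (Complex.re_le_norm _)
  · simpa using hT.isBernstein.le_norm T.phi_isHolomorphicExtension (z := a + b * Complex.I)
      (by simpa using ha0)

/-- Factors of the product formula for `|W_φ|` may be dropped. -/
theorem Nondegenerate.norm_W_le (hT : T.Nondegenerate) {a : ℝ} (ha : T.dphi < a) (b : ℝ)
    (k₀ N : ℕ) :
    ‖W T.phi (a + b * Complex.I)‖ ≤
      ‖W T.phi a‖ * Real.exp (-∑ k ∈ Finset.Ico k₀ N, vert T.phi b (a + k)) := by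
  have hk : ∀ k : ℕ, T.dphi < a + k := fun k => ha.trans_le (by linarith [k.cast_nonneg (α := ℝ)])
  refine hT.isBernstein.norm_W_le T.phi_isHolomorphicExtension (fun k h0 => ?_)
    (fun k => hT.norm_phi_le (hk k) b) k₀ N
  have := hT.re_phi_pos_of_dphi_lt (hk k)
  rw [h0] at this
  simp at this

end Triplet

theorem log_add_one_sub_log_le {x : ℝ} (hx : 0 < x) : Real.log (x + 1) - Real.log x ≤ 1 / x := by
  have h1 : Real.log (x + 1) - Real.log x = Real.log (1 + 1 / x) := by
    rw [← Real.log_div (by positivity) hx.ne']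
    congr 1
    field_simp
  have h2 := Real.log_le_sub_one_of_pos (show 0 < 1 + 1 / x by positivity)
  rw [h1]
  linarith

theorem neg_two_mul_le_log_one_sub {t : ℝ} (h0 : 0 ≤ t) (h1 : t ≤ 1 / 2) :
    -(2 * t) ≤ Real.log (1 - t) := by
  have h2 := Real.one_sub_inv_le_log_of_pos (show 0 < 1 - t by linarith)
  refine le_trans ?_ h2
  have h3 : (1 - t)⁻¹ ≤ 1 + 2 * t := by
    rw [inv_le_iff_one_le_mul₀ (by linarith)]
    nlinarith
  linarith

namespace Triplet

variable {T : Triplet}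

/-! ### Decay of `W_φ` along vertical lines -/

theorem decaysOfOrder_of_bound {a u q B C : ℝ} (huq : u < q)
    (h : ∀ b : ℝ, B ≤ |b| → ‖W T.phi (a + b * Complex.I)‖ ≤ C * |b| ^ (-q)) :
    T.DecaysOfOrder a u := by
  have h1 : Tendsto (fun b : ℝ => C * |b| ^ (-(q - u))) (cocompact ℝ) (𝓝 (C * 0)) :=
    ((tendsto_rpow_neg_atTop (sub_pos.2 huq)).comp
      (tendsto_norm_cocompact_atTop (E := ℝ))).const_mul C
  rw [mul_zero] at h1
  have h2 := (tendsto_norm_cocompact_atTop (E := ℝ))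
  refine squeeze_zero' (Eventually.of_forall fun b => by positivity) ?_ h1
  filter_upwards [h2.eventually_ge_atTop B, h2.eventually_gt_atTop 0] with b hb hb0
  rw [Real.norm_eq_abs] at hb hb0
  calc |b| ^ u * ‖W T.phi (a + b * Complex.I)‖ ≤ |b| ^ u * (C * |b| ^ (-q)) := by
        gcongr
        exact h b hb
    _ = C * (|b| ^ u * |b| ^ (-q)) := by ring
    _ = _ := by
        rw [← Real.rpow_add hb0]
        congr 2
        ring

/-- Lower bounds for the factors of the product formula yield polynomial decay. -/
theorem Nondegenerate.decaysOfOrder_of_vert_ge (hT : T.Nondegenerate) {a u p s x₀ B D : ℝ}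
    {e : ℝ → ℝ} (ha : T.dphi < a) (hp : 0 ≤ p) (hs : 0 < s) (hups : u < p * s)
    (he : ∀ b, B ≤ b → 0 ≤ e b ∧ b ^ s * e b ≤ D)
    (hvert : ∀ b x : ℝ, B ≤ b → x₀ ≤ x → x ≤ b ^ s →
      p * (Real.log (x + 1) - Real.log x) - e b ≤ vert T.phi b x) :
    T.DecaysOfOrder a u := by
  obtain ⟨k₀, hk₀⟩ := exists_nat_gt (max x₀ 1 - a)
  have hk1 : 1 < a + k₀ := by linarith [le_max_right x₀ 1]
  have hk2 : x₀ < a + k₀ := by linarith [le_max_left x₀ 1]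
  have hlim := tendsto_rpow_atTop hs
  obtain ⟨B₁, hB₁⟩ := eventually_atTop.1
    ((hlim.eventually_ge_atTop (2 * |a| + k₀ + 2)).and
      ((eventually_ge_atTop B).and (eventually_gt_atTop 0)))
  refine decaysOfOrder_of_bound (q := p * s) (B := B₁)
    (C := ‖W T.phi a‖ * Real.exp (p * Real.log 2 + p * Real.log (a + k₀) + 2 * D)) hups fun b hb => ?_
  obtain ⟨h1, h2, h3⟩ := hB₁ |b| hb
  set S := |b| ^ s with hS
  have ha1 := neg_abs_le a
  have ha2 := le_abs_self a
  have hk0 : (0 : ℝ) ≤ k₀ := k₀.cast_nonneg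
  set N := ⌊S - a⌋₊ with hN
  have hN1 : (N : ℝ) ≤ S - a := Nat.floor_le (by linarith)
  have hN2 : S - a < N + 1 := Nat.lt_floor_add_one _
  have hkN : k₀ ≤ N := Nat.le_floor (by linarith)
  refine (hT.norm_W_le ha b k₀ N).trans ?_
  rw [mul_assoc]
  refine mul_le_mul_of_nonneg_left ?_ (norm_nonneg _)
  rw [Real.rpow_def_of_pos h3, ← Real.exp_add, Real.exp_le_exp]
  have hpos : ∀ k ∈ Finset.Ico k₀ N, x₀ ≤ a + k ∧ 0 < a + k ∧ a + k ≤ S := by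
    intro k hk
    rw [Finset.mem_Ico] at hk
    have h4 : (k₀ : ℝ) ≤ k := by exact_mod_cast hk.1
    have h5 : (k : ℝ) ≤ N := by exact_mod_cast hk.2.le
    exact ⟨by linarith, by linarith, by linarith⟩
  have hsum : ∑ k ∈ Finset.Ico k₀ N, (p * (Real.log (a + k + 1) - Real.log (a + k)) - e |b|) ≤
      ∑ k ∈ Finset.Ico k₀ N, vert T.phi b (a + k) := by
    refine Finset.sum_le_sum fun k hk => ?_
    obtain ⟨h4, h5, h6⟩ := hpos k hk
    rw [← hT.isBernstein.vert_abs T.phi_isHolomorphicExtension h5]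
    exact hvert _ _ h2 h4 h6
  -- Bounding below by differences of logarithms, instead of by `1/x`, makes the sum telescope to `p
  -- s ln |b|` up to a constant.
  have htel : ∑ k ∈ Finset.Ico k₀ N, (Real.log (a + k + 1) - Real.log (a + k)) =
      Real.log (a + N) - Real.log (a + k₀) := by
    have := Finset.sum_Ico_sub (fun k : ℕ => Real.log (a + k)) hkN
    rw [← this]
    refine Finset.sum_congr rfl fun k _ => ?_
    push_cast
    rw [add_assoc]
  rw [Finset.sum_sub_distrib, ← Finset.mul_sum, htel, Finset.sum_const, Nat.card_Ico,
    nsmul_eq_mul] at hsum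
  obtain ⟨he0, he1⟩ := he |b| h2
  have hcount : ((N - k₀ : ℕ) : ℝ) * e |b| ≤ 2 * D := by
    have h6 : ((N - k₀ : ℕ) : ℝ) ≤ 2 * S := by
      rw [Nat.cast_sub hkN]
      linarith
    calc ((N - k₀ : ℕ) : ℝ) * e |b| ≤ 2 * S * e |b| := mul_le_mul_of_nonneg_right h6 he0
      _ ≤ 2 * D := by linarith
  have hlog : s * Real.log |b| - Real.log 2 ≤ Real.log (a + N) := by
    rw [← Real.log_rpow h3, ← hS, ← Real.log_div (by linarith) (by norm_num)]
    exact Real.log_le_log (by linarith) (by linarith)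
  nlinarith [mul_le_mul_of_nonneg_left hlog hp]

/-! ### The case `𝒩_∞` -/

/-- `1 - e^{-v} - v e^{-v}`. -/
noncomputable def gammaKernel (v : ℝ) : ℝ := 1 - Real.exp (-v) - v * Real.exp (-v)

theorem gammaKernel_nonneg (v : ℝ) : 0 ≤ gammaKernel v := by
  have h1 := Real.add_one_le_exp v
  have h2 : Real.exp (-v) * Real.exp v = 1 := by rw [← Real.exp_add]; simp
  have h3 := Real.exp_pos (-v)
  rw [gammaKernel]
  nlinarith

theorem gammaKernel_le_one {v : ℝ} (hv : 0 ≤ v) : gammaKernel v ≤ 1 := by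
  have h3 := Real.exp_pos (-v)
  rw [gammaKernel]
  nlinarith

theorem gammaKernel_le {v : ℝ} (hv : 0 ≤ v) : gammaKernel v ≤ v := by
  have h1 := Real.add_one_le_exp (-v)
  have h3 := Real.exp_pos (-v)
  rw [gammaKernel]
  nlinarith

theorem gammaKernel_le_sq {v : ℝ} (hv : 0 ≤ v) : gammaKernel v ≤ v ^ 2 := by
  have h1 := Real.add_one_le_exp (-v)
  rw [gammaKernel]
  nlinarith

/-- After multiplication by `exp v` this is twice the inequality `1 + v + v² / 2 ≤ exp v`. -/
theorem kernel_le_mul_gammaKernel {v : ℝ} (hv : 0 ≤ v) :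
    Real.exp (-v) - 1 + v ≤ (1 + v) * gammaKernel v := by
  have h1 := Real.quadratic_le_exp_of_nonneg hv
  have h2 : Real.exp (-v) * Real.exp v = 1 := by rw [← Real.exp_add]; simp
  have h3 := Real.exp_pos (-v)
  rw [gammaKernel]
  nlinarith

/-- The constant is what the quadratic lower bound for `exp` gives at `v = 1`, where `1 + v = 2 =
(4/5) (5/2)`. -/
theorem le_gammaKernel {v : ℝ} (hv : 1 ≤ v) : 1 / 5 ≤ gammaKernel v := by
  have h1 := Real.quadratic_le_exp_of_nonneg (zero_le_one.trans hv)
  have h2 : Real.exp (-v) * Real.exp v = 1 := by rw [← Real.exp_add]; simp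
  have h3 := Real.exp_pos (-v)
  have h4 : (1 + v) ≤ 4 / 5 * Real.exp v := by nlinarith
  rw [gammaKernel]
  nlinarith

theorem mul_min_bound {x y : ℝ} (hx : 0 ≤ x) (hy : 0 < y) :
    min (x * y) ((x * y) ^ 2) ≤ (x + x ^ 2) * min (y ^ 2) y := by
  rcases min_choice (y ^ 2) y with h | h
  · rw [h]
    refine (min_le_right _ _).trans ?_
    nlinarith [sq_nonneg y, mul_nonneg hx (sq_nonneg y)]
  · rw [h]
    refine (min_le_left _ _).trans ?_
    nlinarith [mul_nonneg (sq_nonneg x) hy.le]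

variable (T) in
theorem integrable_gammaKernel {x : ℝ} (hx : 0 ≤ x) :
    Integrable (fun y : ℝ => gammaKernel (x * y)) T.Pi := by
  refine T.integrable_of_norm_le (C := x + x ^ 2)
    (by unfold gammaKernel; fun_prop) fun y hy => ?_
  have hxy : 0 ≤ x * y := by positivity
  rw [Real.norm_of_nonneg (gammaKernel_nonneg _)]
  exact (le_min (gammaKernel_le hxy) (gammaKernel_le_sq hxy)).trans (mul_min_bound hx hy)

variable (T) in
theorem integrable_mul_gammaKernel {x : ℝ} (hx : 0 ≤ x) :
    Integrable (fun y : ℝ => y * gammaKernel (x * y)) T.Pi := by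
  refine T.integrable_of_norm_le (C := 1 + x)
    (by unfold gammaKernel; fun_prop) fun y hy => ?_
  have hxy : 0 ≤ x * y := by positivity
  have h0 := gammaKernel_nonneg (x * y)
  have h1 := gammaKernel_le hxy
  have h2 := gammaKernel_le_one hxy
  rw [Real.norm_of_nonneg (by positivity)]
  rcases min_choice (y ^ 2) y with h | h
  · rw [h]
    nlinarith [sq_nonneg y]
  · rw [h]
    nlinarith [mul_nonneg hx hy.le]

variable (T) in
/-- `x² φ'(x)`. -/
noncomputable def energy (x : ℝ) : ℝ :=
  T.sigma ^ 2 * x ^ 2 + ∫ y, gammaKernel (x * y) ∂T.Pi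

variable (T) in
theorem mul_phi_eq {x : ℝ} (hx : 0 ≤ x) : x * (T.phi x).re = T.sigma ^ 2 * x ^ 2 + T.m * x +
    ∫ y, (Real.exp (-(x * y)) - 1 + x * y) ∂T.Pi := by
  have h1 := T.psi_eq (z := (x : ℂ)) (by simpa using hx)
  rw [psi_ofReal, phi_eq_re, ← Complex.ofReal_mul] at h1
  exact (Complex.ofReal_injective h1).symm

variable (T) in
-- The imaginary part of the kernel is `b y - exp (-x y) sin (b y)`. The inequality `sin (b y) ≤ b
-- y` leaves `b y (1 - exp (-x y))`, which is `b / x` times the sum of the kernels of `x φ(x)` and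
-- of `energy x`.
theorem le_im_psi {x b : ℝ} (hx : 0 < x) (hb : 0 < b) :
    b / x * (x * (T.phi x).re + T.energy x) ≤ (T.psi (x + b * Complex.I)).im := by
  have hz : 0 ≤ ((x : ℂ) + b * Complex.I).re := by simpa using hx.le
  have hi := T.integrable_kernel hz
  have h1 : (T.psi (x + b * Complex.I)).im = T.sigma ^ 2 * (2 * x * b) + T.m * b +
      ∫ y, (Complex.exp (-((x : ℂ) + b * Complex.I) * y) - 1 + (x + b * Complex.I) * y).im
        ∂T.Pi := by
    rw [psi, Complex.add_im, Complex.add_im]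
    have e1 : (((T.sigma : ℂ)) ^ 2 * ((x : ℂ) + b * Complex.I) ^ 2).im =
        T.sigma ^ 2 * (2 * x * b) := by
      rw [← Complex.ofReal_pow, Complex.im_ofReal_mul]
      congr 1
      simp [sq]
      ring
    have e2 : ((T.m : ℂ) * ((x : ℂ) + b * Complex.I)).im = T.m * b := by
      rw [Complex.im_ofReal_mul]
      simp
    have e3 := integral_im hi
    rw [e1, e2]
    exact congrArg _ e3.symm
  rw [h1, T.mul_phi_eq hx.le, energy]
  have h2 : b / x * (T.sigma ^ 2 * x ^ 2 + T.m * x +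
      ∫ y, (Real.exp (-(x * y)) - 1 + x * y) ∂T.Pi + (T.sigma ^ 2 * x ^ 2 +
      ∫ y, gammaKernel (x * y) ∂T.Pi)) = T.sigma ^ 2 * (2 * x * b) + T.m * b +
      b / x * ∫ y, ((Real.exp (-(x * y)) - 1 + x * y) + gammaKernel (x * y)) ∂T.Pi := by
    rw [integral_add (T.integrable_kernel_real hx.le) (T.integrable_gammaKernel hx.le)]
    field_simp
    ring
  rw [h2, ← integral_const_mul]
  refine add_le_add le_rfl (integral_mono_ae (((T.integrable_kernel_real hx.le).add
    (T.integrable_gammaKernel hx.le)).const_mul _) hi.im ?_)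
  filter_upwards [T.ae_pos] with y hy
  have e4 : (Complex.exp (-((x : ℂ) + b * Complex.I) * y) - 1 + (x + b * Complex.I) * y).im =
      b * y - Real.exp (-(x * y)) * Real.sin (b * y) := by
    simp [Complex.exp_im]
    ring
  refine le_trans ?_ e4.ge
  have e5 := Real.sin_le (show 0 ≤ b * y by positivity)
  have e6 := Real.exp_pos (-(x * y))
  have e7 : b / x * (Real.exp (-(x * y)) - 1 + x * y + gammaKernel (x * y)) =
      b * y - Real.exp (-(x * y)) * (b * y) := by
    rw [gammaKernel]
    field_simp
    ring
  rw [e7]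
  nlinarith

/-- Bound `|ψ(x + ib)|` below by its imaginary part and divide by `|x + ib| φ(x)`. The factor `b /
√(x² + b²)` costs at most `x² / (2 b²)` after taking logarithms. -/
theorem Nondegenerate.vert_ge (hT : T.Nondegenerate) {x b : ℝ} (hx : 0 < x) (hb : 0 < b) :
    Real.log (1 + T.energy x / (x * (T.phi x).re)) - x ^ 2 / (2 * b ^ 2) ≤ vert T.phi b x := by
  have hφ : 0 < (T.phi x).re := hT.isBernstein.pos T.phi_isHolomorphicExtension hx
  have hE : 0 ≤ T.energy x := by
    have : 0 ≤ ∫ y, gammaKernel (x * y) ∂T.Pi := integral_nonneg fun y => gammaKernel_nonneg _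
    rw [energy]
    positivity
  have h1 := (T.le_im_psi hx hb).trans ((le_abs_self _).trans (Complex.abs_im_le_norm _))
  rw [T.psi_eq (by simpa using hx.le), norm_mul] at h1
  have hz : ‖(x : ℂ) + b * Complex.I‖ = √(x ^ 2 + b ^ 2) := Complex.norm_add_mul_I x b
  have hs : 0 < √(x ^ 2 + b ^ 2) := Real.sqrt_pos.2 (by positivity)
  rw [hz] at h1
  have h2 : b / √(x ^ 2 + b ^ 2) * (1 + T.energy x / (x * (T.phi x).re)) ≤
      ‖T.phi (x + b * Complex.I)‖ / (T.phi x).re := by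
    rw [le_div_iff₀ hφ, div_mul_eq_mul_div, div_mul_eq_mul_div, div_le_iff₀ hs]
    calc _ = b / x * (x * (T.phi x).re + T.energy x) := by field_simp
      _ ≤ _ := h1.trans (le_of_eq (mul_comm _ _))
  rw [vert, norm_phi_ofReal hφ.le]
  have h3 := Real.log_le_log (by positivity) h2
  rw [Real.log_mul (by positivity) (by positivity)] at h3
  have h4 : -(x ^ 2 / (2 * b ^ 2)) ≤ Real.log (b / √(x ^ 2 + b ^ 2)) := by
    have e1 : √(x ^ 2 + b ^ 2) / b = √(1 + x ^ 2 / b ^ 2) := by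
      rw [show 1 + x ^ 2 / b ^ 2 = (x ^ 2 + b ^ 2) / b ^ 2 by field_simp; ring,
        Real.sqrt_div (by positivity), Real.sqrt_sq hb.le]
    rw [← inv_div (√(x ^ 2 + b ^ 2)) b, Real.log_inv, e1, Real.log_sqrt (by positivity), neg_le_neg_iff]
    have e2 := Real.log_le_sub_one_of_pos (show 0 < 1 + x ^ 2 / b ^ 2 by positivity)
    have e3 : x ^ 2 / (2 * b ^ 2) = x ^ 2 / b ^ 2 / 2 := by field_simp
    rw [e3]
    linarith
  linarith

/-- Jumps with `x y ≥ 1` contribute at least `1/5` each. -/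
theorem tail_le_energy {x : ℝ} (hx : 0 < x) : T.tail (1 / x) / 5 ≤ T.energy x := by
  have h1 : ∫ y, (Ici (1 / x)).indicator (fun _ => (1 / 5 : ℝ)) y ∂T.Pi ≤
      ∫ y, gammaKernel (x * y) ∂T.Pi := by
    refine integral_mono_ae ((integrable_indicator_iff measurableSet_Ici).2
      (integrableOn_const (T.Pi_Ici_lt_top (by positivity)).ne)) (T.integrable_gammaKernel hx.le) ?_
    refine Eventually.of_forall fun y => ?_
    refine indicator_le' (fun y hy => ?_) (fun y _ => gammaKernel_nonneg _) y
    have hy' : 1 / x ≤ y := hy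
    refine le_gammaKernel ?_
    rwa [div_le_iff₀' hx] at hy'
  rw [integral_indicator measurableSet_Ici, setIntegral_const, Measure.real, smul_eq_mul] at h1
  have h2 : 0 ≤ T.sigma ^ 2 * x ^ 2 := by positivity
  rw [energy, tail]
  linarith

theorem exists_le_tail (h : T.tailZero = ⊤) (B : ℝ) :
    ∃ x₀ : ℝ, 0 < x₀ ∧ ∀ x, x₀ ≤ x → B ≤ T.tail (1 / x) := by
  have hU : ⋃ n : ℕ, Ici (1 / ((n : ℝ) + 1)) = Ioi (0 : ℝ) := by
    ext y
    simp only [mem_iUnion, mem_Ici, mem_Ioi]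
    constructor
    · rintro ⟨n, hn⟩
      exact lt_of_lt_of_le (by positivity) hn
    · intro hy
      obtain ⟨n, hn⟩ := exists_nat_one_div_lt hy
      exact ⟨n, hn.le⟩
  have hmono : Monotone fun n : ℕ => Ici (1 / ((n : ℝ) + 1)) := by
    intro n k hnk
    refine Ici_subset_Ici.2 (one_div_le_one_div_of_le (by positivity) ?_)
    have : (n : ℝ) ≤ k := by exact_mod_cast hnk
    linarith
  have h1 := tendsto_measure_iUnion_atTop (μ := T.Pi) hmono
  rw [hU, show T.Pi (Ioi 0) = ⊤ from h] at h1
  obtain ⟨n, hn'⟩ := (h1.eventually (lt_mem_nhds (ENNReal.ofReal_lt_top (r := B)))).exists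
  have hn : ENNReal.ofReal B ≤ T.Pi (Ici (1 / ((n : ℝ) + 1))) := hn'.le
  refine ⟨n + 1, by positivity, fun x hx => ?_⟩
  have hx0 : 0 < x := lt_of_lt_of_le (by positivity) hx
  have h2 : T.Pi (Ici (1 / ((n : ℝ) + 1))) ≤ T.Pi (Ici (1 / x)) :=
    measure_mono (Ici_subset_Ici.2 (one_div_le_one_div_of_le (by positivity) hx))
  exact (ENNReal.ofReal_le_iff_le_toReal (T.Pi_Ici_lt_top (by positivity)).ne).1 (hn.trans h2)

theorem Nondegenerate.phi_le_mul (hT : T.Nondegenerate) {x : ℝ} (hx : 1 ≤ x) :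
    (T.phi x).re ≤ (T.phi (1 : ℝ)).re * x := by
  have hf := hT.isBernstein
  have h := T.phi_isHolomorphicExtension
  rcases hx.eq_or_lt with rfl | hx1
  · simp
  obtain ⟨c, hc, hc'⟩ := exists_deriv_eq_slope (fun u : ℝ => (T.phi u).re) hx1
    (fun u hu => (h.differentiableAt_real
      (one_pos.trans_le hu.1)).continuousAt.continuousWithinAt)
    (fun u hu => (h.differentiableAt_real (one_pos.trans hu.1)).differentiableWithinAt)
  have h1 := hf.antitoneOn_deriv h (mem_Ioi.2 one_pos) (mem_Ioi.2 (one_pos.trans hc.1)) hc.1.le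
  have h2 := hf.mul_deriv_le h one_pos
  rw [one_mul] at h2
  have h3 := h1.trans h2
  rw [hc', div_le_iff₀ (by linarith)] at h3
  nlinarith

/-- The kernel of `x φ(x)` is at most `(1 + x y) gammaKernel (x y)`. In the part with the factor
`y`, jumps below `δ` cost `δ` times the energy and larger ones a constant independent of `x`. So `φ`
is an arbitrarily small multiple of the energy plus a constant. -/
theorem phi_le_energy {δ x : ℝ} (hδ : 0 < δ) (hx : 0 < x) :
    (T.phi x).re ≤ (2 / x + δ) * T.energy x +
      (T.m + ∫ y, (Ici δ).indicator (fun y => y) y ∂T.Pi) := by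
  have hi1 := T.integrable_gammaKernel hx.le
  have hi2 := T.integrable_mul_gammaKernel hx.le
  have hi3 : Integrable (fun y => (Ici δ).indicator (fun y : ℝ => y) y) T.Pi := by
    refine T.integrable_of_norm_le (C := 1 + 1 / δ)
      (Measurable.aestronglyMeasurable (measurable_id.indicator measurableSet_Ici)) fun y hy => ?_
    have hm : 0 ≤ min (y ^ 2) y := le_min (by positivity) hy.le
    by_cases h : y ∈ Ici δ
    · have h' : δ ≤ y := h
      rw [indicator_of_mem h, Real.norm_of_nonneg hy.le]
      rcases min_choice (y ^ 2) y with h1 | h1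
      · rw [h1]
        have : y ≤ 1 / δ * y ^ 2 := by
          rw [div_mul_eq_mul_div, one_mul, le_div_iff₀ hδ]
          nlinarith
        nlinarith [sq_nonneg y]
      · rw [h1]
        have : 0 ≤ 1 / δ * y := by positivity
        linarith
    · rw [indicator_of_notMem h, norm_zero]
      positivity
  have hi4 : Integrable (fun y => δ * gammaKernel (x * y) +
      (Ici δ).indicator (fun y : ℝ => y) y) T.Pi := (hi1.const_mul δ).add hi3
  have hi5 : Integrable (fun y => x * (δ * gammaKernel (x * y) +
      (Ici δ).indicator (fun y : ℝ => y) y)) T.Pi := hi4.const_mul x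
  have h1 : ∫ y, (Real.exp (-(x * y)) - 1 + x * y) ∂T.Pi ≤
      ∫ y, (gammaKernel (x * y) + x * (δ * gammaKernel (x * y) +
        (Ici δ).indicator (fun y : ℝ => y) y)) ∂T.Pi := by
    refine integral_mono_ae (T.integrable_kernel_real hx.le)
      (hi1.add hi5) ?_
    filter_upwards [T.ae_pos] with y hy
    have hxy : 0 ≤ x * y := by positivity
    have e0 := gammaKernel_nonneg (x * y)
    have e1 := gammaKernel_le_one hxy
    have e2 : y * gammaKernel (x * y) ≤ δ * gammaKernel (x * y) +
        (Ici δ).indicator (fun y : ℝ => y) y := by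
      by_cases h : y ∈ Ici δ
      · rw [indicator_of_mem h]
        nlinarith
      · have h' : y < δ := not_le.1 h
        rw [indicator_of_notMem h]
        nlinarith
    have e3 := kernel_le_mul_gammaKernel hxy
    nlinarith
  rw [integral_add hi1 hi5, integral_const_mul,
    integral_add (hi1.const_mul δ) hi3, integral_const_mul] at h1
  have h2 := T.mul_phi_eq hx.le
  have h3 : 0 ≤ ∫ y, gammaKernel (x * y) ∂T.Pi := integral_nonneg fun y => gammaKernel_nonneg _
  have h4 : 0 ≤ T.sigma ^ 2 * x ^ 2 := by positivity
  rw [energy]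
  refine le_of_mul_le_mul_left ?_ hx
  rw [h2]
  set V := ∫ y, gammaKernel (x * y) ∂T.Pi
  set A := ∫ y, (Ici δ).indicator (fun y : ℝ => y) y ∂T.Pi
  have e4 : x * ((2 / x + δ) * (T.sigma ^ 2 * x ^ 2 + V) + (T.m + A)) =
      2 * (T.sigma ^ 2 * x ^ 2) + 2 * V + x * δ * (T.sigma ^ 2 * x ^ 2) + x * δ * V +
        x * T.m + x * A := by
    field_simp
    ring
  rw [e4]
  have e5 : 0 ≤ x * δ * (T.sigma ^ 2 * x ^ 2) := by positivity
  nlinarith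

/-- If `σ > 0`, `φ` is at most linear and the energy at least quadratic. If `Π` is infinite, the
energy tends to infinity and absorbs the additive constant of `phi_le_energy`. -/
theorem Nondegenerate.exists_mul_phi_le_energy (hT : T.Nondegenerate) (h : T.InNInfty) {K : ℝ}
    (hK : 0 < K) : ∃ x₀ : ℝ, 0 < x₀ ∧ ∀ x, x₀ ≤ x → K * (T.phi x).re ≤ T.energy x := by
  rcases h with h | h
  · have hφ := hT.re_phi_pos
    refine ⟨max 1 (K * (T.phi (1 : ℝ)).re / T.sigma ^ 2), by positivity, fun x hx => ?_⟩
    have hx1 : 1 ≤ x := (le_max_left _ _).trans hx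
    have hx2 := (le_max_right _ _).trans hx
    have hx0 : 0 < x := by linarith
    rw [div_le_iff₀ (by positivity)] at hx2
    have h1 := hT.phi_le_mul hx1
    have h2 : 0 ≤ ∫ y, gammaKernel (x * y) ∂T.Pi := integral_nonneg fun y => gammaKernel_nonneg _
    rw [energy]
    calc K * (T.phi x).re ≤ K * ((T.phi (1 : ℝ)).re * x) := by gcongr
      _ = K * (T.phi (1 : ℝ)).re * x := by ring
      _ ≤ x * T.sigma ^ 2 * x := by gcongr
      _ ≤ _ := by linarith
  -- With `x ≥ 16 K` the coefficient of the energy becomes `K (1/(8K) + 1/(4K)) = 3/8`; the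
  -- threshold `10 K |A|` for the tail makes `K A` at most half the energy, for a total of `7/8`.
  · set δ := 1 / (4 * K) with hδ
    have hδ0 : 0 < δ := by positivity
    set A := T.m + ∫ y, (Ici δ).indicator (fun y => y) y ∂T.Pi with hA
    obtain ⟨x₁, hx₁, hx₁'⟩ := exists_le_tail h (10 * K * |A|)
    refine ⟨max x₁ (16 * K), lt_max_of_lt_left hx₁, fun x hx => ?_⟩
    have hx0 : 0 < x := hx₁.trans_le ((le_max_left _ _).trans hx)
    have h1 := hx₁' x ((le_max_left _ _).trans hx)
    have h2 := tail_le_energy (T := T) hx0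
    have h3 := phi_le_energy (T := T) hδ0 hx0
    have h4 : 2 / x ≤ 1 / (8 * K) := by
      rw [div_le_div_iff₀ hx0 (by positivity)]
      linarith [(le_max_right _ _).trans hx]
    have h5 := le_abs_self A
    have hE : 0 ≤ T.energy x := by linarith [mul_nonneg hK.le (abs_nonneg A)]
    have h6 : (T.phi x).re ≤ (1 / (8 * K) + δ) * T.energy x + A :=
      h3.trans (add_le_add (mul_le_mul_of_nonneg_right (by linarith) hE) le_rfl)
    have h7 : K * ((1 / (8 * K) + δ) * T.energy x + A) = 3 / 8 * T.energy x + K * A := by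
      rw [hδ]
      field_simp
      ring
    have h8 := mul_le_mul_of_nonneg_left h6 hK.le
    rw [h7] at h8
    nlinarith

theorem Nondegenerate.decaysOfOrder_of_inNInfty (hT : T.Nondegenerate) (h : T.InNInfty) {a : ℝ}
    (ha : T.dphi < a) (u : ℝ) : T.DecaysOfOrder a u := by
  -- The exponent obtained is `K / 4 > u`: one factor two is lost in `ln (1 + t) ≥ t / 2` for `t ≤
  -- 1`, the other because only `x ≤ √b` is used, where the error `x² / (2 b²)` is at most `1 / b`
  -- and adds up to a constant.
  set K := 4 * (|u| + 1) with hK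
  have hK0 : 0 < K := by positivity
  obtain ⟨x₀, hx₀, hx₀'⟩ := hT.exists_mul_phi_le_energy h hK0
  refine hT.decaysOfOrder_of_vert_ge (p := K / 2) (s := 1 / 2) (x₀ := max x₀ K) (B := 1) (D := 1)
    (e := fun b => b⁻¹) ha (by positivity) (by norm_num) ?_ (fun b hb => ?_)
    (fun b x hb hx hxb => ?_)
  · rw [hK]
    linarith [le_abs_self u]
  · refine ⟨by positivity, ?_⟩
    have h1 : b ^ (1 / 2 : ℝ) ≤ b := by
      simpa using Real.rpow_le_rpow_of_exponent_le hb (show (1 / 2 : ℝ) ≤ 1 by norm_num)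
    have hb0 : 0 < b := by linarith
    rw [← div_eq_mul_inv, div_le_one hb0]
    exact h1
  · have hb0 : 0 < b := by linarith
    have hx1 : x₀ ≤ x := (le_max_left _ _).trans hx
    have hx2 : K ≤ x := (le_max_right _ _).trans hx
    have hx0 : 0 < x := hx₀.trans_le hx1
    have hφ : 0 < (T.phi x).re := hT.isBernstein.pos T.phi_isHolomorphicExtension hx0
    refine le_trans ?_ (hT.vert_ge hx0 hb0)
    have h1 : K / x ≤ T.energy x / (x * (T.phi x).re) := by
      rw [div_le_div_iff₀ hx0 (by positivity)]
      nlinarith [hx₀' x hx1]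
    have h2 : Real.log (1 + K / x) ≤ Real.log (1 + T.energy x / (x * (T.phi x).re)) :=
      Real.log_le_log (by positivity) (by linarith)
    have h3 : K / x / 2 ≤ Real.log (1 + K / x) := by
      have e1 := Real.le_log_one_add_of_nonneg (show 0 ≤ K / x by positivity)
      refine le_trans ?_ e1
      have e2 : K / x ≤ 1 := (div_le_one hx0).2 hx2
      have e3 : 0 ≤ K / x := by positivity
      rw [div_le_div_iff₀ (by norm_num) (by positivity)]
      nlinarith
    have h4 := mul_le_mul_of_nonneg_left (log_add_one_sub_log_le hx0) (half_pos hK0).le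
    have h5 : x ^ 2 / (2 * b ^ 2) ≤ b⁻¹ := by
      have e4 : x ^ 2 ≤ b := by
        have := pow_le_pow_left₀ hx0.le hxb 2
        rwa [← Real.sqrt_eq_rpow, Real.sq_sqrt hb0.le] at this
      rw [div_le_iff₀ (by positivity)]
      calc x ^ 2 ≤ b := e4
        _ ≤ b⁻¹ * (2 * b ^ 2) := by
          field_simp
          linarith
    have h6 : K / 2 * (1 / x) = K / x / 2 := by ring
    linarith

end Triplet

namespace Triplet

variable {T : Triplet}

/-! ### The case of a finite measure and `σ = 0` -/

theorem sigma_eq_zero (h : ¬ T.InNInfty) : T.sigma = 0 :=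
  le_antisymm (not_lt.1 fun h0 => h (Or.inl h0)) T.sigma_nonneg

theorem Pi_univ : T.Pi univ = T.tailZero := by
  rw [← Iic_union_Ioi (a := (0 : ℝ))]
  refine le_antisymm ((measure_union_le _ _).trans ?_) (measure_mono subset_union_right)
  rw [T.concentrated, zero_add, tailZero]

theorem isFiniteMeasure_Pi (h : ¬ T.InNInfty) : IsFiniteMeasure T.Pi :=
  ⟨by rw [Pi_univ]; exact lt_top_iff_ne_top.2 fun h0 => h (Or.inr h0)⟩

variable (T) in
/-- The total mass of `Π`. -/
noncomputable def mass : ℝ := T.tailZero.toReal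

variable (T) in
/-- `m + ∫ y Π(dy)`. -/
noncomputable def phiTop : ℝ := T.m + ∫ y, y ∂T.Pi

theorem Nondegenerate.mass_pos (hT : T.Nondegenerate) (h : ¬ T.InNInfty) : 0 < T.mass := by
  rcases hT with h0 | h0
  · exact absurd (Or.inl h0) h
  · refine ENNReal.toReal_pos ?_ fun h1 => h (Or.inr h1)
    rw [← Pi_univ]
    exact Measure.measure_univ_ne_zero.2 h0

theorem integrable_id_Pi (h : ¬ T.InNInfty) : Integrable (fun y : ℝ => y) T.Pi := by
  have := isFiniteMeasure_Pi h
  refine Integrable.mono' ((integrable_const (1 : ℝ)).add T.integrable_min)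
    (by fun_prop) ?_
  filter_upwards [T.ae_pos] with y hy
  rw [Real.norm_of_nonneg hy.le]
  change y ≤ 1 + min (y ^ 2) y
  rcases min_choice (y ^ 2) y with h1 | h1 <;> rw [h1]
  · nlinarith [sq_nonneg (y - 1)]
  · linarith

theorem r_eq_ofReal (h : ¬ T.InNInfty) : T.r = ENNReal.ofReal T.phiTop := by
  have hpos : 0 ≤ᵐ[T.Pi] fun y : ℝ => y := T.ae_pos.mono fun y hy => hy.le
  have h1 := lintegral_eq_lintegral_meas_le T.Pi hpos aemeasurable_id
  rw [phiTop, add_comm, ENNReal.ofReal_add (integral_nonneg_of_ae hpos) T.m_nonneg,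
    ofReal_integral_eq_lintegral_ofReal (integrable_id_Pi h) hpos, h1]
  rfl

theorem integrable_one_sub_exp (h : ¬ T.InNInfty) {z : ℂ} (hz : 0 ≤ z.re) :
    Integrable (fun y : ℝ => 1 - Complex.exp (-z * y)) T.Pi := by
  have := isFiniteMeasure_Pi h
  refine Integrable.mono' (integrable_const (2 : ℝ)) (by fun_prop) ?_
  filter_upwards [T.ae_pos] with y hy
  rw [neg_mul]
  refine norm_one_sub_exp_neg_le_two ?_
  rw [Complex.re_mul_ofReal]
  positivity

/-- For finite `Π` and `σ = 0` the deviation of `φ` from its limit is an explicit bounded integral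
divided by `z`. This yields both the rate `2 Π̄(0+) / |z|` and the limit `x (r - φ(x)) → Π̄(0+)`. -/
theorem mul_phiTop_sub (h : ¬ T.InNInfty) {z : ℂ} (hz : 0 ≤ z.re) :
    z * (T.phiTop - T.phi z) = ∫ y : ℝ, (1 - Complex.exp (-z * y)) ∂T.Pi := by
  rw [mul_sub, ← T.psi_eq hz, psi, sigma_eq_zero h, phiTop]
  have h1 : ∫ y : ℝ, (Complex.exp (-z * y) - 1 + z * y) ∂T.Pi =
      z * (∫ y : ℝ, y ∂T.Pi : ℝ) - ∫ y : ℝ, (1 - Complex.exp (-z * y)) ∂T.Pi := by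
    have hi : Integrable (fun y : ℝ => z * (y : ℂ)) T.Pi :=
      (integrable_id_Pi h).ofReal.const_mul z
    rw [← integral_complex_ofReal, ← integral_const_mul, ← integral_sub hi (integrable_one_sub_exp h hz)]
    refine integral_congr_ae (Eventually.of_forall fun y => ?_)
    dsimp only
    ring
  rw [h1]
  push_cast
  ring

theorem norm_phi_sub_phiTop_le (h : ¬ T.InNInfty) {z : ℂ} (hz : 0 ≤ z.re) (hz0 : z ≠ 0) :
    ‖T.phi z - T.phiTop‖ ≤ 2 * T.mass / ‖z‖ := by
  have := isFiniteMeasure_Pi h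
  rw [le_div_iff₀ (norm_pos_iff.2 hz0), norm_sub_rev, mul_comm, ← norm_mul, mul_phiTop_sub h hz]
  refine (norm_integral_le_of_norm_le_const (C := 2) ?_).trans (le_of_eq ?_)
  · filter_upwards [T.ae_pos] with y hy
    rw [neg_mul]
    refine norm_one_sub_exp_neg_le_two ?_
    rw [Complex.re_mul_ofReal]
    positivity
  · rw [Measure.real, Pi_univ, mass]

theorem mul_phiTop_sub_ofReal (h : ¬ T.InNInfty) {x : ℝ} (hx : 0 ≤ x) :
    x * (T.phiTop - (T.phi x).re) = ∫ y : ℝ, (1 - Real.exp (-x * y)) ∂T.Pi := by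
  have h1 := mul_phiTop_sub (z := (x : ℂ)) h (by simpa using hx)
  rw [phi_eq_re] at h1
  rw [← Complex.ofReal_inj, ← integral_complex_ofReal]
  push_cast
  exact h1

theorem tendsto_mul_phiTop_sub (h : ¬ T.InNInfty) :
    Tendsto (fun x : ℝ => x * (T.phiTop - (T.phi x).re)) atTop (𝓝 T.mass) := by
  have := isFiniteMeasure_Pi h
  have h1 : Tendsto (fun x : ℝ => ∫ y : ℝ, (1 - Real.exp (-x * y)) ∂T.Pi) atTop
      (𝓝 (∫ _ : ℝ, (1 : ℝ) ∂T.Pi)) := by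
    refine tendsto_integral_filter_of_dominated_convergence (fun _ => 1)
      (Eventually.of_forall fun x => by fun_prop) ?_ (integrable_const _) ?_
    · filter_upwards [eventually_ge_atTop 0] with x hx
      filter_upwards [T.ae_pos] with y hy
      have e1 : Real.exp (-x * y) ≤ 1 := by
        rw [Real.exp_le_one_iff]
        nlinarith
      rw [Real.norm_of_nonneg (by linarith)]
      linarith [Real.exp_pos (-x * y)]
    · filter_upwards [T.ae_pos] with y hy
      have e1 : Tendsto (fun x : ℝ => Real.exp (-(x * y))) atTop (𝓝 0) :=
        Real.tendsto_exp_neg_atTop_nhds_zero.comp (tendsto_id.atTop_mul_const hy)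
      simpa using e1.const_sub 1
  rw [integral_const, smul_eq_mul, mul_one, Measure.real, Pi_univ] at h1
  refine h1.congr' ?_
  filter_upwards [eventually_ge_atTop 0] with x hx
  rw [mul_phiTop_sub_ofReal h hx]

theorem phi_le_phiTop (h : ¬ T.InNInfty) {x : ℝ} (hx : 0 < x) : (T.phi x).re ≤ T.phiTop := by
  have h1 := mul_phiTop_sub_ofReal h hx.le
  have h2 : 0 ≤ ∫ y : ℝ, (1 - Real.exp (-x * y)) ∂T.Pi := by
    refine integral_nonneg_of_ae ?_
    filter_upwards [T.ae_pos] with y hy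
    change 0 ≤ 1 - Real.exp (-x * y)
    rw [sub_nonneg, Real.exp_le_one_iff]
    nlinarith
  rw [← h1] at h2
  linarith [nonneg_of_mul_nonneg_right h2 hx]

theorem Nondegenerate.phiTop_pos (hT : T.Nondegenerate) (h : ¬ T.InNInfty) : 0 < T.phiTop :=
  hT.re_phi_pos.trans_le (phi_le_phiTop h one_pos)

/-- On the real axis `φ(x) ≤ r exp (-p / x)` for large `x` and any `p < M / r`, whereas `|φ(x + ib)|
≥ r - 2M / b`. Hence each term is at least `p / x - 4M / (r b)`, and summing over `x ≤ b` loses only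
a constant. -/
theorem Nondegenerate.decaysOfOrder_of_lt (hT : T.Nondegenerate) (h : ¬ T.InNInfty) {a u : ℝ}
    (ha : T.dphi < a) (hu : u < T.mass / T.phiTop) : T.DecaysOfOrder a u := by
  have hM := hT.mass_pos h
  have hr := hT.phiTop_pos h
  set M := T.mass with hMdef
  set r := T.phiTop with hrdef
  have hp : 0 < M / r := by positivity
  -- A midpoint, so that `p` is non-negative, exceeds `u` and stays strictly below `M / r`.
  set p := (max u 0 + M / r) / 2 with hpdef
  have hmax : max u 0 < M / r := max_lt hu hp
  have hp0 : 0 ≤ p := by linarith [le_max_right u 0]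
  have hpM : p * r < M := by
    rw [← lt_div_iff₀ hr]
    linarith
  obtain ⟨x₀, hx₀⟩ := eventually_atTop.1
    ((tendsto_mul_phiTop_sub h).eventually (lt_mem_nhds hpM))
  refine hT.decaysOfOrder_of_vert_ge (p := p) (s := 1) (x₀ := max x₀ 1) (B := max 1 (4 * M / r))
    (D := 4 * M / r) (e := fun b => 4 * M / (r * b)) ha hp0 one_pos ?_ (fun b hb => ?_)
    (fun b x hb hx _ => ?_)
  · linarith [le_max_left u 0]
  · have hb0 : 0 < b := one_pos.trans_le ((le_max_left _ _).trans hb)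
    refine ⟨by positivity, le_of_eq ?_⟩
    rw [Real.rpow_one]
    field_simp
  · have hb0 : 0 < b := one_pos.trans_le ((le_max_left _ _).trans hb)
    have hb1 := (le_max_right _ _).trans hb
    have hx0 : 0 < x := one_pos.trans_le ((le_max_right _ _).trans hx)
    have hφ : 0 < (T.phi x).re := hT.isBernstein.pos T.phi_isHolomorphicExtension hx0
    have h1 := hx₀ x ((le_max_left _ _).trans hx)
    have hz : ((x : ℂ) + b * Complex.I) ≠ 0 := fun h0 => by
      have := congrArg Complex.re h0
      simp at this
      exact hx0.ne' this
    have h2 := norm_phi_sub_phiTop_le h (z := x + b * Complex.I) (by simpa using hx0.le) hz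
    have hbz : b ≤ ‖(x : ℂ) + b * Complex.I‖ := by
      have := (le_abs_self _).trans (Complex.abs_im_le_norm ((x : ℂ) + b * Complex.I))
      simpa using this
    have h3 : 2 * M / ‖(x : ℂ) + b * Complex.I‖ ≤ 2 * M / b :=
      div_le_div_of_nonneg_left (by positivity) hb0 hbz
    have h4 : r * (1 - 2 * M / (r * b)) ≤ ‖T.phi (x + b * Complex.I)‖ := by
      have e1 := norm_sub_norm_le (r : ℂ) (T.phi (x + b * Complex.I))
      rw [norm_sub_rev, Complex.norm_real, Real.norm_of_nonneg hr.le] at e1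
      have e2 : r * (1 - 2 * M / (r * b)) = r - 2 * M / b := by field_simp
      rw [e2]
      linarith
    have h5 : 2 * M / (r * b) ≤ 1 / 2 := by
      rw [div_le_div_iff₀ (by positivity) (by norm_num)]
      rw [div_le_iff₀ hr] at hb1
      linarith
    have h6 := neg_two_mul_le_log_one_sub (by positivity) h5
    have h7 : (T.phi x).re ≤ r * Real.exp (-(p / x)) := by
      have e1 := Real.add_one_le_exp (-(p / x))
      refine le_trans ?_ (mul_le_mul_of_nonneg_left e1 hr.le)
      have e2 : r * (-(p / x) + 1) = r - p * r / x := by field_simp; ring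
      rw [e2, le_sub_iff_add_le', ← le_sub_iff_add_le, div_le_iff₀ hx0]
      linarith
    have h8 := Real.log_le_log hφ h7
    have h9 : 0 < 1 - 2 * M / (r * b) := by linarith
    have h10 := Real.log_le_log (by positivity) h4
    rw [Real.log_mul hr.ne' (Real.exp_ne_zero _), Real.log_exp] at h8
    rw [Real.log_mul hr.ne' h9.ne'] at h10
    have h11 : 0 < ‖T.phi (x + b * Complex.I)‖ := lt_of_lt_of_le (by positivity) h4
    rw [vert, norm_phi_ofReal hφ.le, Real.log_div h11.ne' hφ.ne']
    have h12 := mul_le_mul_of_nonneg_left (log_add_one_sub_log_le hx0) hp0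
    have h13 : 4 * M / (r * b) = 2 * (2 * M / (r * b)) := by ring
    rw [h13]
    rw [mul_one_div] at h12
    linarith

/-- In the finite case already `⌈t⌉ - 1 < t` for `t = Π̄(0+) / r`, so `N_r - 1` lies strictly below
`t`; the alternative `0` does because `t > 0`. -/
theorem Nondegenerate.decaysOfOrder_of_le_Nr (hT : T.Nondegenerate) {a u : ℝ}
    (ha : T.dphi < a) (hu : (u : EReal) ≤ max (T.Nr - 1) 0) : T.DecaysOfOrder a u := by
  by_cases h : T.InNInfty
  · exact hT.decaysOfOrder_of_inNInfty h ha u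
  refine hT.decaysOfOrder_of_lt h ha ?_
  have hM := hT.mass_pos h
  have hr := hT.phiTop_pos h
  have h1 : (T.tailZero / T.r).toReal = T.mass / T.phiTop := by
    rw [ENNReal.toReal_div, r_eq_ofReal h, ENNReal.toReal_ofReal hr.le, mass]
  rw [Nr, if_neg h, h1] at hu
  have h2 : (u : EReal) ≤ ((max ((⌈T.mass / T.phiTop⌉ - 1 : ℤ) - 1 : ℝ) 0 : ℝ) : EReal) := by
    refine hu.trans (le_of_eq ?_)
    rw [EReal.coe_strictMono.monotone.map_max]
    simp
  rw [EReal.coe_le_coe_iff] at h2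
  refine h2.trans_lt (max_lt ?_ (by positivity))
  have h3 := Int.ceil_lt_add_one (T.mass / T.phiTop)
  push_cast
  linarith

theorem dphi_nonpos : T.dphi ≤ 0 := Real.sSup_nonpos fun _ h => h.1

/-- Both `φ(x + ib)` and `φ(x)` are within `2 Π̄(0+) / x` of the limit `r`, whatever `b` is. -/
theorem Nondegenerate.vert_le_div (hT : T.Nondegenerate) (h : ¬ T.InNInfty) {x : ℝ} (hx : 1 ≤ x)
    (b : ℝ) : vert T.phi b x ≤ 4 * T.mass / (T.phi (1 : ℝ)).re / x := by
  have hM := hT.mass_pos h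
  have hx0 : 0 < x := one_pos.trans_le hx
  have hf := hT.isBernstein
  have hφ1 := hT.re_phi_pos
  have hφ : 0 < (T.phi x).re := hf.pos T.phi_isHolomorphicExtension hx0
  have hmono : (T.phi (1 : ℝ)).re ≤ (T.phi x).re :=
    hf.monotoneOn T.phi_isHolomorphicExtension (mem_Ioi.2 one_pos) (mem_Ioi.2 hx0) hx
  have hre : 0 < ((x : ℂ) + b * Complex.I).re := by simpa using hx0
  have hxz : x ≤ ‖(x : ℂ) + b * Complex.I‖ := by
    have := Complex.re_le_norm ((x : ℂ) + b * Complex.I)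
    simpa using this
  have h1 := norm_phi_sub_phiTop_le h hre.le (norm_pos_iff.1 (hx0.trans_le hxz))
  have h2 := norm_phi_sub_phiTop_le h (z := (x : ℂ)) (by simpa using hx0.le)
    (by simpa using hx0.ne')
  rw [Complex.norm_real, Real.norm_of_nonneg hx0.le, norm_sub_rev] at h2
  have h3 : 2 * T.mass / ‖(x : ℂ) + b * Complex.I‖ ≤ 2 * T.mass / x :=
    div_le_div_of_nonneg_left (by positivity) hx0 hxz
  have h4 : ‖T.phi (x + b * Complex.I)‖ ≤ (T.phi x).re + 4 * T.mass / x := by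
    have e1 := norm_le_norm_add_norm_sub' (T.phi (x + b * Complex.I)) (T.phi x)
    have e2 := norm_sub_le_norm_sub_add_norm_sub (T.phi (x + b * Complex.I)) T.phiTop (T.phi x)
    rw [norm_phi_ofReal hφ.le] at e1
    have e3 : 4 * T.mass / x = 2 * T.mass / x + 2 * T.mass / x := by ring
    linarith
  have h5 : 0 < ‖T.phi (x + b * Complex.I)‖ :=
    norm_pos_iff.2 (hf.ne_zero T.phi_isHolomorphicExtension hre)
  rw [vert, norm_phi_ofReal hφ.le]
  refine (Real.log_le_sub_one_of_pos (by positivity)).trans ?_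
  rw [sub_le_iff_le_add, div_le_iff₀ hφ]
  refine h4.trans ?_
  have h6 : 4 * T.mass / x ≤ 4 * T.mass / (T.phi (1 : ℝ)).re / x * (T.phi x).re := by
    rw [div_div, div_mul_eq_mul_div, div_le_div_iff₀ hx0 (by positivity)]
    have := mul_le_mul_of_nonneg_left hmono (show 0 ≤ 4 * T.mass * x by positivity)
    linarith
  linarith

/-- Terms with `k < b²` are summed with the bound `C / x`, giving a harmonic number; for the others
`5 b² / x²` telescopes to at most `5`. An integer `b` makes the cutoff `b²` an index. -/
theorem Nondegenerate.sum_vert_le (hT : T.Nondegenerate) (h : ¬ T.InNInfty) {b : ℕ} (hb : 0 < b)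
    (n : ℕ) : ∑ k ∈ Finset.range n, vert T.phi b (1 + k) ≤
      4 * T.mass / (T.phi (1 : ℝ)).re * (1 + 2 * Real.log b) + 5 := by
  have hf := hT.isBernstein
  have hM := hT.mass_pos h
  have hφ1 := hT.re_phi_pos
  set C := 4 * T.mass / (T.phi (1 : ℝ)).re with hC
  have hC0 : 0 < C := by positivity
  have hb' : (0 : ℝ) < b := by exact_mod_cast hb
  have h0 : ∀ k : ℕ, 0 ≤ vert T.phi b (1 + k) := fun k =>
    hf.vert_nonneg T.phi_isHolomorphicExtension (by positivity) _
  have h1 : ∑ k ∈ Finset.range n, vert T.phi b (1 + k) ≤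
      ∑ k ∈ Finset.range (b ^ 2 + n), vert T.phi b (1 + k) :=
    Finset.sum_le_sum_of_subset_of_nonneg (Finset.range_mono (by omega)) fun k _ _ => h0 k
  refine h1.trans ?_
  rw [Finset.sum_range_add]
  refine add_le_add ?_ ?_
  · have h2 : ∑ k ∈ Finset.range (b ^ 2), vert T.phi b (1 + k) ≤ C * (harmonic (b ^ 2) : ℝ) := by
      rw [harmonic]
      push_cast
      rw [Finset.mul_sum]
      refine Finset.sum_le_sum fun k _ => ?_
      have := hT.vert_le_div h (x := 1 + k) (by linarith [k.cast_nonneg (α := ℝ)]) b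
      rw [add_comm (k : ℝ) 1, ← div_eq_mul_inv]
      exact this
    refine h2.trans (mul_le_mul_of_nonneg_left ?_ hC0.le)
    have h3 := harmonic_le_one_add_log (b ^ 2)
    push_cast at h3
    rwa [Real.log_pow] at h3
  · have h2 : ∀ i : ℕ, vert T.phi b (1 + ((b ^ 2 + i : ℕ) : ℝ)) ≤
        5 * b ^ 2 * ((1 / ((b : ℝ) ^ 2 + i)) - (1 / ((b : ℝ) ^ 2 + (i + 1 : ℕ)))) := by
      intro i
      refine (hf.vert_le T.phi_isHolomorphicExtension (by positivity) _).trans ?_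
      push_cast
      have e0 : (0 : ℝ) < (b : ℝ) ^ 2 + i := by positivity
      rw [div_mul_eq_mul_div, div_sub_div _ _ e0.ne' (by positivity), mul_div_assoc']
      rw [div_le_div_iff₀ (by positivity) (by positivity)]
      have e1 : ((b : ℝ) ^ 2 + i) * ((b : ℝ) ^ 2 + (i + 1)) ≤ (1 + ((b : ℝ) ^ 2 + i)) ^ 2 := by
        nlinarith
      have e2 := mul_le_mul_of_nonneg_left e1 (show 0 ≤ 5 * (b : ℝ) ^ 2 by positivity)
      nlinarith
    refine (Finset.sum_le_sum fun i _ => h2 i).trans ?_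
    rw [← Finset.mul_sum, Finset.sum_range_sub' (fun i : ℕ => 1 / ((b : ℝ) ^ 2 + i))]
    have h3 : 0 ≤ 1 / ((b : ℝ) ^ 2 + n) := by positivity
    have h4 : 5 * (b : ℝ) ^ 2 * (1 / ((b : ℝ) ^ 2 + (0 : ℕ))) = 5 := by
      rw [Nat.cast_zero, add_zero]
      field_simp
    nlinarith [mul_nonneg (show 0 ≤ 5 * (b : ℝ) ^ 2 by positivity) h3]

theorem Nondegenerate.inNInfty_iff (hT : T.Nondegenerate) :
    T.InNInfty ↔ ∀ a u : ℝ, T.dphi < a → 0 ≤ u → T.DecaysOfOrder a u := by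
  refine ⟨fun h a u ha _ => hT.decaysOfOrder_of_inNInfty h ha u, fun hd => ?_⟩
  by_contra h
  have hf := hT.isBernstein
  have he := T.phi_isHolomorphicExtension
  have hM := hT.mass_pos h
  have hφ1 := hT.re_phi_pos
  set C := 4 * T.mass / (T.phi (1 : ℝ)).re with hC
  have hC0 : 0 < C := by positivity
  -- The sum bound gives `|W(1 + in)| ≥ c n ^ (-2C)` with `c > 0`, which contradicts decay of order
  -- `2C` along the integers.
  have h1 := hd 1 (2 * C) (dphi_nonpos.trans_lt one_pos) (by positivity)
  have h2 : Tendsto (fun n : ℕ => (n : ℝ)) atTop (cocompact ℝ) :=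
    tendsto_natCast_atTop_atTop.mono_right atTop_le_cocompact
  have h3 := h1.comp h2
  set c := ‖W T.phi (1 : ℝ)‖ * Real.exp (-(C + 5)) with hc
  have hW : W T.phi (1 : ℝ) ≠ 0 := hf.W_ne_zero he (by simp)
  have hc0 : 0 < c := by positivity
  refine absurd (ge_of_tendsto h3 ?_) (not_le.2 hc0)
  filter_upwards [eventually_gt_atTop 0] with n hn
  have hn' : (0 : ℝ) < n := by exact_mod_cast hn
  have h4 := hf.le_norm_W he (a := 1) (b := n) (fun k => hf.ne_zero he (by
    rw [Complex.ofReal_re]; positivity)) (fun k => hf.ne_zero he (by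
    simp; positivity)) (hT.sum_vert_le h hn)
  dsimp only [Function.comp_apply]
  have h5 : Real.exp (-(C * (1 + 2 * Real.log n) + 5)) =
      Real.exp (-(C + 5)) * (n : ℝ) ^ (-(2 * C)) := by
    rw [Real.rpow_def_of_pos hn', ← Real.exp_add]
    congr 1
    ring
  rw [h5, ← mul_assoc, ← hc] at h4
  rw [abs_of_pos hn']
  calc c = (n : ℝ) ^ (2 * C) * (c * (n : ℝ) ^ (-(2 * C))) := by
        rw [mul_left_comm, ← Real.rpow_add hn']
        simp
    _ ≤ _ := mul_le_mul_of_nonneg_left h4 (by positivity)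

end Triplet

namespace Triplet

variable {T : Triplet}

/-! ### Regularly varying `φ` -/

theorem kernel_le_min {u y : ℝ} (hu : 1 ≤ u) (hy : 0 ≤ y) :
    Real.exp (-(u * y)) - 1 + u * y ≤ u ^ 2 * min (y ^ 2) y := by
  have hv : 0 ≤ u * y := by positivity
  have h1 : Real.exp (-(u * y)) ≤ 1 := Real.exp_le_one_iff.2 (by linarith)
  rcases min_choice (y ^ 2) y with h | h <;> rw [h]
  · rcases le_or_gt (u * y) 1 with h2 | h2
    · have h3 := Real.abs_exp_sub_one_sub_id_le (x := -(u * y)) (by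
        rwa [abs_neg, abs_of_nonneg hv])
      have h4 := (le_abs_self _).trans h3
      nlinarith
    · nlinarith
  · nlinarith

/-- A Gaussian part makes `φ` regularly varying of index one: after division by `u²` the jump
integral vanishes by dominated convergence, with majorant `min (y ^ 2) y`. -/
theorem tendsto_phi_div_of_inNP (h : T.InNP) :
    Tendsto (fun u : ℝ => (T.phi u).re / (T.sigma ^ 2 * u ^ (1 : ℝ))) atTop (𝓝 1) := by
  have hs : 0 < T.sigma := h
  have h1 : Tendsto (fun u : ℝ => ∫ y, (Real.exp (-(u * y)) - 1 + u * y) / u ^ 2 ∂T.Pi) atTop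
      (𝓝 (∫ _, (0 : ℝ) ∂T.Pi)) := by
    refine tendsto_integral_filter_of_dominated_convergence (fun y => min (y ^ 2) y)
      (Eventually.of_forall fun u => by fun_prop) ?_ T.integrable_min ?_
    · filter_upwards [eventually_ge_atTop 1] with u hu
      filter_upwards [T.ae_pos] with y hy
      rw [Real.norm_of_nonneg (div_nonneg (kernel_nonneg _) (sq_nonneg u)),
        div_le_iff₀' (by positivity)]
      exact kernel_le_min hu hy.le
    · filter_upwards [T.ae_pos] with y hy
      refine squeeze_zero' (Eventually.of_forall fun u =>
        div_nonneg (kernel_nonneg _) (sq_nonneg u)) ?_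
        (tendsto_const_nhds.div_atTop (a := y) tendsto_id)
      filter_upwards [eventually_gt_atTop 0] with u hu
      have h1 : Real.exp (-(u * y)) ≤ 1 := Real.exp_le_one_iff.2 (by nlinarith)
      rw [id, div_le_div_iff₀ (by positivity) hu]
      nlinarith
  rw [integral_zero] at h1
  have h2 : Tendsto (fun u : ℝ => T.m / u) atTop (𝓝 0) := tendsto_const_nhds.div_atTop tendsto_id
  have h3 := (((h2.add h1).div_const (T.sigma ^ 2)).const_add 1)
  simp only [add_zero, zero_div] at h3
  refine h3.congr' ?_
  filter_upwards [eventually_gt_atTop 0] with u hu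
  have h4 := T.mul_phi_eq hu.le
  have h5 : (T.phi u).re = (T.sigma ^ 2 * u ^ 2 + T.m * u +
    ∫ y, (Real.exp (-(u * y)) - 1 + u * y) ∂T.Pi) / u := by
    rw [← h4]
    field_simp
  rw [integral_div, h5, Real.rpow_one]
  field_simp
  ring

theorem tendsto_phi_div_of_psi {C α : ℝ}
    (h : Tendsto (fun u : ℝ => (T.psi u).re / (C * u ^ (α + 1))) atTop (𝓝 1)) :
    Tendsto (fun u : ℝ => (T.phi u).re / (C * u ^ α)) atTop (𝓝 1) := by
  refine h.congr' ?_
  filter_upwards [eventually_gt_atTop 0] with u hu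
  rw [T.psi_eq (by simpa using hu.le), Complex.re_ofReal_mul, Real.rpow_add_one hu.ne']
  field_simp

theorem Nondegenerate.ThetaInf_of_inNP (hT : T.Nondegenerate) (h : T.InNP) :
    ThetaInf T.phi = Real.pi / 2 ∧ T.InNTheta := by
  have hs : 0 < T.sigma := h
  have h1 : ThetaInf T.phi = Real.pi / 2 := by
    rw [ThetaInf_eq_of_tendsto (hT.isBernstein.tendsto_Theta_of_regularlyVarying
      T.phi_isHolomorphicExtension (by positivity) (tendsto_phi_div_of_inNP h)), mul_one]
  refine ⟨h1, ?_⟩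
  rw [InNTheta, h1]
  positivity

theorem Nondegenerate.ThetaInf_of_inNAlpha (hT : T.Nondegenerate) {α : ℝ} (hα : 0 < α)
    (h : T.InNAlpha α) : ThetaInf T.phi = Real.pi / 2 * α ∧ T.InNTheta := by
  obtain ⟨C, hC, hlim⟩ := h
  have h1 : ThetaInf T.phi = Real.pi / 2 * α :=
    ThetaInf_eq_of_tendsto (hT.isBernstein.tendsto_Theta_of_regularlyVarying
      T.phi_isHolomorphicExtension hC (tendsto_phi_div_of_psi hlim))
  refine ⟨h1, ?_⟩
  rw [InNTheta, h1]
  positivity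

end Triplet

/-! ### Two limit lemmas for the logarithmic example. -/

/-- L'Hôpital's rule at infinity, for a denominator tending to infinity. -/
theorem tendsto_div_of_tendsto_deriv_div {f f' g g' : ℝ → ℝ} {A L : ℝ}
    (hf : ∀ x, A ≤ x → HasDerivAt f (f' x) x) (hg : ∀ x, A ≤ x → HasDerivAt g (g' x) x)
    (hg' : ∀ x, A ≤ x → 0 < g' x) (hlim : Tendsto (fun x => f' x / g' x) atTop (𝓝 L))
    (hginf : Tendsto g atTop atTop) : Tendsto (fun x => f x / g x) atTop (𝓝 L) := by
  -- Eventually `f - (L - ε) g` and `(L + ε) g - f` are increasing, hence bounded below; the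
  -- constants disappear on division by `g → ∞`.
  have key : ∀ ε : ℝ, 0 < ε → ∃ C : ℝ, ∀ᶠ x in atTop,
      (L - ε) * g x - C ≤ f x ∧ f x ≤ (L + ε) * g x + C := by
    intro ε hε
    obtain ⟨a, ha⟩ := eventually_atTop.1 ((hlim.eventually
      (Icc_mem_nhds (show L - ε < L by linarith) (show L < L + ε by linarith))).and
      (eventually_ge_atTop A))
    have haA := (ha a le_rfl).2
    have hmono : ∀ p q : ℝ, (∀ x, a ≤ x → 0 ≤ p * f' x + q * g' x) →
        MonotoneOn (fun x => p * f x + q * g x) (Ici a) := by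
      intro p q hpq
      have hd : ∀ x, a ≤ x → HasDerivAt (fun x => p * f x + q * g x) (p * f' x + q * g' x) x :=
        fun x hx => ((hf x (haA.trans hx)).const_mul p).add ((hg x (haA.trans hx)).const_mul q)
      refine monotoneOn_of_deriv_nonneg (convex_Ici a)
        (fun x hx => (hd x hx).continuousAt.continuousWithinAt) (fun x hx => ?_) fun x hx => ?_
      · exact (hd x (interior_subset hx)).differentiableAt.differentiableWithinAt
      · rw [(hd x (interior_subset hx)).deriv]
        exact hpq x (interior_subset hx)
    have h1 : MonotoneOn (fun x => 1 * f x + -(L - ε) * g x) (Ici a) := by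
      refine hmono _ _ fun x hx => ?_
      have h2 := (ha x hx).1.1
      rw [le_div_iff₀ (hg' x (haA.trans hx))] at h2
      linarith
    have h2 : MonotoneOn (fun x => -1 * f x + (L + ε) * g x) (Ici a) := by
      refine hmono _ _ fun x hx => ?_
      have h2 := (ha x hx).1.2
      rw [div_le_iff₀ (hg' x (haA.trans hx))] at h2
      linarith
    refine ⟨|1 * f a + -(L - ε) * g a| + |-1 * f a + (L + ε) * g a|, ?_⟩
    filter_upwards [eventually_ge_atTop a] with x hx
    have h3 : 1 * f a + -(L - ε) * g a ≤ 1 * f x + -(L - ε) * g x :=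
      h1 (mem_Ici.2 le_rfl) (mem_Ici.2 hx) hx
    have h4 : -1 * f a + (L + ε) * g a ≤ -1 * f x + (L + ε) * g x :=
      h2 (mem_Ici.2 le_rfl) (mem_Ici.2 hx) hx
    have h5 := neg_abs_le (1 * f a + -(L - ε) * g a)
    have h6 := neg_abs_le (-1 * f a + (L + ε) * g a)
    have h7 := abs_nonneg (1 * f a + -(L - ε) * g a)
    have h8 := abs_nonneg (-1 * f a + (L + ε) * g a)
    constructor <;> linarith
  rw [Metric.tendsto_nhds]
  intro ε hε
  obtain ⟨C, hC⟩ := key (ε / 2) (half_pos hε)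
  filter_upwards [hC, hginf.eventually_gt_atTop 0, hginf.eventually_gt_atTop (2 * C / ε)]
    with x hx hx0 hx1
  rw [div_lt_iff₀ hε] at hx1
  rw [Real.dist_eq, abs_lt, lt_sub_iff_add_lt, sub_lt_iff_lt_add, lt_div_iff₀ hx0,
    div_lt_iff₀ hx0]
  constructor <;> linarith [hx.1, hx.2]

/-- If `l → ∞` and `l w → ζ`, then `l ln |1 + w| → Re ζ`. -/
theorem tendsto_mul_log_norm_one_add {l : ℝ → ℝ} {w : ℝ → ℂ} {ζ : ℂ} (hl : Tendsto l atTop atTop)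
    (hw : Tendsto (fun b => (l b : ℂ) * w b) atTop (𝓝 ζ)) :
    Tendsto (fun b => l b * Real.log ‖1 + w b‖) atTop (𝓝 ζ.re) := by
  have h0 : Tendsto (fun b => ‖w b‖) atTop (𝓝 0) := by
    have h1 := hl.inv_tendsto_atTop.mul hw.norm
    rw [zero_mul] at h1
    refine h1.congr' ?_
    filter_upwards [hl.eventually_gt_atTop 0] with b hb
    rw [norm_mul, Complex.norm_real, Real.norm_of_nonneg hb.le, Pi.inv_apply]
    field_simp
  have h1 : Tendsto (fun b => (l b : ℂ) * (Complex.log (1 + w b) - w b)) atTop (𝓝 0) := by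
    rw [tendsto_zero_iff_norm_tendsto_zero]
    have h2 := hw.norm.mul h0
    rw [mul_zero] at h2
    refine squeeze_zero' (Eventually.of_forall fun b => norm_nonneg _) ?_ h2
    filter_upwards [h0.eventually_le_const (show (0 : ℝ) < 1 / 2 by norm_num)] with b hb
    rw [norm_mul, norm_mul, mul_assoc]
    refine mul_le_mul_of_nonneg_left ?_ (norm_nonneg _)
    refine (Complex.norm_log_one_add_sub_self_le (by linarith)).trans ?_
    have h3 : (1 - ‖w b‖)⁻¹ ≤ 2 := by
      rw [inv_le_iff_one_le_mul₀ (by linarith)]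
      linarith
    nlinarith [sq_nonneg ‖w b‖]
  have h2 := (Complex.continuous_re.tendsto _).comp (h1.add hw)
  rw [zero_add] at h2
  refine h2.congr fun b => ?_
  rw [Function.comp_apply, ← mul_add, sub_add_cancel, Complex.re_ofReal_mul, Complex.log_re]

namespace IsBernstein

variable {f : ℝ → ℝ} {F : ℂ → ℂ}

/-! ### Bernstein functions with `s φ'(s) ~ (ln s)²` -/

/-- Cauchy's mean value theorem against the logarithm, so that the quantity `c f'(c)` with known
asymptotics appears. -/
theorem exists_sub_eq_mul_log (h : IsHolomorphicExtension f F) {u v : ℝ} (hu : 0 < u)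
    (hv : 0 < v) : ∃ c ∈ uIcc u v, f v - f u = c * deriv f c * (Real.log v - Real.log u) := by
  have key : ∀ u v : ℝ, 0 < u → u < v → ∃ c ∈ Icc u v,
      f v - f u = c * deriv f c * (Real.log v - Real.log u) := by
    intro u v hu huv
    obtain ⟨c, hc, hc'⟩ := exists_ratio_hasDerivAt_eq_ratio_slope f (deriv f) huv
      (fun x hx => (h.differentiableAt_real (hu.trans_le hx.1)).continuousAt.continuousWithinAt)
      (fun x hx => (h.differentiableAt_real (hu.trans hx.1)).hasDerivAt) Real.log (fun x => x⁻¹)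
      (fun x hx => (Real.continuousAt_log (hu.trans_le hx.1).ne').continuousWithinAt)
      (fun x hx => Real.hasDerivAt_log (hu.trans hx.1).ne')
    have hc0 : 0 < c := hu.trans hc.1
    refine ⟨c, Ioo_subset_Icc_self hc, ?_⟩
    rw [mul_assoc, mul_comm (deriv f c), hc', mul_comm (f v - f u), mul_inv_cancel_left₀ hc0.ne']
  rcases lt_trichotomy u v with huv | rfl | huv
  · rw [uIcc_of_le huv.le]
    exact key u v hu huv
  · exact ⟨u, left_mem_uIcc, by simp⟩
  · rw [uIcc_of_ge huv.le]
    obtain ⟨c, hc, hc'⟩ := key v u hv huv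
    exact ⟨c, hc, by linarith⟩

/-- A point within a bounded factor of `b` has a logarithm asymptotic to `ln b`, so intermediate
points may be replaced by `b`. -/
theorem tendsto_mul_deriv_comp
    (hreg : Tendsto (fun s => s * deriv f s / Real.log s ^ 2) atTop (𝓝 1)) {c : ℝ → ℝ} {K : ℝ}
    (hc : ∀ᶠ b in atTop, 0 < c b ∧ |Real.log (c b) - Real.log b| ≤ K) :
    Tendsto (fun b => c b * deriv f (c b) / Real.log b ^ 2) atTop (𝓝 1) := by
  have hl := Real.tendsto_log_atTop
  have h1 : Tendsto (fun b => Real.log (c b)) atTop atTop := by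
    refine tendsto_atTop_mono' _ ?_ (tendsto_atTop_add_const_right _ (-K) hl)
    filter_upwards [hc] with b hb
    have := neg_abs_le (Real.log (c b) - Real.log b)
    linarith [hb.2]
  have h2 : Tendsto c atTop atTop := by
    refine (Real.tendsto_exp_atTop.comp h1).congr' ?_
    filter_upwards [hc] with b hb
    exact Real.exp_log hb.1
  have h3 : Tendsto (fun b => Real.log (c b) / Real.log b) atTop (𝓝 1) := by
    rw [tendsto_iff_norm_sub_tendsto_zero]
    refine squeeze_zero' (Eventually.of_forall fun b => norm_nonneg _) ?_
      (tendsto_const_nhds.div_atTop (a := K) hl)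
    filter_upwards [hc, hl.eventually_gt_atTop 0] with b hb hb0
    rw [div_sub_one hb0.ne', norm_div, Real.norm_of_nonneg hb0.le]
    exact div_le_div_of_nonneg_right hb.2 hb0.le
  have h4 := (hreg.comp h2).mul (h3.pow 2)
  rw [one_pow, one_mul] at h4
  refine h4.congr' ?_
  filter_upwards [h1.eventually_gt_atTop 0] with b hb
  rw [Function.comp_apply, div_pow]
  field_simp

theorem tendsto_sub_div_log_sq (h : IsHolomorphicExtension f F)
    (hreg : Tendsto (fun s => s * deriv f s / Real.log s ^ 2) atTop (𝓝 1)) {x : ℝ} (hx : 0 < x) :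
    Tendsto (fun b => (f (b * x) - f b) / Real.log b ^ 2) atTop (𝓝 (Real.log x)) := by
  have hex : ∀ b : ℝ, ∃ c : ℝ, 0 < b → (0 < c ∧ |Real.log c - Real.log b| ≤ |Real.log x|) ∧
      f (b * x) - f b = c * deriv f c * Real.log x := by
    intro b
    by_cases hb : 0 < b
    · have hbx := mul_pos hb hx
      obtain ⟨c, hc, hc'⟩ := exists_sub_eq_mul_log h hb hbx
      have hc0 : 0 < c := (lt_min hb hbx).trans_le hc.1
      have hlog : Real.log (b * x) - Real.log b = Real.log x := by
        rw [Real.log_mul hb.ne' hx.ne']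
        ring
      refine ⟨c, fun _ => ⟨⟨hc0, ?_⟩, by rw [hc', hlog]⟩⟩
      rw [← hlog]
      refine abs_sub_left_of_mem_uIcc ?_
      rcases le_total b (b * x) with h1 | h1
      · rw [uIcc_of_le h1] at hc
        exact Icc_subset_uIcc ⟨Real.log_le_log hb hc.1, Real.log_le_log hc0 hc.2⟩
      · rw [uIcc_of_ge h1] at hc
        exact Icc_subset_uIcc' ⟨Real.log_le_log hbx hc.1, Real.log_le_log hc0 hc.2⟩
    · exact ⟨0, fun h => absurd h hb⟩
  choose c hc using hex
  have h1 := (tendsto_mul_deriv_comp hreg (c := c) (K := |Real.log x|) (by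
    filter_upwards [eventually_gt_atTop 0] with b hb
    exact (hc b hb).1)).mul_const (Real.log x)
  rw [one_mul] at h1
  refine h1.congr' ?_
  filter_upwards [eventually_gt_atTop 0] with b hb
  rw [(hc b hb).2, div_mul_eq_mul_div]

theorem tendsto_div_log_cube (h : IsHolomorphicExtension f F)
    (hreg : Tendsto (fun s => s * deriv f s / Real.log s ^ 2) atTop (𝓝 1)) :
    Tendsto (fun s => f s / (Real.log s ^ 3 / 3)) atTop (𝓝 1) := by
  refine tendsto_div_of_tendsto_deriv_div (A := 2) (f' := deriv f)
    (g' := fun s => Real.log s ^ 2 / s)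
    (fun x hx => (h.differentiableAt_real (by linarith)).hasDerivAt) (fun x hx => ?_)
    (fun x hx => ?_) ?_ ?_
  · have h1 := ((Real.hasDerivAt_log (show x ≠ 0 by linarith)).pow 3).div_const 3
    convert! h1 using 1
    norm_num
    ring
  · have := Real.log_pos (show 1 < x by linarith)
    have : 0 < x := by linarith
    positivity
  · refine hreg.congr fun s => ?_
    rw [div_div_eq_mul_div, mul_comm]
  · exact ((tendsto_pow_atTop (by norm_num)).comp Real.tendsto_log_atTop).atTop_div_const
      (by norm_num)

theorem norm_sub_le_deriv_mul (hf : IsBernstein f) (h : IsHolomorphicExtension f F) {x : ℝ}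
    (hx : 0 < x) {z w : ℂ} (hz : x ≤ z.re) (hw : x ≤ w.re) :
    ‖F z - F w‖ ≤ deriv f x * ‖z - w‖ := by
  refine (convex_halfSpace_re_ge x).norm_image_sub_le_of_norm_deriv_le (f := F)
    (fun u hu => h.differentiableAt (hx.trans_le hu)) (fun u hu => ?_) hw hz
  have hu' : x ≤ u.re := hu
  exact (hf.norm_deriv_le h (hx.trans_le hu')).trans
    (hf.antitoneOn_deriv h (mem_Ioi.2 hx) (mem_Ioi.2 (hx.trans_le hu')) hu')

theorem tendsto_sub_div_log_sq_complex (hf : IsBernstein f) (h : IsHolomorphicExtension f F)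
    (hreg : Tendsto (fun s => s * deriv f s / Real.log s ^ 2) atTop (𝓝 1)) {z : ℂ}
    (hz : 0 < z.re) :
    Tendsto (fun b : ℝ => (F (b * z) - F b) / (Real.log b ^ 2 : ℝ)) atTop
      (𝓝 (Complex.log z)) := by
  have hlog : DifferentiableOn ℂ Complex.log {z : ℂ | 0 < z.re} := fun w hw =>
    (Complex.differentiableAt_log (Or.inl hw)).differentiableWithinAt
  have hfam : LocallyBoundedFamily atTop
      (fun (b : ℝ) (z : ℂ) => (F (b * z) - F b) / (Real.log b ^ 2 : ℝ) - Complex.log z) := by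
    refine ⟨?_, ?_⟩
    · filter_upwards [eventually_gt_atTop 0] with b hb
      refine DifferentiableOn.sub (DifferentiableOn.div_const
        (DifferentiableOn.sub_const ?_ _) _) hlog
      refine h.holomorphic.comp (by fun_prop) fun w hw => ?_
      have hw' : 0 < w.re := hw
      change 0 < ((b : ℂ) * w).re
      rw [Complex.re_ofReal_mul]
      positivity
    · intro R ρ hρ hρR
      obtain ⟨M₁, hM₁⟩ := (isCompact_closedBall (R : ℂ) ρ).exists_bound_of_continuousOn
        (hlog.continuousOn.mono (LocallyBoundedFamily.closedBall_subset hρR))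
      -- Both `b z` and `b` then have real part at least `b δ`, where `|F'| ≤ f'(b δ)`; the mean
      -- value inequality gives the local bound for the Vitali argument.
      set δ := min 1 (R - ρ) with hδ
      have hδ0 : 0 < δ := lt_min one_pos (by linarith)
      have h1 := tendsto_mul_deriv_comp hreg (c := fun b => b * δ) (K := |Real.log δ|) (by
        filter_upwards [eventually_gt_atTop 0] with b hb
        refine ⟨mul_pos hb hδ0, le_of_eq ?_⟩
        rw [Real.log_mul hb.ne' hδ0.ne']
        congr 1
        ring)
      refine ⟨2 * ((2 * R + 1) / δ) + M₁, ?_⟩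
      filter_upwards [eventually_gt_atTop 1,
        h1.eventually_le_const (show (1 : ℝ) < 2 by norm_num)] with b hb hb1 z hz
      obtain ⟨hz1, hz2, hz3⟩ := mem_closedBall_bounds hρ hρR hz
      have hb0 : 0 < b := one_pos.trans hb
      have hL : 0 < Real.log b ^ 2 := pow_pos (Real.log_pos hb) 2
      refine (_root_.norm_sub_le _ _).trans (add_le_add ?_ (hM₁ z hz))
      rw [norm_div, Complex.norm_real, Real.norm_of_nonneg hL.le, div_le_iff₀ hL]
      have h2 := hf.norm_sub_le_deriv_mul h (mul_pos hb0 hδ0) (z := b * z) (w := b)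
        (by
          rw [Complex.re_ofReal_mul]
          exact mul_le_mul_of_nonneg_left ((min_le_right _ _).trans hz1) hb0.le)
        (by
          rw [Complex.ofReal_re]
          exact mul_le_of_le_one_right hb0.le (min_le_left _ _))
      have h3 : ‖(b : ℂ) * z - b‖ ≤ b * (2 * R + 1) := by
        rw [← mul_sub_one, norm_mul, Complex.norm_real, Real.norm_of_nonneg hb0.le]
        refine mul_le_mul_of_nonneg_left ((_root_.norm_sub_le _ _).trans ?_) hb0.le
        rw [norm_one]
        linarith
      have h4 := hf.deriv_nonneg (mul_pos hb0 hδ0)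
      rw [div_le_iff₀ hL] at hb1
      calc _ ≤ deriv f (b * δ) * (b * (2 * R + 1)) :=
            h2.trans (mul_le_mul_of_nonneg_left h3 h4)
        _ = b * δ * deriv f (b * δ) * ((2 * R + 1) / δ) := by field_simp
        _ ≤ 2 * Real.log b ^ 2 * ((2 * R + 1) / δ) :=
            mul_le_mul_of_nonneg_right hb1 (by
              have : 0 < R := hρ.trans hρR
              positivity)
        _ = _ := by ring
  have h5 := hfam.tendsto_zero (fun x hx => ?_) hz
  · simpa using h5.add_const (Complex.log z)
  · have h6 := (Complex.continuous_ofReal.tendsto _).comp (tendsto_sub_div_log_sq h hreg hx)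
    have h7 := h6.sub_const (Complex.log x)
    rw [← Complex.ofReal_log hx.le, sub_self] at h7
    refine h7.congr' ?_
    filter_upwards [eventually_gt_atTop 0] with b hb
    rw [Function.comp_apply, ← Complex.ofReal_mul, h.agrees _ (mul_pos hb hx), h.agrees b hb, ← Complex.ofReal_log hx.le]
    push_cast
    rfl

/-- The increment `F(bz) - F(b)` is of size `(ln b)² ln z` and `f b` of size `(ln b)³ / 3`; their
quotient `3 ln z / ln b` is the source of the factor three. -/
theorem tendsto_log_mul_log_norm (hf : IsBernstein f) (h : IsHolomorphicExtension f F)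
    (hreg : Tendsto (fun s => s * deriv f s / Real.log s ^ 2) atTop (𝓝 1)) {z : ℂ}
    (hz : 0 < z.re) :
    Tendsto (fun b : ℝ => Real.log b * Real.log (‖F (b * z)‖ / f b)) atTop
      (𝓝 (3 * Real.log ‖z‖)) := by
  have h1 := (tendsto_div_log_cube h hreg).inv₀ one_ne_zero
  have h2 := (Complex.continuous_ofReal.tendsto _).comp (h1.const_mul 3)
  have h3 := h2.mul (hf.tendsto_sub_div_log_sq_complex h hreg hz)
  have h4 := tendsto_mul_log_norm_one_add (l := Real.log)
    (w := fun b : ℝ => (F (b * z) - F b) / f b) Real.tendsto_log_atTop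
    (ζ := (3 * 1⁻¹ : ℝ) * Complex.log z) ?_
  · rw [Complex.re_ofReal_mul, Complex.log_re, inv_one, mul_one] at h4
    refine h4.congr' ?_
    filter_upwards [eventually_gt_atTop 0] with b hb
    have hfb := hf.pos h hb
    have hfb' : (f b : ℂ) ≠ 0 := by exact_mod_cast hfb.ne'
    rw [h.agrees b hb, one_add_div hfb', add_sub_cancel, norm_div, Complex.norm_real,
      Real.norm_of_nonneg hfb.le]
  · refine h3.congr' ?_
    filter_upwards [eventually_gt_atTop 1] with b hb
    have hL : (Real.log b : ℂ) ≠ 0 := by exact_mod_cast (Real.log_pos hb).ne'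
    have hfb' : (f b : ℂ) ≠ 0 := by exact_mod_cast (hf.pos h (one_pos.trans hb)).ne'
    rw [Function.comp_apply]
    push_cast
    field_simp

theorem tendsto_log_mul_angleIntegrand (hf : IsBernstein f) (h : IsHolomorphicExtension f F)
    (hreg : Tendsto (fun s => s * deriv f s / Real.log s ^ 2) atTop (𝓝 1)) {y : ℝ}
    (hy : 0 < y) :
    Tendsto (fun b : ℝ => Real.log b * angleIntegrand F b y) atTop (𝓝 (3 * logSlope y)) := by
  have hyI : 0 < ((y : ℂ) + Complex.I).re := by simpa using hy
  have hpos : 0 < ‖(y : ℂ) + Complex.I‖ := norm_pos_iff.2 fun h0 => by simp [h0] at hyI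
  have h1 := (hf.tendsto_log_mul_log_norm h hreg hyI).sub
    (hf.tendsto_log_mul_log_norm h hreg (z := (y : ℂ)) (by simpa using hy))
  rw [← mul_sub, Complex.norm_real, Real.norm_of_nonneg hy.le,
    ← Real.log_div hpos.ne' hy.ne', ← logSlope_eq hy] at h1
  refine h1.congr' ?_
  filter_upwards [eventually_gt_atTop 0] with b hb
  have hfb := hf.pos h hb
  have e1 : ((b * y : ℝ) : ℂ) + (b : ℂ) * Complex.I = b * (y + Complex.I) := by
    push_cast
    ring
  have n1 : 0 < ‖F (b * (y + Complex.I))‖ := norm_pos_iff.2 (hf.ne_zero h (by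
    rw [Complex.re_ofReal_mul]
    positivity))
  have n2 : 0 < ‖F (b * y)‖ := norm_pos_iff.2 (hf.ne_zero h (by
    rw [Complex.re_ofReal_mul, Complex.ofReal_re]
    positivity))
  rw [angleIntegrand, e1, Complex.ofReal_mul, Real.log_div n1.ne' hfb.ne',
    Real.log_div n2.ne' hfb.ne', Real.log_div n1.ne' n2.ne']
  ring

end IsBernstein

/-- From `|ln y| y^(1/4) < 4` and `y^(1/4) ≤ 1`; the constant is `(1 + 4)²`. Near zero it is the
majorant for the integrands of `Θ` and of `s φ'(s)`, and for the Lévy measure. -/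
theorem one_sub_log_sq_le {y : ℝ} (hy : 0 < y) (hy1 : y ≤ 1) :
    (1 - Real.log y) ^ 2 ≤ 25 * y ^ (-(1 / 2) : ℝ) := by
  have h1 := Real.abs_log_mul_self_rpow_lt y (1 / 4) hy hy1 (by norm_num)
  have h2 := Real.log_nonpos hy.le hy1
  have h3 : 0 < y ^ (1 / 4 : ℝ) := Real.rpow_pos_of_pos hy _
  have h4 : y ^ (1 / 4 : ℝ) ≤ 1 := Real.rpow_le_one hy.le hy1 (by norm_num)
  have h5 : (1 - Real.log y) * y ^ (1 / 4 : ℝ) ≤ 5 := by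
    have := neg_abs_le (Real.log y * y ^ (1 / 4 : ℝ))
    rw [one_div_one_div] at h1
    linarith
  have h6 : (y ^ (1 / 4 : ℝ)) ^ 2 * y ^ (-(1 / 2) : ℝ) = 1 := by
    rw [← Real.rpow_natCast, ← Real.rpow_mul hy.le, ← Real.rpow_add hy]
    norm_num
  have h7 : 0 ≤ (1 - Real.log y) * y ^ (1 / 4 : ℝ) := by
    have : 0 ≤ 1 - Real.log y := by linarith
    positivity
  have h8 : 0 < y ^ (-(1 / 2) : ℝ) := Real.rpow_pos_of_pos hy _
  calc (1 - Real.log y) ^ 2 = ((1 - Real.log y) * y ^ (1 / 4 : ℝ)) ^ 2 * y ^ (-(1 / 2) : ℝ) := by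
        rw [mul_pow, mul_assoc, h6, mul_one]
    _ ≤ 5 ^ 2 * y ^ (-(1 / 2) : ℝ) := by gcongr
    _ = _ := by norm_num

/-! ### Dominated convergence for `Θ` in the logarithmic case. -/

namespace IsBernstein

variable {f : ℝ → ℝ} {F : ℂ → ℂ}

theorem exists_log_bounds (h : IsHolomorphicExtension f F)
    (hreg : Tendsto (fun s => s * deriv f s / Real.log s ^ 2) atTop (𝓝 1)) :
    ∃ S : ℝ, 1 < S ∧ ∀ s, S ≤ s → 1 ≤ Real.log s ∧ s * deriv f s ≤ 2 * Real.log s ^ 2 ∧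
      Real.log s ^ 3 / 4 ≤ f s ∧ f s ≤ Real.log s ^ 3 := by
  have h1 := tendsto_div_log_cube h hreg
  obtain ⟨S, hS⟩ := eventually_atTop.1 ((Real.tendsto_log_atTop.eventually_ge_atTop 1).and
    ((hreg.eventually_le_const (show (1 : ℝ) < 2 by norm_num)).and
    ((h1.eventually_const_le (show (3 / 4 : ℝ) < 1 by norm_num)).and
    (h1.eventually_le_const (show (1 : ℝ) < 3 by norm_num)))))
  refine ⟨max S 2, by simp, fun s hs => ?_⟩
  obtain ⟨e1, e2, e3, e4⟩ := hS s ((le_max_left _ _).trans hs)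
  have hL : 0 < Real.log s := by linarith
  rw [div_le_iff₀ (by positivity)] at e2 e4
  rw [le_div_iff₀ (by positivity)] at e3
  exact ⟨e1, e2, by linarith, by linarith⟩

/-- Slow variation improves the universal bound on `(log F)''` by a factor `1 / ln`: the constants
are `32` from `f''/f` and `64` from `(f'/f)²`. -/
theorem log_mul_angleIntegrand_le_of_one_le (hf : IsBernstein f) (h : IsHolomorphicExtension f F)
    {S : ℝ} (hS1 : 1 < S) (hS : ∀ s, S ≤ s → 1 ≤ Real.log s ∧
      s * deriv f s ≤ 2 * Real.log s ^ 2 ∧ Real.log s ^ 3 / 4 ≤ f s) {b y : ℝ} (hb : 2 * S ≤ b)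
    (hy : 1 ≤ y) : Real.log b * angleIntegrand F b y ≤ 96 / y ^ 2 := by
  have hb0 : 0 < b := by linarith
  have hL : 1 ≤ Real.log b := (hS b (by linarith)).1
  have hx : b ≤ b * y := le_mul_of_one_le_right hb0.le hy
  have hx0 : 0 < b * y := by positivity
  have key : ∀ z : ℂ, b * y ≤ z.re → ‖deriv (deriv F) z / F z - (deriv F z / F z) ^ 2‖ ≤
      96 / ((b * y) ^ 2 * Real.log b) := by
    intro z hz
    have hz0 : 0 < z.re := hx0.trans_le hz
    refine (hf.norm_deriv_logDeriv_le' h hz0).trans ?_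
    set t := z.re
    obtain ⟨l1, l2, l3⟩ := hS t (by linarith)
    obtain ⟨_, m2, _⟩ := hS (t / 2) (by linarith)
    have n1 := hf.neg_deriv_deriv_le h hz0
    have n2 := hf.deriv_nonneg hz0
    have hft := hf.pos h hz0
    have m3 : Real.log (t / 2) ^ 2 ≤ Real.log t ^ 2 :=
      pow_le_pow_left₀ (Real.log_nonneg (by linarith))
        (Real.log_le_log (by linarith) (by linarith)) 2
    set l := Real.log t
    have hl0 : 0 < l := by linarith
    have a1 : -deriv (deriv f) t / f t ≤ 32 / (t ^ 2 * l) := by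
      rw [div_le_div_iff₀ hft (by positivity)]
      have e1 : t ^ 2 * -deriv (deriv f) t ≤ 8 * l ^ 2 := by
        have := mul_le_mul_of_nonneg_left n1 hz0.le
        nlinarith
      have e2 := mul_le_mul_of_nonneg_right e1 hl0.le
      nlinarith
    have a2 : deriv f t / f t ≤ 8 / (t * l) := by
      rw [div_le_div_iff₀ hft (by positivity)]
      have e2 := mul_le_mul_of_nonneg_right l2 hl0.le
      nlinarith
    have a3 : (deriv f t / f t) ^ 2 ≤ 64 / (t ^ 2 * l) := by
      refine (pow_le_pow_left₀ (by positivity) a2 2).trans ?_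
      rw [div_pow, div_le_div_iff₀ (by positivity) (by positivity)]
      have e3 : 0 ≤ t ^ 2 * l := by positivity
      nlinarith
    have a4 : (96 : ℝ) / (t ^ 2 * l) ≤ 96 / ((b * y) ^ 2 * Real.log b) := by
      refine div_le_div_of_nonneg_left (by norm_num) (by positivity) ?_
      exact mul_le_mul (pow_le_pow_left₀ hx0.le hz 2)
        (Real.log_le_log hb0 (hx.trans hz)) (by positivity) (by positivity)
    have a5 : 32 / (t ^ 2 * l) + 64 / (t ^ 2 * l) = 96 / (t ^ 2 * l) := by ring
    linarith
  have h1 := hf.vert_le_of_bound h hx0 key b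
  rw [angleIntegrand_eq_vert]
  refine (mul_le_mul_of_nonneg_left h1 (by linarith)).trans (le_of_eq ?_)
  have hL0 : Real.log b ≠ 0 := by linarith
  have hy0 : y ≠ 0 := by linarith
  field_simp

/-- Go from `x` to `b` along the axis, up to `b + ib`, and back to `x + ib`. Each horizontal leg
costs `f b - f x`, and the vertical leg is taken far out, where the derivative is at most `f'(b)`.
-/
theorem norm_sub_ofReal_le (hf : IsBernstein f) (h : IsHolomorphicExtension f F) {x b : ℝ}
    (hx : 0 < x) (hxb : x ≤ b) :
    ‖F (x + b * Complex.I)‖ ≤ f x + (2 * (f b - f x) + b * deriv f b) := by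
  have hb : 0 < b := hx.trans_le hxb
  have hre : ((x : ℂ) + b * Complex.I).re = x := by simp
  have e1 := hf.norm_sub_le h (z := x + b * Complex.I) (by rwa [hre]) (sub_nonneg.2 hxb)
  have e2 := hf.norm_sub_le h (z := x) (by simpa using hx) (sub_nonneg.2 hxb)
  have e3 := hf.norm_sub_le_deriv_mul h hb (z := b + b * Complex.I) (w := b) (by simp) (by simp)
  rw [hre] at e1
  rw [Complex.ofReal_re] at e2
  have c1 : (x : ℂ) + b * Complex.I + (b - x : ℝ) = b + b * Complex.I := by push_cast; ring
  have c2 : (x : ℂ) + (b - x : ℝ) = b := by push_cast; ring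
  rw [c1, add_sub_cancel] at e1
  rw [c2, add_sub_cancel, h.agrees x hx] at e2
  rw [add_sub_cancel_left, norm_mul, Complex.norm_I, mul_one, Complex.norm_real,
    Real.norm_of_nonneg hb.le] at e3
  have n1 : ‖(f x : ℂ)‖ = f x := by
    rw [Complex.norm_real, Real.norm_of_nonneg (hf.nonneg x hx)]
  have t1 : F (x + b * Complex.I) = f x + ((F b - f x) + (F (b + b * Complex.I) - F b) -
      (F (b + b * Complex.I) - F (x + b * Complex.I))) := by ring
  have t2 := norm_add_le (f x : ℂ) ((F b - f x) + (F (b + b * Complex.I) - F b) -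
      (F (b + b * Complex.I) - F (x + b * Complex.I)))
  have t3 := _root_.norm_sub_le ((F b - f x) + (F (b + b * Complex.I) - F b))
      (F (b + b * Complex.I) - F (x + b * Complex.I))
  have t4 := norm_add_le (F b - f x) (F (b + b * Complex.I) - F b)
  rw [t1]
  linarith

/-- If `ln b ≤ -2 ln y`, the universal majorant suffices, since `ln b` is itself bounded in terms of
`y`. Otherwise `ln (b y) > (ln b) / 2`, so `f (b y)` is still of order `(ln b)³` while the
increments are `O((ln b)² (1 - ln y))`. Finally `3200 = 128 · 25`. -/
theorem log_mul_angleIntegrand_le_of_le_one (hf : IsBernstein f) (h : IsHolomorphicExtension f F)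
    {S : ℝ} (hS1 : 1 < S) (hS : ∀ s, S ≤ s → 1 ≤ Real.log s ∧
      s * deriv f s ≤ 2 * Real.log s ^ 2 ∧ Real.log s ^ 3 / 4 ≤ f s) {b y : ℝ} (hb : S ^ 2 ≤ b)
    (hy : 0 < y) (hy1 : y ≤ 1) :
    Real.log b * angleIntegrand F b y ≤ 3200 * y ^ (-(1 / 2) : ℝ) := by
  have hSb : S ≤ b := by nlinarith
  have hb0 : 0 < b := by linarith
  have hL : 1 ≤ Real.log b := (hS b hSb).1
  have hy2 : Real.log y ≤ 0 := Real.log_nonpos hy.le hy1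
  suffices hmain : Real.log b * angleIntegrand F b y ≤ 128 * (1 - Real.log y) ^ 2 by
    linarith [one_sub_log_sq_le hy hy1]
  rcases le_or_gt (Real.log b) (-2 * Real.log y) with hc | hc
  · have h1 := hf.angleIntegrand_le h hb0 hy
    have h2 : logSlope y ≤ 1 - Real.log y := by
      have e1 : Real.log (y ^ 2 + 1) ≤ y ^ 2 := by
        have := Real.log_le_sub_one_of_pos (show 0 < y ^ 2 + 1 by positivity)
        linarith
      have e2 : y ^ 2 ≤ 1 := pow_le_one₀ hy.le hy1
      rw [logSlope]
      linarith
    calc _ ≤ (-2 * Real.log y) * (1 - Real.log y) :=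
          mul_le_mul hc (h1.trans h2) (hf.angleIntegrand_nonneg h hb0 hy) (by linarith)
      _ ≤ _ := by nlinarith
  · have hx0 : 0 < b * y := by positivity
    have hxb : b * y ≤ b := mul_le_of_le_one_right hb0.le hy1
    have hlx : Real.log (b * y) = Real.log b + Real.log y := Real.log_mul hb0.ne' hy.ne'
    have hSx : S ≤ b * y := by
      rw [← Real.log_le_log_iff (by linarith) hx0, hlx]
      have := Real.log_le_log (by positivity) hb
      rw [Real.log_pow] at this
      push_cast at this
      linarith
    obtain ⟨-, b2, -⟩ := hS b hSb
    obtain ⟨x1, -, x3⟩ := hS _ hSx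
    obtain ⟨c, hc1, hc2⟩ := exists_sub_eq_mul_log h hx0 hb0
    rw [uIcc_of_le hxb] at hc1
    have hc0 : 0 < c := hx0.trans_le hc1.1
    obtain ⟨c1, c2, -⟩ := hS c (hSx.trans hc1.1)
    have hcb : Real.log c ≤ Real.log b := Real.log_le_log hc0 hc1.2
    have hc3 : c * deriv f c ≤ 2 * Real.log b ^ 2 :=
      c2.trans (mul_le_mul_of_nonneg_left (pow_le_pow_left₀ (by linarith) hcb 2) (by norm_num))
    have hfx := hf.pos h hx0
    have h1 := hf.norm_sub_ofReal_le h hx0 hxb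
    rw [hlx] at hc2 x1 x3
    have h2 : f b - f (b * y) ≤ 2 * Real.log b ^ 2 * (-Real.log y) := by
      rw [hc2]
      have := mul_le_mul_of_nonneg_right hc3 (neg_nonneg.2 hy2)
      linarith
    set L := Real.log b
    set l := Real.log y
    have h3 : L ^ 3 / 32 ≤ f (b * y) := by
      have e1 : (L / 2) ^ 3 ≤ (L + l) ^ 3 := pow_le_pow_left₀ (by linarith) (by linarith) 3
      have e2 : (L / 2) ^ 3 = L ^ 3 / 8 := by ring
      linarith
    have hn : ‖F ((b * y : ℝ) : ℂ)‖ = f (b * y) := by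
      rw [h.agrees _ hx0, Complex.norm_real, Real.norm_of_nonneg hfx.le]
    have hpos : 0 < ‖F ((b * y : ℝ) + b * Complex.I)‖ :=
      norm_pos_iff.2 (hf.ne_zero h (by simpa using hx0))
    have h4 : angleIntegrand F b y ≤ (4 * L ^ 2 * (-l) + 2 * L ^ 2) / f (b * y) := by
      rw [angleIntegrand, hn]
      refine (Real.log_le_sub_one_of_pos (by positivity)).trans ?_
      rw [sub_le_iff_le_add, div_add_one hfx.ne']
      exact div_le_div_of_nonneg_right (by linarith) hfx.le
    have hL0 : 0 < L := by linarith
    have h5 : (4 * L ^ 2 * (-l) + 2 * L ^ 2) / f (b * y) ≤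
        (4 * L ^ 2 * (-l) + 2 * L ^ 2) / (L ^ 3 / 32) :=
      div_le_div_of_nonneg_left (by
        have : 0 ≤ L ^ 2 * (-l) := mul_nonneg (sq_nonneg L) (by linarith)
        nlinarith [sq_nonneg L]) (by positivity) h3
    calc _ ≤ L * ((4 * L ^ 2 * (-l) + 2 * L ^ 2) / (L ^ 3 / 32)) :=
          mul_le_mul_of_nonneg_left (h4.trans h5) hL0.le
      _ = 128 * (-l) + 64 := by
          field_simp
          ring
      _ ≤ _ := by nlinarith

theorem tendsto_log_mul_Theta (hf : IsBernstein f) (h : IsHolomorphicExtension f F)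
    (hreg : Tendsto (fun s => s * deriv f s / Real.log s ^ 2) atTop (𝓝 1)) :
    Tendsto (fun b : ℝ => Real.log b * Theta F 0 b) atTop (𝓝 (3 * Real.pi / 2)) := by
  obtain ⟨S, hS1, hS⟩ := exists_log_bounds h hreg
  have hS' : ∀ s, S ≤ s → 1 ≤ Real.log s ∧ s * deriv f s ≤ 2 * Real.log s ^ 2 ∧
      Real.log s ^ 3 / 4 ≤ f s := fun s hs => ⟨(hS s hs).1, (hS s hs).2.1, (hS s hs).2.2.1⟩
  set G : ℝ → ℝ := fun y => if y ≤ 1 then 3200 * y ^ (-(1 / 2) : ℝ) else 96 * y ^ (-2 : ℝ) with hG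
  have hGi : IntegrableOn G (Ioi 0) := by
    rw [← Ioc_union_Ioi_eq_Ioi zero_le_one]
    refine IntegrableOn.union ?_ ?_
    · have h1 : IntegrableOn (fun y : ℝ => y ^ (-(1 / 2) : ℝ)) (Ioc 0 1) :=
        (intervalIntegrable_iff_integrableOn_Ioc_of_le zero_le_one).1
          (intervalIntegral.intervalIntegrable_rpow' (by norm_num))
      exact (IntegrableOn.congr_fun (h1.const_mul 3200) (fun y hy => (if_pos hy.2).symm)
        measurableSet_Ioc)
    · have h1 := integrableOn_Ioi_rpow_of_lt (show (-2 : ℝ) < -1 by norm_num) one_pos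
      exact (IntegrableOn.congr_fun (h1.const_mul 96)
        (fun y hy => (if_neg (not_le.2 hy)).symm) measurableSet_Ioi)
  have h1 := tendsto_integral_filter_of_dominated_convergence (l := atTop)
    (μ := volume.restrict (Ioi (0 : ℝ))) (F := fun b y => Real.log b * angleIntegrand F b y)
    (f := fun y => 3 * logSlope y) G ?_ ?_ hGi ?_
  · rw [integral_const_mul, integrableOn_logSlope_and_integral.2, mul_div_assoc'] at h1
    simpa [Theta, integral_const_mul] using h1
  · filter_upwards [eventually_gt_atTop 0] with b hb
    exact ((hf.angleIntegrand_continuousOn h hb).const_smul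
      (Real.log b)).aestronglyMeasurable measurableSet_Ioi
  · filter_upwards [eventually_ge_atTop (2 * S), eventually_ge_atTop (S ^ 2)] with b hb1 hb2
    have hb0 : 0 < b := by linarith
    have hL : 0 ≤ Real.log b := Real.log_nonneg (by linarith)
    filter_upwards [ae_restrict_mem measurableSet_Ioi] with y hy
    have hy0 : 0 < y := hy
    rw [Real.norm_of_nonneg (mul_nonneg hL (hf.angleIntegrand_nonneg h hb0 hy))]
    rcases le_or_gt y 1 with hy1 | hy1
    · rw [hG]
      dsimp only
      rw [if_pos hy1]
      exact hf.log_mul_angleIntegrand_le_of_le_one h hS1 hS' hb2 hy hy1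
    · rw [hG]
      dsimp only
      rw [if_neg (not_le.2 hy1), Real.rpow_neg hy0.le, Real.rpow_ofNat, ← div_eq_mul_inv]
      exact hf.log_mul_angleIntegrand_le_of_one_le h hS1 hS' hb1 hy1.le
  · filter_upwards [ae_restrict_mem measurableSet_Ioi] with y hy
    exact hf.tendsto_log_mul_angleIntegrand h hreg hy

end IsBernstein

namespace Triplet

variable {T : Triplet}

/-! ### The logarithmic example -/

theorem deriv_re_phi (T : Triplet) {s : ℝ} (hs : 0 < s) :
    deriv (fun u : ℝ => (T.phi u).re) s =
      T.sigma ^ 2 + ∫ t in Ioi (0 : ℝ), t * Real.exp (-s * t) * T.tail t := by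
  have h1 := T.phi_isHolomorphicExtension.deriv_eq hs
  rw [(T.hasDerivAt_phi (by simpa using hs)).deriv, tailMoment] at h1
  rw [← Complex.ofReal_inj, ← h1]
  push_cast
  rw [← integral_complex_ofReal]
  congr 1
  refine integral_congr_ae (Eventually.of_forall fun t => ?_)
  push_cast
  rw [pow_one]

/-- The integrand in `s φ'(s) = ∫_0^{s/2} e^{-v} (ln v - ln s)² dv`. -/
noncomputable def logKernel (s v : ℝ) : ℝ :=
  if v ≤ s / 2 then Real.exp (-v) * (Real.log v - Real.log s) ^ 2 else 0

theorem measurable_logKernel (s : ℝ) : Measurable (logKernel s) :=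
  Measurable.ite measurableSet_Iic (by fun_prop) measurable_const

/-- Substitute `v = s t`: the factor `t` cancels the pole of the tail, `ln t` becomes `ln v - ln s`,
and the cutoff `1/2` becomes `s / 2`. -/
theorem IsLogExample.mul_deriv_phi (h : T.IsLogExample) {s : ℝ} (hs : 0 < s) :
    s * deriv (fun u : ℝ => (T.phi u).re) s = ∫ v in Ioi (0 : ℝ), logKernel s v := by
  have h1 := integral_comp_mul_left_Ioi (logKernel s) 0 hs
  rw [mul_zero, smul_eq_mul] at h1
  rw [T.deriv_re_phi hs, h.1, ← mul_inv_cancel_left₀ hs.ne' (∫ v in Ioi (0 : ℝ), logKernel s v),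
    ← h1, sq, mul_zero, zero_add]
  congr 1
  refine setIntegral_congr_fun measurableSet_Ioi fun t ht => ?_
  have ht' : 0 < t := ht
  have h2 : s * t ≤ s / 2 ↔ t ≤ 1 / 2 := by
    rw [div_eq_mul_one_div s, mul_le_mul_iff_right₀ hs]
  rw [h.2 t ht', logKernel, Real.log_mul hs.ne' ht'.ne']
  simp only [h2]
  split_ifs
  · rw [add_sub_cancel_left, neg_mul]
    field_simp
  · ring

/-- The majorant is a combination of the Gamma integrands at `1/2`, `1` and `3`: the first handles
the logarithmic singularity at `0`, the others the growth at infinity. -/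
theorem logKernel_div_le {s v : ℝ} (hs : 1 ≤ Real.log s) (hv : 0 < v) :
    ‖logKernel s v / Real.log s ^ 2‖ ≤
      25 * (Real.exp (-v) * v ^ ((1 / 2 : ℝ) - 1)) + 2 * (Real.exp (-v) * v ^ ((1 : ℝ) - 1)) +
        2 * (Real.exp (-v) * v ^ ((3 : ℝ) - 1)) := by
  have e1 : (1 / 2 : ℝ) - 1 = -(1 / 2) := by norm_num
  have e2 : (1 : ℝ) - 1 = 0 := by norm_num
  have e3 : (3 : ℝ) - 1 = 2 := by norm_num
  rw [e1, e2, e3, Real.rpow_zero, Real.rpow_ofNat]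
  have h0 : 0 < v ^ (-(1 / 2) : ℝ) := Real.rpow_pos_of_pos hv _
  have hE := Real.exp_pos (-v)
  have hL : 0 < Real.log s := by linarith
  rw [logKernel]
  split_ifs
  · rw [Real.norm_of_nonneg (by positivity), mul_div_assoc, ← div_pow]
    have h1 : ((Real.log v - Real.log s) / Real.log s) ^ 2 ≤
        25 * v ^ (-(1 / 2) : ℝ) + 2 + 2 * v ^ 2 := by
      rcases le_or_gt v 1 with hv1 | hv1
      · have h2 := one_sub_log_sq_le hv hv1
        have h3 := Real.log_nonpos hv.le hv1
        have h4 : ((Real.log v - Real.log s) / Real.log s) ^ 2 ≤ (1 - Real.log v) ^ 2 := by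
          rw [sq_le_sq, abs_of_nonpos (div_nonpos_of_nonpos_of_nonneg (by linarith) hL.le),
            abs_of_nonneg (by linarith), ← neg_div, div_le_iff₀ hL]
          nlinarith
        nlinarith
      · have h3 := Real.log_pos hv1
        have h2 := Real.log_le_sub_one_of_pos hv
        have h4 : ((Real.log v - Real.log s) / Real.log s) ^ 2 ≤ (1 + v) ^ 2 := by
          rw [sq_le_sq, abs_div, abs_of_pos hL, abs_of_pos (show 0 < 1 + v by linarith),
            div_le_iff₀ hL, abs_le]
          constructor <;> nlinarith
        nlinarith [sq_nonneg (v - 1)]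
    have := mul_le_mul_of_nonneg_left h1 hE.le
    linarith
  · rw [zero_div, norm_zero]
    positivity

theorem IsLogExample.tendsto_mul_deriv (h : T.IsLogExample) :
    Tendsto (fun s => s * deriv (fun u : ℝ => (T.phi u).re) s / Real.log s ^ 2) atTop (𝓝 1) := by
  have hl := Real.tendsto_log_atTop
  have hi := (((Real.GammaIntegral_convergent (show (0 : ℝ) < 1 / 2 by norm_num)).const_mul
    25).add ((Real.GammaIntegral_convergent one_pos).const_mul 2)).add
    ((Real.GammaIntegral_convergent (show (0 : ℝ) < 3 by norm_num)).const_mul 2)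
  have h1 := tendsto_integral_filter_of_dominated_convergence (l := atTop)
    (μ := volume.restrict (Ioi (0 : ℝ))) (F := fun s v => logKernel s v / Real.log s ^ 2)
    (f := fun v => Real.exp (-v)) _
    (Eventually.of_forall fun s => ((measurable_logKernel s).div_const _).aestronglyMeasurable)
    ?_ hi ?_
  · rw [integral_exp_neg_Ioi_zero] at h1
    refine h1.congr' ?_
    filter_upwards [eventually_gt_atTop 0] with s hs
    rw [integral_div, h.mul_deriv_phi hs]
  · filter_upwards [hl.eventually_ge_atTop 1] with s hs
    filter_upwards [ae_restrict_mem measurableSet_Ioi] with v hv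
    exact logKernel_div_le hs hv
  · filter_upwards [ae_restrict_mem measurableSet_Ioi] with v hv
    have h2 : Tendsto (fun s => Real.exp (-v) * (Real.log v / Real.log s - 1) ^ 2) atTop
        (𝓝 (Real.exp (-v) * (0 - 1) ^ 2)) :=
      (((tendsto_const_nhds.div_atTop hl).sub_const 1).pow 2).const_mul _
    norm_num at h2
    refine h2.congr' ?_
    filter_upwards [eventually_ge_atTop (2 * v), hl.eventually_gt_atTop 0] with s hs hs0
    rw [logKernel, if_pos (by linarith), mul_div_assoc, ← div_pow, sub_div, div_self hs0.ne']

theorem IsLogExample.tail_one_div (h : T.IsLogExample) {x : ℝ} (hx : 2 ≤ x) :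
    T.tail (1 / x) = x * Real.log x ^ 2 := by
  rw [h.2 _ (by positivity), if_pos (one_div_le_one_div_of_le (by norm_num) hx)]
  simp

theorem IsLogExample.inNInfty (h : T.IsLogExample) : T.InNInfty := by
  refine Or.inr ?_
  by_contra hfin
  set M := T.tailZero.toReal
  set x := max 3 (M + 1) with hx
  have hx3 : 3 ≤ x := le_max_left _ _
  have hxM : M + 1 ≤ x := le_max_right _ _
  have h1 := h.tail_one_div (show 2 ≤ x by linarith)
  have h2 : T.tail (1 / x) ≤ M := ENNReal.toReal_mono hfin
    (measure_mono fun y hy => (show 0 < 1 / x by positivity).trans_le hy)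
  have h3 : 1 ≤ Real.log x := by
    rw [Real.le_log_iff_exp_le (by linarith)]
    linarith [Real.exp_one_lt_d9]
  have h4 : 1 ≤ Real.log x ^ 2 := one_le_pow₀ h3
  nlinarith

theorem Nondegenerate.tendsto_log_mul_Theta (hT : T.Nondegenerate) (h : T.IsLogExample) :
    Tendsto (fun b : ℝ => Real.log b * Theta T.phi 0 b) atTop (𝓝 (3 * Real.pi / 2)) :=
  hT.isBernstein.tendsto_log_mul_Theta T.phi_isHolomorphicExtension h.tendsto_mul_deriv

theorem Nondegenerate.Theta_isEquivalent (hT : T.Nondegenerate) (h : T.IsLogExample) :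
    Tendsto (fun b : ℝ => Theta T.phi 0 |b| / (3 * Real.pi / (2 * Real.log |b|)))
      (cocompact ℝ) (𝓝 1) := by
  have h1 := ((hT.tendsto_log_mul_Theta h).div_const (3 * Real.pi / 2)).comp
    (tendsto_norm_cocompact_atTop (E := ℝ))
  rw [div_self (by positivity)] at h1
  refine h1.congr fun b => ?_
  rw [Function.comp_apply, Real.norm_eq_abs]
  have := Real.pi_pos.ne'
  -- When the logarithm vanishes, both expressions are zero by the convention for division by zero.
  rcases eq_or_ne (Real.log |b|) 0 with h0 | h0
  · simp [h0]
  · field_simp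

theorem Nondegenerate.not_inNTheta (hT : T.Nondegenerate) (h : T.IsLogExample) :
    ¬ T.InNTheta := by
  have h1 := (hT.tendsto_log_mul_Theta h).div_atTop Real.tendsto_log_atTop
  have h2 : Tendsto (fun b : ℝ => Theta T.phi 0 b) atTop (𝓝 0) := by
    refine h1.congr' ?_
    filter_upwards [Real.tendsto_log_atTop.eventually_gt_atTop 0] with b hb
    field_simp
  rw [InNTheta, ThetaInf_eq_of_tendsto h2]
  exact lt_irrefl 0

/-- The energy is at least `x (ln x)² / 5` and `φ(x) ≤ (ln x)³`, so each term is of order `1 / ln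
x`. This is weakened to a power of `b` by `ln b ≤ 4 b^(1/4)`, which leaves room for the error `x² /
(2 b²) ≤ 1 / (2 b)`. -/
theorem Nondegenerate.exists_vert_ge (hT : T.Nondegenerate) (h : T.IsLogExample) :
    ∃ S B : ℝ, 1 < S ∧ 1 < B ∧ ∀ b x : ℝ, B ≤ b → S ≤ x → x ≤ √b →
      b ^ (-(1 / 4) : ℝ) / 80 ≤ vert T.phi b x := by
  obtain ⟨S, hS1, hS⟩ := IsBernstein.exists_log_bounds T.phi_isHolomorphicExtension
    h.tendsto_mul_deriv
  obtain ⟨B, hB⟩ := eventually_atTop.1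
    ((tendsto_rpow_atTop (show (0 : ℝ) < 3 / 4 by norm_num)).eventually_ge_atTop 80)
  refine ⟨max S 2, max B 2, by simp, by simp, fun b x hb hx hxb => ?_⟩
  have hb0 : 0 < b := by linarith [(le_max_right B 2).trans hb]
  have hx2 : 2 ≤ x := (le_max_right _ _).trans hx
  have hx0 : 0 < x := by linarith
  have hφ : 0 < (T.phi x).re := hT.isBernstein.pos T.phi_isHolomorphicExtension hx0
  obtain ⟨l1, -, -, l4⟩ := hS x ((le_max_left _ _).trans hx)
  have hbB := hB b ((le_max_left _ _).trans hb)
  have hx_sq : x ^ 2 ≤ b := by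
    have := pow_le_pow_left₀ hx0.le hxb 2
    rwa [Real.sq_sqrt hb0.le] at this
  have hxb' : x ≤ b := by nlinarith
  have hl := Real.log_le_log hx0 hxb'
  have hlb : Real.log b ≤ b ^ (1 / 4 : ℝ) / (1 / 4) := Real.log_le_rpow_div hb0.le (by norm_num)
  set l := Real.log x
  have hl0 : 0 < l := by linarith
  have hE := tail_le_energy (T := T) hx0
  rw [h.tail_one_div hx2] at hE
  have h1 : 1 / (5 * l) ≤ T.energy x / (x * (T.phi x).re) := by
    rw [div_le_div_iff₀ (by positivity) (by positivity)]
    have e1 := mul_le_mul_of_nonneg_left l4 hx0.le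
    have e2 := mul_le_mul_of_nonneg_right hE hl0.le
    nlinarith
  refine le_trans ?_ (hT.vert_ge hx0 hb0)
  have h2 : Real.log (1 + 1 / (5 * l)) ≤ Real.log (1 + T.energy x / (x * (T.phi x).re)) :=
    Real.log_le_log (by positivity) (by linarith)
  have h3 : 1 / (10 * l) ≤ Real.log (1 + 1 / (5 * l)) := by
    refine le_trans ?_ (Real.le_log_one_add_of_nonneg (by positivity))
    rw [div_le_div_iff₀ (by positivity) (by positivity)]
    field_simp
    nlinarith
  have h4 : b ^ (-(1 / 4) : ℝ) / 40 ≤ 1 / (10 * l) := by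
    rw [Real.rpow_neg hb0.le, ← one_div, div_div]
    refine one_div_le_one_div_of_le (by positivity) ?_
    linarith
  have h5 : x ^ 2 / (2 * b ^ 2) ≤ b ^ (-(1 / 4) : ℝ) / 80 := by
    have e1 : b ^ (-(1 / 4) : ℝ) = b ^ (3 / 4 : ℝ) / b := by
      rw [← Real.rpow_sub_one hb0.ne']
      norm_num
    rw [e1, div_le_div_iff₀ (by positivity) (by norm_num), div_mul_eq_mul_div,
      le_div_iff₀ hb0]
    have e2 := mul_le_mul_of_nonneg_right hx_sq hb0.le
    have e3 := mul_le_mul_of_nonneg_right hbB (show 0 ≤ 2 * b ^ 2 by positivity)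
    nlinarith
  linarith

/-- At least `√|b| / 2` terms of size `|b|^(-1/4) / 80` add up to `|b|^(1/4) / 160`, which
eventually exceeds `(ln |b|)³`. -/
theorem Nondegenerate.W_isBigO (hT : T.Nondegenerate) (h : T.IsLogExample) {a : ℝ}
    (ha : T.dphi < a) :
    (fun b : ℝ => W T.phi (a + b * Complex.I)) =O[cocompact ℝ]
      (fun b : ℝ => Real.exp (-(Real.log |b|) ^ 3)) := by
  obtain ⟨S, B, hS1, hB1, hv⟩ := hT.exists_vert_ge h
  obtain ⟨k₀, hk₀⟩ := exists_nat_gt (S - a)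
  have hlo := (isLittleO_log_rpow_rpow_atTop 3 (show (0 : ℝ) < 1 / 4 by norm_num)).bound
    (show (0 : ℝ) < 1 / 160 by norm_num)
  have hsq : Tendsto Real.sqrt atTop atTop := Real.tendsto_sqrt_atTop
  refine Asymptotics.IsBigO.of_bound ‖W T.phi a‖ ?_
  have hn := tendsto_norm_cocompact_atTop (E := ℝ)
  filter_upwards [hn.eventually hlo, hn.eventually_ge_atTop B,
    (hsq.comp hn).eventually_ge_atTop (2 * (|a| + 1 + k₀))] with b h1 h2 h3
  rw [Real.norm_eq_abs b] at h1 h2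
  rw [Function.comp_apply, Real.norm_eq_abs] at h3
  have hb0 : 0 < |b| := by linarith
  have ha1 := neg_abs_le a
  have ha2 := le_abs_self a
  have hk0 : (0 : ℝ) ≤ k₀ := k₀.cast_nonneg
  set N := ⌊√|b| - a⌋₊ with hN
  have hN1 : (N : ℝ) ≤ √|b| - a := Nat.floor_le (by linarith)
  have hN2 : √|b| - a < N + 1 := Nat.lt_floor_add_one _
  have hkN : k₀ ≤ N := Nat.le_floor (by linarith)
  refine (hT.norm_W_le ha b k₀ N).trans (mul_le_mul_of_nonneg_left ?_ (norm_nonneg _))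
  rw [Real.norm_of_nonneg (Real.exp_pos _).le, Real.exp_le_exp, neg_le_neg_iff]
  have hlog : 0 ≤ Real.log |b| := Real.log_nonneg (by linarith)
  rw [Real.rpow_ofNat, Real.norm_of_nonneg (by positivity),
    Real.norm_of_nonneg (by positivity)] at h1
  have hsum : ∑ _k ∈ Finset.Ico k₀ N, |b| ^ (-(1 / 4) : ℝ) / 80 ≤
      ∑ k ∈ Finset.Ico k₀ N, vert T.phi b (a + k) := by
    refine Finset.sum_le_sum fun k hk => ?_
    rw [Finset.mem_Ico] at hk
    have h4 : (k₀ : ℝ) ≤ k := by exact_mod_cast hk.1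
    have h5 : (k : ℝ) ≤ N := by exact_mod_cast hk.2.le
    rw [← hT.isBernstein.vert_abs T.phi_isHolomorphicExtension (show 0 < a + k by linarith)]
    exact hv _ _ h2 (by linarith) (by linarith)
  rw [Finset.sum_const, Nat.card_Ico, nsmul_eq_mul, Nat.cast_sub hkN] at hsum
  refine le_trans ?_ hsum
  refine h1.trans ?_
  have h6 : √|b| / 2 ≤ (N : ℝ) - k₀ := by linarith
  have h7 : √|b| * |b| ^ (-(1 / 4) : ℝ) = |b| ^ (1 / 4 : ℝ) := by
    rw [Real.sqrt_eq_rpow, ← Real.rpow_add hb0]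
    norm_num
  have h8 : 0 ≤ |b| ^ (-(1 / 4) : ℝ) / 80 := by positivity
  have h9 := mul_le_mul_of_nonneg_right h6 h8
  nlinarith

end Triplet

namespace Triplet

/-! ### Existence of the logarithmic example -/

/-- The density of `-d((ln y)² / y)`. -/
noncomputable def logDensity (y : ℝ) : ℝ := (Real.log y ^ 2 - 2 * Real.log y) / y ^ 2

theorem logDensity_nonneg {y : ℝ} (hy : 0 < y) (hy1 : y ≤ 1) : 0 ≤ logDensity y := by
  have := Real.log_nonpos hy.le hy1
  refine div_nonneg ?_ (sq_nonneg y)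
  nlinarith

theorem hasDerivAt_logDensity {y : ℝ} (hy : 0 < y) :
    HasDerivAt (fun t => -(Real.log t ^ 2 / t)) (logDensity y) y := by
  have h1 := ((((Real.hasDerivAt_log hy.ne').pow 2).div (hasDerivAt_id y) hy.ne').neg)
  convert! h1 using 1
  rw [logDensity, id]
  simp only [Pi.pow_apply]
  field_simp
  ring

/-- The Lévy measure with tail `y⁻¹ (ln y)²` on `(0, 1/2]` and no mass to the right of `1/2`. -/
noncomputable def logMeasure : Measure ℝ :=
  (volume.restrict (Ioc (0 : ℝ) (1 / 2))).withDensity (fun y => ENNReal.ofReal (logDensity y)) +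
    ENNReal.ofReal (2 * Real.log (1 / 2) ^ 2) • Measure.dirac (1 / 2)

theorem measurable_logDensity : Measurable logDensity := by
  unfold logDensity
  fun_prop

theorem logMeasure_apply {s : Set ℝ} (hs : MeasurableSet s) :
    logMeasure s = (∫⁻ y in s ∩ Ioc (0 : ℝ) (1 / 2), ENNReal.ofReal (logDensity y)) +
      ENNReal.ofReal (2 * Real.log (1 / 2) ^ 2) * s.indicator 1 (1 / 2) := by
  rw [logMeasure, Measure.add_apply, withDensity_apply _ hs, Measure.restrict_restrict hs,
    Measure.smul_apply, Measure.dirac_apply' _ hs, smul_eq_mul]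

theorem lintegral_logDensity {y : ℝ} (hy : 0 < y) (hy1 : y ≤ 1 / 2) :
    ∫⁻ t in Icc y (1 / 2), ENNReal.ofReal (logDensity t) =
      ENNReal.ofReal (Real.log y ^ 2 / y - 2 * Real.log (1 / 2) ^ 2) := by
  have hcont : ContinuousOn logDensity (Icc y (1 / 2)) := by
    unfold logDensity
    refine ContinuousOn.div ?_ (by fun_prop) fun t ht => pow_ne_zero 2 (hy.trans_le ht.1).ne'
    have hl : ContinuousOn Real.log (Icc y (1 / 2)) := fun t ht =>
      (Real.continuousAt_log (hy.trans_le ht.1).ne').continuousWithinAt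
    exact (hl.pow 2).sub (hl.const_smul (2 : ℝ))
  have hi : IntegrableOn logDensity (Icc y (1 / 2)) := hcont.integrableOn_Icc
  have hint := intervalIntegral.integral_eq_sub_of_hasDerivAt
    (f := fun t => -(Real.log t ^ 2 / t)) (f' := logDensity) (a := y) (b := 1 / 2)
    (fun t ht => by
      rw [uIcc_of_le hy1] at ht
      exact hasDerivAt_logDensity (hy.trans_le ht.1))
    ((intervalIntegrable_iff_integrableOn_Icc_of_le hy1).2 hi)
  rw [← ofReal_integral_eq_lintegral_ofReal hi, integral_Icc_eq_integral_Ioc,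
    ← intervalIntegral.integral_of_le hy1, hint]
  · congr 1
    ring
  · filter_upwards [ae_restrict_mem measurableSet_Icc] with t ht
    exact logDensity_nonneg (hy.trans_le ht.1) (ht.2.trans (by norm_num))

/-- Integrating the density gives the required tail minus its value `2 (ln (1/2))²` at the right
end; the atom at `1/2` restores this amount. -/
theorem logMeasure_Ici {y : ℝ} (hy : 0 < y) (hy1 : y ≤ 1 / 2) :
    logMeasure (Ici y) = ENNReal.ofReal (Real.log y ^ 2 / y) := by
  have h1 : Ici y ∩ Ioc (0 : ℝ) (1 / 2) = Icc y (1 / 2) := by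
    ext t
    simp only [mem_inter_iff, mem_Ici, mem_Ioc, mem_Icc]
    exact ⟨fun h => ⟨h.1, h.2.2⟩, fun h => ⟨h.1, hy.trans_le h.1, h.2⟩⟩
  have hanti : 2 * Real.log (1 / 2) ^ 2 ≤ Real.log y ^ 2 / y := by
    have e1 : Real.log y ≤ Real.log (1 / 2) := Real.log_le_log hy hy1
    have e2 : Real.log (1 / 2) ≤ 0 := Real.log_nonpos (by norm_num) (by norm_num)
    rw [le_div_iff₀ hy]
    nlinarith [sq_nonneg (Real.log (1 / 2))]
  rw [logMeasure_apply measurableSet_Ici, h1, lintegral_logDensity hy hy1,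
    indicator_of_mem (mem_Ici.2 hy1), Pi.one_apply, mul_one,
    ← ENNReal.ofReal_add (by linarith) (by positivity), sub_add_cancel]

theorem logMeasure_Ici_of_lt {y : ℝ} (hy : 1 / 2 < y) : logMeasure (Ici y) = 0 := by
  have h1 : Ici y ∩ Ioc (0 : ℝ) (1 / 2) = ∅ := by
    ext t
    simp only [mem_inter_iff, mem_Ici, mem_Ioc, mem_empty_iff_false, iff_false]
    intro h
    linarith [h.1, h.2.2]
  rw [logMeasure_apply measurableSet_Ici, h1, indicator_of_notMem fun h => not_le.2 hy (mem_Ici.1 h)]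
  simp

theorem logMeasure_Iic_zero : logMeasure (Iic 0) = 0 := by
  have h1 : Iic 0 ∩ Ioc (0 : ℝ) (1 / 2) = ∅ := by
    ext t
    simp only [mem_inter_iff, mem_Iic, mem_Ioc, mem_empty_iff_false, iff_false]
    intro h
    linarith [h.1, h.2.1]
  rw [logMeasure_apply measurableSet_Iic, h1, indicator_of_notMem fun h => by norm_num at h]
  simp

/-- The factor `y²` cancels the denominator of the density, and `(ln y)² - 2 ln y ≤ (1 - ln y)²` is
integrable at zero. -/
theorem lintegral_logMeasure_lt_top :
    ∫⁻ y, ENNReal.ofReal (min (y ^ 2) y) ∂logMeasure < ⊤ := by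
  have hm : Measurable fun y : ℝ => ENNReal.ofReal (min (y ^ 2) y) := by fun_prop
  rw [logMeasure, lintegral_add_measure, lintegral_smul_measure, lintegral_dirac' _ hm,
    lintegral_withDensity_eq_lintegral_mul _ measurable_logDensity.ennreal_ofReal hm]
  refine ENNReal.add_lt_top.2 ⟨?_, ENNReal.mul_lt_top ENNReal.ofReal_lt_top
    ENNReal.ofReal_lt_top⟩
  have h1 : IntegrableOn (fun y : ℝ => y ^ (-(1 / 2) : ℝ)) (Ioc 0 (1 / 2)) :=
    (intervalIntegrable_iff_integrableOn_Ioc_of_le (by norm_num)).1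
      (intervalIntegral.intervalIntegrable_rpow' (by norm_num))
  refine lt_of_le_of_lt (setLIntegral_mono' measurableSet_Ioc fun y hy => ?_)
    (h1.const_mul 25).lintegral_lt_top
  have hy1 : y ≤ 1 := hy.2.trans (by norm_num)
  rw [Pi.mul_apply, ← ENNReal.ofReal_mul (logDensity_nonneg hy.1 hy1)]
  refine ENNReal.ofReal_le_ofReal ?_
  refine (mul_le_mul_of_nonneg_left (min_le_left _ _) (logDensity_nonneg hy.1 hy1)).trans ?_
  refine le_trans ?_ (one_sub_log_sq_le hy.1 hy1)
  rw [logDensity, div_mul_cancel₀ _ (pow_ne_zero 2 hy.1.ne')]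
  nlinarith

theorem exists_isLogExample {m : ℝ} (hm : 0 ≤ m) : ∃ T : Triplet, T.m = m ∧ T.IsLogExample := by
  refine ⟨⟨0, m, logMeasure, le_rfl, hm, logMeasure_Iic_zero, lintegral_logMeasure_lt_top⟩, rfl,
    rfl, fun y hy => ?_⟩
  rw [tail]
  dsimp only
  split_ifs with h
  · rw [logMeasure_Ici hy h, ENNReal.toReal_ofReal (by positivity), div_eq_inv_mul]
  · rw [logMeasure_Ici_of_lt (not_le.1 h), ENNReal.toReal_zero]

end Triplet
end BernsteinWeierstrass

/-! ### Assembly of the theorem. -/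

open BernsteinWeierstrass MeasureTheory Filter Topology in
theorem mainTheorem10 :
    -- Bernstein functions extend holomorphically to the right half-plane
    (∀ f : ℝ → ℝ, IsBernstein f → ∃ F : ℂ → ℂ, IsHolomorphicExtension f F) ∧
    -- all quantities are well defined, and `0 ≤ Θ_φ(a, |b|) ≤ π/2`
    (∀ (f : ℝ → ℝ) (F : ℂ → ℂ), IsBernstein f → IsHolomorphicExtension f F →
      ∀ a b : ℝ, 0 < a →
        WConverges F ((a : ℂ) + (b : ℂ) * Complex.I) ∧
        IntegrableOn (angleIntegrand F |b|) (Set.Ioi (a / |b|)) ∧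
        0 ≤ Theta F a |b| ∧ Theta F a |b| ≤ Real.pi / 2) ∧
    -- the two-sided bound for `|W_φ(a + ib)|`
    (∀ a₀ : ℝ, 0 < a₀ → ∃ c : ℝ, 0 < c ∧
      ∀ (f : ℝ → ℝ) (F : ℂ → ℂ), IsBernstein f → IsHolomorphicExtension f F →
        ∀ a b : ℝ, a₀ ≤ a →
          c * (Real.sqrt (f a) * (W F (a : ℂ)).re /
              Real.sqrt ‖F ((a : ℂ) + (b : ℂ) * Complex.I)‖ * Real.exp (-|b| * Theta F a |b|))
            ≤ ‖W F ((a : ℂ) + (b : ℂ) * Complex.I)‖ ∧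
          ‖W F ((a : ℂ) + (b : ℂ) * Complex.I)‖ ≤
            c⁻¹ * (Real.sqrt (f a) * (W F (a : ℂ)).re /
              Real.sqrt ‖F ((a : ℂ) + (b : ℂ) * Complex.I)‖ * Real.exp (-|b| * Theta F a |b|))) ∧
    -- the class `𝒩`
    (∀ T : Triplet, T.Nondegenerate →
      -- `φ(u) = ψ(u)/u` is a Bernstein function, and `W_φ` is well defined on `Re z > d_φ`
      (∀ z : ℂ, 0 ≤ z.re → T.psi z = z * T.phi z) ∧
      (IsBernstein (fun u : ℝ => (T.phi (u : ℂ)).re) ∧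
        IsHolomorphicExtension (fun u : ℝ => (T.phi (u : ℂ)).re) T.phi) ∧
      (∀ z : ℂ, T.dphi < z.re → WConverges T.phi z) ∧
      -- polynomial decay
      (∀ a u : ℝ, T.dphi < a → (u : EReal) ≤ max (T.Nr - 1) 0 → T.DecaysOfOrder a u) ∧
      (T.InNInfty ↔ ∀ a u : ℝ, T.dphi < a → 0 ≤ u → T.DecaysOfOrder a u) ∧
      -- the range of the liminf, and its specific values
      (∀ b : ℝ, IntegrableOn (angleIntegrand T.phi |b|) (Set.Ioi 0)) ∧
      (0 ≤ ThetaInf T.phi ∧ ThetaInf T.phi ≤ Real.pi / 2) ∧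
      (T.InNP → ThetaInf T.phi = Real.pi / 2 ∧ T.InNTheta) ∧
      (∀ α : ℝ, 0 < α → α < 1 → T.InNAlpha α →
        ThetaInf T.phi = Real.pi / 2 * α ∧ T.InNTheta) ∧
      (T.IsLogExample →
        Tendsto (fun b : ℝ => Theta T.phi 0 |b| / (3 * Real.pi / (2 * Real.log |b|)))
          (cocompact ℝ) (𝓝 1) ∧
        (∀ a : ℝ, T.dphi < a →
          (fun b : ℝ => W T.phi ((a : ℂ) + (b : ℂ) * Complex.I))
            =O[cocompact ℝ] (fun b : ℝ => Real.exp (-(Real.log |b|) ^ 3))) ∧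
        T.InNInfty ∧ ¬ T.InNTheta)) ∧
    -- the logarithmic example exists, for every value of `m`
    (∀ m : ℝ, 0 ≤ m → ∃ T : Triplet, T.m = m ∧ T.IsLogExample) := by 
  refine ⟨fun f hf => hf.exists_extension, fun f F hf h a b ha => ?_, fun a₀ ha₀ => ?_,
    fun T hT => ?_, fun m hm => Triplet.exists_isLogExample hm⟩
  · exact ⟨hf.wConverges h _,
      (hf.integrableOn_angleIntegrand h (abs_nonneg b)).mono_set
        (Set.Ioi_subset_Ioi (div_nonneg ha.le (abs_nonneg b))),
      hf.Theta_nonneg h ha.le (abs_nonneg b), hf.Theta_le h ha.le (abs_nonneg b)⟩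
  -- The constant is `exp (-∑ 10 / (a₀ + k)²)`, which involves `a₀` only.
  · exact ⟨_, Real.exp_pos _, fun f F hf h a b ha => hf.W_bounds h ha₀ ha b⟩
  · have hf := hT.isBernstein
    have h := T.phi_isHolomorphicExtension
    exact ⟨fun z hz => T.psi_eq hz, ⟨hf, h⟩, fun z _ => hf.wConverges h z,
      fun a u ha hu => hT.decaysOfOrder_of_le_Nr ha hu, hT.inNInfty_iff,
      fun b => hf.integrableOn_angleIntegrand h (abs_nonneg b), ThetaInf_mem_Icc hf h,
      hT.ThetaInf_of_inNP, fun α hα _ hT' => hT.ThetaInf_of_inNAlpha hα hT',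
      fun hL => ⟨hT.Theta_isEquivalent hL, fun a ha => hT.W_isBigO hL ha, hL.inNInfty,
        hT.not_inNTheta hL⟩⟩
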